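/- **Setting.** Let $n\ge 1$, $\epsilon>0$, and let $X$ be an anti-symmetric $n\times n$ real matrix with entries in $[-1,1]$ which can be represented exactly with some number $b$ of fractional bits (each entry is a multiple of $2^{-b}$; $b$ is arbitrary). $X$ is accessed through the quantum oracle $O_X|i\rangle|j\rangle|z\rangle=|i\rangle|j\rangle|z\oplus X_{ij}\rangle$. A quantum algorithm starts with qubits in $|0\cdots0\rangle$ and applies two-qubit gates, oracle queries and computational-basis measurements of single qubits; later operations may depend on earlier measurement outcomes. Its gate complexity is the total number of two-qubit gates and oracle queries (measurements are counted as well), in the worst case over the measurement outcomes. Let $\Delta_n=\{w\in\mathbb R^n: w_i\ge 0,\ \sum_i w_i=1\}$. **Algorithm.** Put $N=\max\{n,27\}$ and $T=\lceil 4\epsilon^{-2}\ln N\rceil$. Start with $A=0\in\mathbb Z^n$. In round $t=1,\dots,T$, prepare on fresh qubits the state $$|p_t\rangle=\frac{\sum_{i=1}^n\exp\big[\epsilon\sum_{\tau<t}X_{i,k_\tau}/4\big]\,|i\rangle}{\sqrt{\sum_{j=1}^n\exp\big[\epsilon\sum_{\tau<t}X_{j,k_\tau}/2\big]}},$$ measure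 it in the computational basis, call the outcome $k_t$, and increase $A_{k_t}$ by $1$. Return $\bar w=A/T$. The preparation is done by a quantum subroutine that may depend on $k_1,\dots,k_{t-1}$. Call the subroutine *adequate* for $X$ if, for every round $t\le T$ and all possible $k_1,\dots,k_{t-1}$, its final state is with probability at least $1-\frac1{NT}$ within distance $\frac1{NT}$ in norm of a product of $|p_t\rangle$ and some state of the ancillas. (If a faulty preparation leads to an outcome outside the index range, it is reduced modulo $n$.) **Theorem.** 1. With every state preparation subroutine that is adequate for $X$, the algorithm returns, with probability at least $2/3$, a vector $\bar w\in\Delta_n$ such that $X\bar w\le\epsilon\cdot\mathbf 1_n$ (coordinatewise). 2. There are absolute constants $C$ and $c$ such that for all $n\ge1$, $0<\epsilon\le1$ and $b$ there is a state preparation subroutine, depending on $n,\epsilon,b$ but on $X$ only through the oracle, which is adequate for every such $X$ and with which the whole algorithm has gate complexity at most $$C\,\frac{\sqrt n}{\epsilon^4}\Big(1+\ln\frac n\epsilon\Big)^{c}=\tilde O\Big(\frac{\sqrt n}{\epsilon^4}\Big).$$ In particular, with this subroutine the algorithm returns, with probability at least $2/3$, some $\bar w\in\Delta_n$ with $X\bar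 w\le\epsilon\cdot\mathbf 1_n$. -/

import Mathlib

open scoped Matrix

noncomputable section

namespace ZeroSum

/-! ### Quantum programs: two-qubit gates, oracle queries, measurements -/

/-- Pure states, not necessarily normalised, of qubits labelled by `W`: one complex amplitude for
each computational basis state `x : W → Bool`, with the Euclidean norm. -/
abbrev QState (W : Type) : Type := EuclideanSpace ℂ (W → Bool)

/-- The basis state `|0…0⟩`. -/
def zeroState (W : Type) [Fintype W] : QState W :=
  WithLp.toLp 2 fun x => if x = fun _ => false then 1 else 0

/-- The tensor product `|p⟩ ⊗ |φ⟩` of states of two disjoint sets of qubits. -/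
def tensorState {U V : Type} (p : QState U) (φ : QState V) : QState (U ⊕ V) :=
  WithLp.toLp 2 fun x => p (fun u => x (Sum.inl u)) * φ (fun v => x (Sum.inr v))

/-- The two-qubit gate `G` acting on the qubits `u` and `v`. -/
def applyGate {W : Type} [DecidableEq W] (u v : W) (G : Matrix (Bool × Bool) (Bool × Bool) ℂ)
    (ψ : QState W) : QState W :=
  WithLp.toLp 2 fun x =>
    ∑ c : Bool × Bool, G (x u, x v) c * ψ (Function.update (Function.update x u c.1) v c.2)

/-- The unnormalised state after the qubit `u` was measured with outcome `β`. -/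
def project {W : Type} (u : W) (β : Bool) (ψ : QState W) : QState W :=
  WithLp.toLp 2 fun x => if x u = β then ψ x else 0

/-- The bits in which the entry `y` of an input matrix is written: the two's complement
representation, with `b + 2` bits, of the integer `2 ^ b * y` (when `y` is a multiple of `2⁻ᵇ` with
`|y| ≤ 1`). Bit `0` is the least significant one. -/
def entryBit (b : ℕ) (y : ℝ) (l : Fin (b + 2)) : Bool :=
  Int.testBit ⌊y * 2 ^ b⌋ l

/-- The three registers of an oracle query, placed on pairwise distinct qubits: the row index and
the column index (`q` qubits each), and the entry (`b + 2` qubits). -/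
abbrev Registers (W : Type) (q b : ℕ) : Type := (Fin q ⊕ Fin q ⊕ Fin (b + 2)) ↪ W

/-- The bits of the entry of `X` in row `i` and column `j`, or zeros if there is no such entry. -/
def inputBit {n : ℕ} (b : ℕ) (X : Matrix (Fin n) (Fin n) ℝ) (i j : ℕ) (l : Fin (b + 2)) : Bool :=
  if h : i < n ∧ j < n then entryBit b (X ⟨i, h.1⟩ ⟨j, h.2⟩) l else false

open Classical in
/-- The action `|i⟩|j⟩|z⟩ ↦ |i⟩|j⟩|z ⊕ Xᵢⱼ⟩` of the oracle on computational basis states. Indices are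
counted from `0` and written in binary, with the least significant bit first. -/
def oracleBasis {W : Type} {n q b : ℕ} (X : Matrix (Fin n) (Fin n) ℝ) (r : Registers W q b)
    (x : W → Bool) : W → Bool := fun w =>
  xor (x w) (decide (∃ l, r (Sum.inr (Sum.inr l)) = w ∧
    inputBit b X (Nat.ofBits fun k => x (r (Sum.inl k)))
      (Nat.ofBits fun k => x (r (Sum.inr (Sum.inl k)))) l = true))

/-- The oracle unitary `O_X`. As `oracleBasis X r` is an involution, the amplitude of `O_X ψ` at `x`
is the amplitude of `ψ` at `oracleBasis X r x`. -/
def applyOracle {W : Type} {n q b : ℕ} (X : Matrix (Fin n) (Fin n) ℝ) (r : Registers W q b)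
    (ψ : QState W) : QState W :=
  WithLp.toLp 2 fun x => ψ (oracleBasis X r x)

/-- Quantum programs with classical output in `α`, working on qubits labelled by `W`. Later
instructions may depend on earlier measurement outcomes. The input matrix is not part of a program:
it enters only through the oracle, when the program is run. -/
inductive Prog (W : Type) (q b : ℕ) (α : Type) : Type
  /-- stop, with classical output `out` -/
  | ret (out : α) : Prog W q b α
  /-- apply an arbitrary two-qubit gate -/
  | gate (u v : W) (huv : u ≠ v) (G : Matrix.unitaryGroup (Bool × Bool) ℂ)
      (next : Prog W q b α) : Prog W q b α
  /-- apply the oracle -/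
  | query (r : Registers W q b) (next : Prog W q b α) : Prog W q b α
  /-- measure a qubit in the computational basis -/
  | measure (u : W) (next : Bool → Prog W q b α) : Prog W q b α
  /-- discard all qubits and continue on fresh ones in the state `|0…0⟩` -/
  | fresh (next : Prog W q b α) : Prog W q b α

namespace Prog

variable {W : Type} {q b : ℕ} {α β : Type}

/-- Sequential composition: run the first program, then, on the same qubits, the program that its
classical output selects. -/
def bind : Prog W q b α → (α → Prog W q b β) → Prog W q b β
  | ret out, f => f out
  | gate u v huv G next, f => gate u v huv G (bind next f)
  | query r next, f => query r (bind next f)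
  | measure u next, f => measure u fun c => bind (next c) f
  | fresh next, f => fresh (bind next f)

/-- Gate complexity: the total number of oracle queries and two-qubit gates, along the worst
sequence of measurement outcomes. Measurements and `fresh` are charged one unit as well. -/
def cost : Prog W q b α → ℕ
  | ret _ => 0
  | gate _ _ _ _ next => 1 + cost next
  | query _ next => 1 + cost next
  | measure _ next => 1 + max (cost (next false)) (cost (next true))
  | fresh next => 1 + cost next

open Classical in
/-- The probability that a run with input matrix `X` and initial state `ψ` ends with a classical
output `out` and a final state `χ` such that `E out χ`. States are carried along unnormalised: on
each sequence of measurement outcomes the squared norm of the state is the probability of that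
sequence. -/
def probFrom [Fintype W] [DecidableEq W] {n : ℕ} (X : Matrix (Fin n) (Fin n) ℝ)
    (E : α → QState W → Prop) : Prog W q b α → QState W → ℝ
  | ret out, ψ => if E out ψ then ‖ψ‖ ^ 2 else 0
  | gate u v _ G next, ψ => probFrom X E next (applyGate u v G.1 ψ)
  | query r next, ψ => probFrom X E next (applyOracle X r ψ)
  | measure u next, ψ =>
      probFrom X E (next false) (project u false ψ) + probFrom X E (next true) (project u true ψ)
  | fresh next, ψ => probFrom X E next ((‖ψ‖ : ℂ) • zeroState W)

/-- The probability of the event `E` in a run that starts in `|0…0⟩`. -/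
def prob [Fintype W] [DecidableEq W] {n : ℕ} (X : Matrix (Fin n) (Fin n) ℝ)
    (P : Prog W q b α) (E : α → QState W → Prop) : ℝ :=
  probFrom X E P (zeroState W)

/-- Measure `k` qubits in the computational basis and return the outcomes. -/
def measureAll : (k : ℕ) → (Fin k → W) → Prog W q b (Fin k → Bool)
  | 0, _ => ret Fin.elim0
  | k + 1, w => measure (w 0) fun c =>
      bind (measureAll k fun i => w i.succ) fun x => ret (Fin.cons c x)

end Prog

/-! ### The algorithm -/

/-- The number of qubits of an index register: `⌈log₂ n⌉`. -/
abbrev idxLen (n : ℕ) : ℕ := Nat.clog 2 n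

/-- The qubits of the algorithm: an index register and `a` ancillas. -/
abbrev Wires (n a : ℕ) : Type := Fin (idxLen n) ⊕ Fin a

/-- Admissible inputs: anti-symmetric matrices with entries in `[-1, 1]` that fit into the entry
register of the oracle (all entries are multiples of `2⁻ᵇ`; the precision `b` is arbitrary). -/
structure IsInput {n : ℕ} (b : ℕ) (X : Matrix (Fin n) (Fin n) ℝ) : Prop where
  antisymm : Xᵀ = -X
  bounded : ∀ i j, |X i j| ≤ 1
  representable : ∀ i j, ∃ z : ℤ, X i j = z / 2 ^ b

/-- The number of rounds `T = ⌈4 ε⁻² ln (max n 27)⌉`. -/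
def numRounds (n : ℕ) (ε : ℝ) : ℕ := ⌈4 * Real.log (max n 27 : ℕ) / ε ^ 2⌉₊

/-- The state of the index register to be measured after the outcomes `k₁, …, kₜ`:
`∑ᵢ exp(ε ∑_τ X i k_τ / 4) |i⟩ / √(∑ⱼ exp(ε ∑_τ X j k_τ / 2))`. -/
def targetState {n : ℕ} (X : Matrix (Fin n) (Fin n) ℝ) (ε : ℝ) (ks : List (Fin n)) :
    QState (Fin (idxLen n)) :=
  WithLp.toLp 2 fun x =>
    if h : Nat.ofBits x < n then
      ((Real.exp (ε * (ks.map fun k => X ⟨_, h⟩ k).sum / 4) /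
        √(∑ j, Real.exp (ε * (ks.map fun k => X j k).sum / 2)) : ℝ) : ℂ)
    else 0

/-- The state `ψ` of index register and ancillas is, up to an error `δ` in norm, the product of `p`
in the index register and some state of the ancillas. -/
def HasPrepared {n a : ℕ} (p : QState (Fin (idxLen n))) (δ : ℝ) (ψ : QState (Wires n a)) : Prop :=
  ∃ φ : QState (Fin a), ‖φ‖ = ‖ψ‖ ∧ ‖ψ - tensorState p φ‖ ≤ δ * ‖ψ‖

/-- The program `P`, started in `|0…0⟩`, prepares the state `p` in the index register: with
probability at least `1 - δ` its final state is `p`, up to an error `δ` in norm. -/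
def Prepares {n b a : ℕ} (X : Matrix (Fin n) (Fin n) ℝ) (p : QState (Fin (idxLen n))) (δ : ℝ)
    (P : Prog (Wires n a) (idxLen n) b Unit) : Prop :=
  1 - δ ≤ P.prob X fun _ ψ => HasPrepared p δ ψ

/-- The accuracy `1 / (max n 27 * T)` asked of the state preparation in each of the `T` rounds. -/
def tolerance (n : ℕ) (ε : ℝ) : ℝ := 1 / ((max n 27 : ℕ) * numRounds n ε)

/-- The subroutine `prep` prepares in each round, whatever the outcomes of the previous rounds were,
the state that is to be measured. -/
def IsStatePrep {n b a : ℕ} (X : Matrix (Fin n) (Fin n) ℝ) (ε : ℝ)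
    (prep : List (Fin n) → Prog (Wires n a) (idxLen n) b Unit) : Prop :=
  ∀ ks : List (Fin n), ks.length < numRounds n ε →
    Prepares X (targetState X ε ks) (tolerance n ε) (prep ks)

/-- `t` more rounds of the algorithm after the outcomes `ks`: on fresh qubits, prepare the state
for `ks`, measure the index register, and append the outcome to `ks`. (An outcome that is not below
`n`, which can only come from an imperfect preparation, is reduced modulo `n`.) -/
def rounds {n b a : ℕ} [NeZero n] (prep : List (Fin n) → Prog (Wires n a) (idxLen n) b Unit) :
    ℕ → List (Fin n) → Prog (Wires n a) (idxLen n) b (List (Fin n))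
  | 0, ks => .ret ks
  | t + 1, ks => .fresh <| (prep ks).bind fun _ =>
      (Prog.measureAll (idxLen n) Sum.inl).bind fun x =>
        rounds prep t (ks ++ [Fin.ofNat n (Nat.ofBits x)])

/-- The zero-sum game algorithm with state preparation `prep`: run `T` rounds and return
`w = A / T`, where `A i` is the number of rounds with outcome `i`. -/
def algorithm {n b a : ℕ} [NeZero n] (ε : ℝ)
    (prep : List (Fin n) → Prog (Wires n a) (idxLen n) b Unit) :
    Prog (Wires n a) (idxLen n) b (Fin n → ℝ) :=
  (rounds prep (numRounds n ε) []).bind fun ks =>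
    .ret fun i => (ks.count i : ℝ) / numRounds n ε

/-- The probability that the algorithm returns some `w` in the simplex `Δ_n` with `X w ≤ ε`. -/
def successProb {n b a : ℕ} [NeZero n] (X : Matrix (Fin n) (Fin n) ℝ) (ε : ℝ)
    (prep : List (Fin n) → Prog (Wires n a) (idxLen n) b Unit) : ℝ :=
  (algorithm ε prep).prob X fun w _ => w ∈ stdSimplex ℝ (Fin n) ∧ ∀ i, (X *ᵥ w) i ≤ ε

end ZeroSum

end

/-!
Correctness of the algorithm rests on the potential `∑ᵢ exp (ε sᵢ / 2)` of the accumulated payoffs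
`s`. If the next column is drawn from the Gibbs distribution, anti-symmetry turns the expected
growth into a `cosh`, so that the potential grows by at most the factor `exp (ε² / 8)` per round
(`sum_potential_append_le`). A run in which some payoff exceeds `ε T` has a final potential above
`exp (ε² T / 2)`, and Markov's inequality bounds the probability of such a run; an adequate
preparation adds at most `3 / (N T)` per round (`expect_rounds_le`, `two_thirds_le_successProb`).
All probabilities are computed with `Prog.expect`, which runs a program and sums a weight over its
final states.

The state preparation is made of gates that are one-qubit gates controlled by at most one qubit; no
reversible arithmetic is needed. An integer-valued form `L` of the index, linear in the index and in
the truncated entries of one row, acts by phases `exp (2 π i L / 2 ^ (l + 1))`, which are products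
of phases controlled by index bits and by queried bits. Stage `l` of `Circ.compute` puts such a
phase between two Hadamard gates and thereby writes bit `l` of `L` into a register
(`Circ.run_compute_ket`). One qubit per bit of `L` is then rotated, under the control of that bit,
so that the part of the state in which none of these qubits is set is multiplied by
`∏ l, lam l ^ (bit l of L)`. With `lam l = exp (-θ 2 ^ l)` for the low bits, `lam = 0` for two sign
bits and `L = 2 ^ (s + 1) (n - 1 - i) + d i`, this factor is `exp (-θ d i)` for the indices `i < n`
with `0 ≤ d i`, and zero for all others (`damping_dampFactor`).

Amplitude amplification with a random number of iterations finds this part with probability at least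
`1 / 4` when its norm is at least of the order `1 / √n` (`exists_restrict_run_iter`,
`quarter_le_avg_sin_sq`). That is the case for `θ = 0` if some `0 ≤ d i`, and for every `θ` if the
least `d i` is zero. The first case decides whether some truncated payoff reaches a threshold, so
that bisection finds the maximum `M` of the payoffs; the second one, for `d = M - s`, then prepares
the Gibbs amplitudes (`le_expect_prepByBisection`). Truncating the entries to `precision n ε` bits
keeps the error below the tolerance, and the cost independent of `b` (`hasPrepared_expVec`).

One attempt costs of the order of `√n` iterations of `T` queries each, there are `T` rounds, and
`T = O (log n / ε²)`; everything else is logarithmic (`cost_attempt_le`, `exists_isStatePrep`).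
-/

open scoped Matrix

noncomputable section

namespace ZeroSum

section

/-! ### Weighted runs of programs -/

namespace Prog

variable {W : Type} [Fintype W] [DecidableEq W] {n q b : ℕ} {α β : Type}
  {X : Matrix (Fin n) (Fin n) ℝ}

/-- The sum of the weights `F out χ` over all sequences of measurement outcomes of a run, where
`out` is the classical output and `χ` the unnormalised final state. With `F out χ = ‖χ‖ ^ 2` on an
event and `0` outside it, this is the probability of the event. -/
def expect (X : Matrix (Fin n) (Fin n) ℝ) (F : α → QState W → ℝ) : Prog W q b α → QState W → ℝ
  | ret out, ψ => F out ψ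
  | gate u v _ G next, ψ => expect X F next (applyGate u v G.1 ψ)
  | query r next, ψ => expect X F next (applyOracle X r ψ)
  | measure u next, ψ =>
      expect X F (next false) (project u false ψ) + expect X F (next true) (project u true ψ)
  | fresh next, ψ => expect X F next ((‖ψ‖ : ℂ) • zeroState W)

open Classical in
theorem probFrom_eq_expect (E : α → QState W → Prop) (P : Prog W q b α) (ψ : QState W) :
    probFrom X E P ψ = expect X (fun a χ => if E a χ then ‖χ‖ ^ 2 else 0) P ψ := by
  induction P generalizing ψ with
  | ret out => simp [probFrom, expect]
  | gate u v h G next ih => simp only [probFrom, expect, ih]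
  | query r next ih => simp only [probFrom, expect, ih]
  | measure u next ih => simp only [probFrom, expect, ih]
  | fresh next ih => simp only [probFrom, expect, ih]

theorem expect_bind (F : β → QState W → ℝ) (P : Prog W q b α) (f : α → Prog W q b β)
    (ψ : QState W) :
    expect X F (bind P f) ψ = expect X (fun a χ => expect X F (f a) χ) P ψ := by
  induction P generalizing ψ with
  | ret out => simp [bind, expect]
  | gate u v h G next ih => simp only [bind, expect, ih]
  | query r next ih => simp only [bind, expect, ih]
  | measure u next ih => simp only [bind, expect, ih]
  | fresh next ih => simp only [bind, expect, ih]

theorem expect_mono {F G : α → QState W → ℝ} (h : ∀ a χ, F a χ ≤ G a χ) (P : Prog W q b α)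
    (ψ : QState W) : expect X F P ψ ≤ expect X G P ψ := by
  induction P generalizing ψ with
  | ret out => exact h _ _
  | gate u v h G next ih => exact ih _
  | query r next ih => exact ih _
  | measure u next ih => exact add_le_add (ih _ _) (ih _ _)
  | fresh next ih => exact ih _

theorem expect_add (F G : α → QState W → ℝ) (P : Prog W q b α) (ψ : QState W) :
    expect X (fun a χ => F a χ + G a χ) P ψ = expect X F P ψ + expect X G P ψ := by
  induction P generalizing ψ with
  | ret out => rfl
  | gate u v h G next ih => exact ih _
  | query r next ih => exact ih _
  | measure u next ih => simp only [expect, ih]; ring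
  | fresh next ih => exact ih _

theorem expect_const_mul (c : ℝ) (F : α → QState W → ℝ) (P : Prog W q b α) (ψ : QState W) :
    expect X (fun a χ => c * F a χ) P ψ = c * expect X F P ψ := by
  induction P generalizing ψ with
  | ret out => rfl
  | gate u v h G next ih => exact ih _
  | query r next ih => exact ih _
  | measure u next ih => simp only [expect, ih]; ring
  | fresh next ih => exact ih _

end Prog

/-! ### Gates and queries are linear isometries -/

variable {W : Type} {n q b : ℕ} {X : Matrix (Fin n) (Fin n) ℝ}

theorem applyGate_apply [DecidableEq W] (u v : W) (G : Matrix (Bool × Bool) (Bool × Bool) ℂ)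
    (ψ : QState W) (x : W → Bool) : applyGate u v G ψ x =
      ∑ c : Bool × Bool, G (x u, x v) c * ψ (Function.update (Function.update x u c.1) v c.2) :=
  rfl

theorem applyGate_add [DecidableEq W] (u v : W) (G : Matrix (Bool × Bool) (Bool × Bool) ℂ)
    (ψ φ : QState W) : applyGate u v G (ψ + φ) = applyGate u v G ψ + applyGate u v G φ := by
  ext x; simp [applyGate, mul_add, Finset.sum_add_distrib]

theorem applyGate_smul [DecidableEq W] (u v : W) (G : Matrix (Bool × Bool) (Bool × Bool) ℂ)
    (c : ℂ) (ψ : QState W) : applyGate u v G (c • ψ) = c • applyGate u v G ψ := by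
  ext x; simp [applyGate, Fintype.sum_prod_type]; ring

theorem applyOracle_add (r : Registers W q b) (ψ φ : QState W) :
    applyOracle X r (ψ + φ) = applyOracle X r ψ + applyOracle X r φ := by
  ext x; simp [applyOracle]

theorem applyOracle_smul (r : Registers W q b) (c : ℂ) (ψ : QState W) :
    applyOracle X r (c • ψ) = c • applyOracle X r ψ := by
  ext x; simp [applyOracle]

theorem project_smul (u : W) (β : Bool) (c : ℂ) (ψ : QState W) :
    project u β (c • ψ) = c • project u β ψ := by
  ext x; simp [project]

theorem sum_update [Fintype W] [DecidableEq W] (u : W) (f : (W → Bool) → ℝ) :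
    ∑ x, ∑ d : Bool, f (Function.update x u d) = 2 * ∑ x, f x := by
  have hinv : Function.Involutive fun x : W → Bool => Function.update x u (!x u) := by
    intro x; simp
  have h : ∀ x : W → Bool, ∑ d : Bool, f (Function.update x u d)
      = f x + f (Function.update x u (!x u)) := by
    intro x
    have hx : Function.update x u (x u) = x := Function.update_eq_self _ _
    cases hu : x u <;> rw [hu] at hx <;> simp [hx, add_comm]
  rw [Finset.sum_congr rfl fun x _ => h x, Finset.sum_add_distrib, two_mul]
  congr 1
  exact Equiv.sum_comp hinv.toPerm f

theorem sum_norm_sq_mulVec {ι : Type*} [Fintype ι] [DecidableEq ι]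
    (G : Matrix.unitaryGroup ι ℂ) (f : ι → ℂ) :
    ∑ d, ‖∑ c, G.1 d c * f c‖ ^ 2 = ∑ c, ‖f c‖ ^ 2 := by
  have key : ∀ g : ι → ℂ, ((∑ d, ‖g d‖ ^ 2 : ℝ) : ℂ) = star g ⬝ᵥ g := by
    intro g
    simp only [dotProduct, Pi.star_apply, Complex.ofReal_sum]
    refine Finset.sum_congr rfl fun d _ => ?_
    rw [Complex.ofReal_pow, ← Complex.conj_mul']; rfl
  apply Complex.ofReal_injective
  have h1 := key (G.1 *ᵥ f)
  rw [key f]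
  have : (fun d => ∑ c, G.1 d c * f c) = G.1 *ᵥ f := rfl
  have h2 : ((∑ d, ‖∑ c, G.1 d c * f c‖ ^ 2 : ℝ) : ℂ) = star (G.1 *ᵥ f) ⬝ᵥ (G.1 *ᵥ f) := h1
  rw [h2, Matrix.star_mulVec, Matrix.dotProduct_mulVec, Matrix.vecMul_vecMul,
    ← Matrix.star_eq_conjTranspose, Matrix.mem_unitaryGroup_iff'.1 G.2, Matrix.vecMul_one]

theorem norm_sq_eq_sum [Fintype W] [DecidableEq W] (ψ : QState W) : ‖ψ‖ ^ 2 = ∑ x, ‖ψ x‖ ^ 2 :=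
  EuclideanSpace.norm_sq_eq ψ

theorem norm_applyGate [Fintype W] [DecidableEq W] {u v : W} (huv : u ≠ v)
    (G : Matrix.unitaryGroup (Bool × Bool) ℂ) (ψ : QState W) :
    ‖applyGate u v G.1 ψ‖ = ‖ψ‖ := by
  -- Each side is averaged over the four settings of the qubits `u` and `v`.
  have two : ∀ f : (W → Bool) → ℝ,
      ∑ x, ∑ d : Bool × Bool, f (Function.update (Function.update x u d.1) v d.2)
        = 4 * ∑ x, f x := by
    intro f
    simp only [Fintype.sum_prod_type]
    rw [sum_update u fun x => ∑ d : Bool, f (Function.update x v d), sum_update v f]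
    ring
  have h : ‖applyGate u v G.1 ψ‖ ^ 2 = ‖ψ‖ ^ 2 := by
    rw [norm_sq_eq_sum, norm_sq_eq_sum]
    have e1 := two fun x => ‖(applyGate u v G.1 ψ) x‖ ^ 2
    have e2 := two fun x => ‖ψ x‖ ^ 2
    have e3 : ∀ x : W → Bool,
        ∑ d : Bool × Bool, ‖(applyGate u v G.1 ψ)
            (Function.update (Function.update x u d.1) v d.2)‖ ^ 2
          = ∑ d : Bool × Bool, ‖ψ (Function.update (Function.update x u d.1) v d.2)‖ ^ 2 := by
      intro x
      rw [← sum_norm_sq_mulVec G fun c : Bool × Bool =>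
        ψ (Function.update (Function.update x u c.1) v c.2)]
      refine Finset.sum_congr rfl fun d _ => ?_
      refine congrArg (fun z : ℂ => ‖z‖ ^ 2) ?_
      rw [applyGate_apply]
      refine Finset.sum_congr rfl fun c _ => ?_
      have hc : Function.update (Function.update (Function.update (Function.update x u d.1) v d.2)
          u c.1) v c.2 = Function.update (Function.update x u c.1) v c.2 := by
        rw [Function.update_comm huv.symm, Function.update_idem, Function.update_idem]
      rw [hc]
      simp [Function.update_of_ne huv]
    rw [Finset.sum_congr rfl fun x _ => e3 x] at e1
    linarith
  exact (sq_eq_sq₀ (norm_nonneg _) (norm_nonneg _)).1 h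

theorem oracleBasis_of_notMem (r : Registers W q b) (x : W → Bool) {w : W}
    (hw : ∀ l, r (Sum.inr (Sum.inr l)) ≠ w) : oracleBasis X r x w = x w := by
  simp [oracleBasis, hw]

theorem oracleBasis_entry (r : Registers W q b) (x : W → Bool) (l : Fin (b + 2)) :
    oracleBasis X r x (r (Sum.inr (Sum.inr l))) =
      xor (x (r (Sum.inr (Sum.inr l))))
        (inputBit b X (Nat.ofBits fun k => x (r (Sum.inl k)))
          (Nat.ofBits fun k => x (r (Sum.inr (Sum.inl k)))) l) := by
  unfold oracleBasis
  congr 1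
  simp

theorem oracleBasis_involutive (r : Registers W q b) :
    Function.Involutive (oracleBasis X r) := by
  intro x
  funext w
  by_cases hw : ∃ l, r (Sum.inr (Sum.inr l)) = w
  · obtain ⟨l, rfl⟩ := hw
    have h1 : ∀ k, oracleBasis X r x (r (Sum.inl k)) = x (r (Sum.inl k)) := fun k =>
      oracleBasis_of_notMem r x (by simp)
    have h2 : ∀ k, oracleBasis X r x (r (Sum.inr (Sum.inl k))) = x (r (Sum.inr (Sum.inl k))) :=
      fun k => oracleBasis_of_notMem r x (by simp)
    rw [oracleBasis_entry, oracleBasis_entry]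
    simp [h1, h2]
  · push Not at hw
    rw [oracleBasis_of_notMem r _ hw, oracleBasis_of_notMem r _ hw]

theorem norm_applyOracle [Fintype W] [DecidableEq W] (r : Registers W q b) (ψ : QState W) :
    ‖applyOracle X r ψ‖ = ‖ψ‖ := by
  have h : ‖applyOracle X r ψ‖ ^ 2 = ‖ψ‖ ^ 2 := by
    rw [norm_sq_eq_sum, norm_sq_eq_sum]
    exact Equiv.sum_comp (oracleBasis_involutive (X := X) r).toPerm fun x => ‖ψ x‖ ^ 2
  exact (sq_eq_sq₀ (norm_nonneg _) (norm_nonneg _)).1 h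

theorem norm_sq_project_add [Fintype W] [DecidableEq W] (u : W) (ψ : QState W) :
    ‖project u false ψ‖ ^ 2 + ‖project u true ψ‖ ^ 2 = ‖ψ‖ ^ 2 := by
  simp only [norm_sq_eq_sum, ← Finset.sum_add_distrib, project]
  refine Finset.sum_congr rfl fun x _ => ?_
  cases x u <;> simp

theorem norm_zeroState [Fintype W] [DecidableEq W] : ‖zeroState W‖ = 1 := by
  have : zeroState W = EuclideanSpace.single (fun _ => false) 1 := by
    ext x; simp [zeroState]
  rw [this]; simp

section

namespace Prog

variable [Fintype W] [DecidableEq W] {α β : Type}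

/-- The probabilities of all sequences of outcomes add up to the squared norm of the initial
state. -/
theorem expect_norm_sq (P : Prog W q b α) (ψ : QState W) :
    expect X (fun _ χ => ‖χ‖ ^ 2) P ψ = ‖ψ‖ ^ 2 := by
  induction P generalizing ψ with
  | ret out => rfl
  | gate u v h G next ih => simp only [expect, ih, norm_applyGate h]
  | query r next ih => simp only [expect, ih, norm_applyOracle]
  | measure u next ih => simp only [expect, ih, norm_sq_project_add]
  | fresh next ih => simp [expect, ih, norm_smul, norm_zeroState]

theorem expect_smul {F : α → QState W → ℝ} (hF : ∀ a (c : ℂ) χ, F a (c • χ) = ‖c‖ ^ 2 * F a χ)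
    (P : Prog W q b α) (c : ℂ) (ψ : QState W) :
    expect X F P (c • ψ) = ‖c‖ ^ 2 * expect X F P ψ := by
  induction P generalizing ψ c with
  | ret out => exact hF _ _ _
  | gate u v h G next ih => simp only [expect, ih, applyGate_smul]
  | query r next ih => simp only [expect, ih, applyOracle_smul]
  | measure u next ih => simp only [expect, ih, project_smul]; ring
  | fresh next ih =>
    simp only [expect, norm_smul, Complex.ofReal_mul, mul_smul]
    rw [ih]; simp

/-- The unnormalised state after the qubits `w 0, …, w (k-1)` were measured with outcomes `z`. -/
def projectAll {k : ℕ} (w : Fin k → W) (z : Fin k → Bool) (ψ : QState W) : QState W :=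
  WithLp.toLp 2 fun x => if ∀ i, x (w i) = z i then ψ x else 0

theorem expect_measureAll (k : ℕ) (w : Fin k → W) (F : (Fin k → Bool) → QState W → ℝ)
    (ψ : QState W) :
    expect X F (measureAll k w : Prog W q b _) ψ = ∑ z, F z (projectAll w z ψ) := by
  induction k generalizing ψ with
  | zero =>
    have h : ∀ z, projectAll w z ψ = ψ := fun z => by ext x; simp [projectAll]
    rw [Fintype.sum_unique, h]
    simp only [measureAll, expect]
    congr 1
  | succ k ih =>
    have e : ∀ c : Bool, ∀ z : Fin k → Bool,
        projectAll (fun i => w i.succ) z (project (w 0) c ψ)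
          = projectAll w (Fin.cons c z : Fin (k + 1) → Bool) ψ := by
      intro c z
      ext x
      simp only [projectAll, project, Fin.forall_fin_succ, Fin.cons_zero, Fin.cons_succ]
      by_cases h1 : x (w 0) = c <;> by_cases h2 : ∀ i, x (w (Fin.succ i)) = z i <;> simp [h1, h2]
    simp only [measureAll, expect, expect_bind, ih, e]
    rw [← (Fin.consEquiv fun _ : Fin (k + 1) => Bool).sum_comp, Fintype.sum_prod_type]
    simp [Fin.consEquiv, add_comm]

end Prog

end

/-! ### Cost of composite programs -/

namespace Prog

variable {α β : Type}

theorem cost_bind_le (P : Prog W q b α) (f : α → Prog W q b β) {K : ℕ}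
    (hf : ∀ a, cost (f a) ≤ K) : cost (bind P f) ≤ cost P + K := by
  induction P with
  | ret out => simpa [bind, cost] using hf out
  | gate u v h G next ih => simp only [bind, cost]; omega
  | query r next ih => simp only [bind, cost]; omega
  | measure u next ih =>
    have h1 := ih false
    have h2 := ih true
    simp only [bind, cost]; omega
  | fresh next ih => simp only [bind, cost]; omega

theorem cost_measureAll (k : ℕ) (w : Fin k → W) :
    cost (measureAll k w : Prog W q b _) ≤ k := by
  induction k with
  | zero => simp [measureAll, cost]
  | succ k ih =>
    have h : ∀ c, cost (bind (measureAll k fun i => w i.succ : Prog W q b _)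
        fun x => ret (Fin.cons c x : Fin (k + 1) → Bool)) ≤ k := fun c => by
      have h1 := cost_bind_le (measureAll k fun i => w i.succ : Prog W q b _)
        (fun x => ret (Fin.cons c x : Fin (k + 1) → Bool)) (K := 0) (by simp [cost])
      have h2 := ih fun i => w i.succ
      omega
    have h1 := h false
    have h2 := h true
    simp only [measureAll, cost]
    omega

end Prog

end

section

/-! ### Sums over bit strings -/

theorem sum_ofBits {M : Type*} [AddCommMonoid M] (q : ℕ) (F : ℕ → M) :
    ∑ x : Fin q → Bool, F (Nat.ofBits x) = ∑ m ∈ Finset.range (2 ^ q), F m := by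
  refine Finset.sum_nbij' (fun x => Nat.ofBits x) (fun m k => m.testBit k) ?_ ?_ ?_ ?_ ?_
  · intro x _; simpa using Nat.ofBits_lt_two_pow x
  · intro m _; simp
  · intro x _; funext k; simp [Nat.testBit_ofBits_lt]
  · intro m hm
    rw [Nat.ofBits_testBit, Nat.mod_eq_of_lt (by simpa using hm)]
  · intro x _; rfl

theorem le_two_pow_idxLen (n : ℕ) : n ≤ 2 ^ idxLen n := Nat.le_pow_clog (by norm_num) n

theorem sum_ofBits_dite {M : Type*} [AddCommMonoid M] {n q : ℕ} (hn : n ≤ 2 ^ q) (F : Fin n → M) :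
    ∑ x : Fin q → Bool, (if h : Nat.ofBits x < n then F ⟨_, h⟩ else 0) = ∑ i, F i := by
  rw [sum_ofBits q fun m => if h : m < n then F ⟨m, h⟩ else 0]
  rw [← Finset.sum_subset (s₁ := Finset.range n) (by intro m; simp; omega)
    (by intro m _ hm; simp at hm; simp [hm])]
  rw [Finset.sum_range]
  simp

/-! ### The exponential potential -/

/-- The accumulated payoff of row `i` against the columns `ks`. -/
def score {n : ℕ} (X : Matrix (Fin n) (Fin n) ℝ) (ks : List (Fin n)) (i : Fin n) : ℝ :=
  (ks.map fun k => X i k).sum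

/-- The potential `∑ᵢ exp(ε sᵢ / 2)`, where `s` is the vector of scores. -/
def potential {n : ℕ} (X : Matrix (Fin n) (Fin n) ℝ) (ε : ℝ) (ks : List (Fin n)) : ℝ :=
  ∑ i, Real.exp (ε * score X ks i / 2)

variable {n : ℕ} {X : Matrix (Fin n) (Fin n) ℝ} {ε : ℝ}

theorem potential_pos [NeZero n] (ks : List (Fin n)) : 0 < potential X ε ks :=
  Finset.sum_pos (fun _ _ => Real.exp_pos _) ⟨0, Finset.mem_univ _⟩

theorem score_append (ks : List (Fin n)) (k i : Fin n) :
    score X (ks ++ [k]) i = score X ks i + X i k := by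
  simp [score]

/-- When the next column is drawn from the Gibbs distribution, the potential grows in expectation
by at most the factor `exp(ε² / 8)`: anti-symmetry turns `exp` into `cosh`. -/
theorem sum_potential_append_le [NeZero n] (hX : Xᵀ = -X) (hb : ∀ i j, |X i j| ≤ 1)
    (ks : List (Fin n)) :
    ∑ k, Real.exp (ε * score X ks k / 2) / potential X ε ks * potential X ε (ks ++ [k])
      ≤ Real.exp (ε ^ 2 / 8) * potential X ε ks := by
  set e : Fin n → ℝ := fun i => Real.exp (ε * score X ks i / 2) with he
  have hP := potential_pos (X := X) (ε := ε) ks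
  have hanti : ∀ i k, X k i = - X i k := fun i k => by
    have := congrFun (congrFun hX i) k
    simpa using this
  have h1 : ∀ k, potential X ε (ks ++ [k]) = ∑ i, e i * Real.exp (ε * X i k / 2) := by
    intro k
    refine Finset.sum_congr rfl fun i _ => ?_
    rw [he, ← Real.exp_add, score_append]; congr 1; ring
  set S := ∑ k, ∑ i, e k * e i * Real.exp (ε * X i k / 2) with hS
  have h2 : S = ∑ k, ∑ i, e k * e i * Real.exp (-(ε * X i k / 2)) := by
    rw [hS, Finset.sum_comm]
    refine Finset.sum_congr rfl fun i _ => Finset.sum_congr rfl fun k _ => ?_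
    rw [hanti k i]; ring_nf
  have h3 : S ≤ Real.exp (ε ^ 2 / 8) * (potential X ε ks * potential X ε ks) := by
    have h4 : 2 * S = ∑ k, ∑ i, e k * e i * (2 * Real.cosh (ε * X i k / 2)) := by
      rw [two_mul]
      nth_rewrite 2 [h2]
      rw [hS, ← Finset.sum_add_distrib]
      refine Finset.sum_congr rfl fun i _ => ?_
      rw [← Finset.sum_add_distrib]
      refine Finset.sum_congr rfl fun k _ => ?_
      rw [Real.cosh_eq]; ring
    have h5 : ∑ k, ∑ i, e k * e i * (2 * Real.cosh (ε * X i k / 2))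
        ≤ ∑ k, ∑ i, e k * e i * (2 * Real.exp (ε ^ 2 / 8)) := by
      refine Finset.sum_le_sum fun k _ => Finset.sum_le_sum fun i _ => ?_
      have hx : X i k ^ 2 ≤ 1 := (sq_le_one_iff_abs_le_one _).2 (hb i k)
      have : Real.cosh (ε * X i k / 2) ≤ Real.exp (ε ^ 2 / 8) :=
        (Real.cosh_le_exp_half_sq _).trans (Real.exp_le_exp.2 (by nlinarith [sq_nonneg ε]))
      have he0 : 0 ≤ e k * e i := (mul_pos (Real.exp_pos _) (Real.exp_pos _)).le
      gcongr
    have h6 : ∑ k, ∑ i, e k * e i * (2 * Real.exp (ε ^ 2 / 8))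
        = 2 * (Real.exp (ε ^ 2 / 8) * (potential X ε ks * potential X ε ks)) := by
      simp only [← Finset.sum_mul, ← Finset.mul_sum]
      change (∑ i, e i) * (∑ i, e i) * _ = 2 * (_ * ((∑ i, e i) * (∑ i, e i)))
      ring
    linarith
  have h7 : ∑ k, e k / potential X ε ks * potential X ε (ks ++ [k]) = S / potential X ε ks := by
    rw [hS, Finset.sum_div]
    refine Finset.sum_congr rfl fun k _ => ?_
    rw [h1, Finset.mul_sum, Finset.sum_div]
    refine Finset.sum_congr rfl fun i _ => ?_
    field_simp
  rw [h7, div_le_iff₀ hP]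
  linarith

/-! ### Measuring an approximately prepared state -/

theorem sum_mul_norm_sq_targetState [NeZero n] (ks : List (Fin n)) (g : Fin n → ℝ) :
    ∑ z, g (Fin.ofNat n (Nat.ofBits z)) * ‖targetState X ε ks z‖ ^ 2
      = ∑ k, Real.exp (ε * score X ks k / 2) / potential X ε ks * g k := by
  rw [← sum_ofBits_dite (le_two_pow_idxLen n)]
  refine Finset.sum_congr rfl fun z _ => ?_
  by_cases h : Nat.ofBits z < n
  · have hz : Fin.ofNat n (Nat.ofBits z) = ⟨Nat.ofBits z, h⟩ := by
      ext; simp [Nat.mod_eq_of_lt h]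
    have hP := potential_pos (X := X) (ε := ε) ks
    have hs : √(∑ j, Real.exp (ε * (ks.map fun k => X j k).sum / 2)) ^ 2 = potential X ε ks :=
      Real.sq_sqrt hP.le
    simp only [targetState, h, dif_pos, hz]
    rw [Complex.norm_real, Real.norm_eq_abs, sq_abs, div_pow, hs, ← Real.exp_nat_mul,
      mul_comm (g _)]
    congr 3
    unfold score; push_cast; ring
  · simp [targetState, h]

/-- Damping the amplitudes by `√g`, where `g` is a function of the index register. -/
def weightState {q a : ℕ} (g : (Fin q → Bool) → ℝ) (ψ : QState (Fin q ⊕ Fin a)) :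
    QState (Fin q ⊕ Fin a) :=
  WithLp.toLp 2 fun x => (√(g fun i => x (Sum.inl i)) : ℂ) * ψ x

theorem norm_sq_weightState {q a : ℕ} {g : (Fin q → Bool) → ℝ} (h0 : ∀ z, 0 ≤ g z)
    (ψ : QState (Fin q ⊕ Fin a)) :
    ‖weightState g ψ‖ ^ 2 = ∑ x, g (fun i => x (Sum.inl i)) * ‖ψ x‖ ^ 2 := by
  rw [norm_sq_eq_sum]
  refine Finset.sum_congr rfl fun x _ => ?_
  simp [weightState, mul_pow, Real.sq_sqrt (h0 _)]

theorem norm_sq_projectAll_sum {q a : ℕ} (g : (Fin q → Bool) → ℝ) (ψ : QState (Fin q ⊕ Fin a)) :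
    ∑ z, g z * ‖Prog.projectAll Sum.inl z ψ‖ ^ 2
      = ∑ x, g (fun i => x (Sum.inl i)) * ‖ψ x‖ ^ 2 := by
  simp only [norm_sq_eq_sum, Finset.mul_sum]
  rw [Finset.sum_comm]
  refine Finset.sum_congr rfl fun x _ => ?_
  rw [Finset.sum_eq_single fun i => x (Sum.inl i)]
  · simp [Prog.projectAll]
  · intro z _ hz
    have : ¬ ∀ i, x (Sum.inl i) = z i := fun h => hz (funext fun i => (h i).symm)
    simp [Prog.projectAll, this]
  · simp

theorem sum_norm_sq_tensorState {q a : ℕ} (g : (Fin q → Bool) → ℝ) (p : QState (Fin q))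
    (φ : QState (Fin a)) :
    ∑ x, g (fun i => x (Sum.inl i)) * ‖tensorState p φ x‖ ^ 2
      = (∑ z, g z * ‖p z‖ ^ 2) * ‖φ‖ ^ 2 := by
  rw [← (Equiv.sumArrowEquivProdArrow (Fin q) (Fin a) Bool).symm.sum_comp, Fintype.sum_prod_type,
    norm_sq_eq_sum, Finset.sum_mul_sum]
  refine Finset.sum_congr rfl fun z _ => Finset.sum_congr rfl fun y _ => ?_
  simp [tensorState, Equiv.sumArrowEquivProdArrow, mul_pow, mul_assoc]

theorem weightState_add {q a : ℕ} (g : (Fin q → Bool) → ℝ) (ψ φ : QState (Fin q ⊕ Fin a)) :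
    weightState g (ψ + φ) = weightState g ψ + weightState g φ := by
  ext x; simp [weightState, mul_add]

theorem norm_weightState_le {q a : ℕ} {g : (Fin q → Bool) → ℝ} (h0 : ∀ z, 0 ≤ g z)
    (h1 : ∀ z, g z ≤ 1) (ψ : QState (Fin q ⊕ Fin a)) : ‖weightState g ψ‖ ≤ ‖ψ‖ := by
  refine le_of_sq_le_sq ?_ (norm_nonneg _)
  rw [norm_sq_weightState h0, norm_sq_eq_sum]
  refine Finset.sum_le_sum fun x _ => ?_
  nlinarith [h1 fun i => x (Sum.inl i), sq_nonneg ‖ψ x‖]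

theorem norm_tensorState {q a : ℕ} (p : QState (Fin q)) (φ : QState (Fin a)) :
    ‖tensorState p φ‖ = ‖p‖ * ‖φ‖ := by
  have h := sum_norm_sq_tensorState (fun _ => 1) p φ
  simp only [one_mul, ← norm_sq_eq_sum, ← mul_pow] at h
  exact (sq_eq_sq₀ (norm_nonneg _) (by positivity)).1 h

/-- The expectation of a function of the measured index changes by at most `2 δ` when a state is
replaced by one at distance `δ`. -/
theorem sum_projectAll_le_of_near {q a : ℕ} {g : (Fin q → Bool) → ℝ} (h0 : ∀ z, 0 ≤ g z)
    (h1 : ∀ z, g z ≤ 1) {p : QState (Fin q)} (hp : ‖p‖ = 1) {δ : ℝ}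
    {ψ : QState (Fin q ⊕ Fin a)} {φ : QState (Fin a)} (hφ : ‖φ‖ = ‖ψ‖)
    (h : ‖ψ - tensorState p φ‖ ≤ δ * ‖ψ‖) :
    ∑ z, g z * ‖Prog.projectAll Sum.inl z ψ‖ ^ 2
      ≤ (∑ z, g z * ‖p z‖ ^ 2 + 2 * δ) * ‖ψ‖ ^ 2 := by
  set η := tensorState p φ with hη
  have hηn : ‖η‖ = ‖ψ‖ := by rw [hη, norm_tensorState, hp, one_mul, hφ]
  have e1 : ∑ z, g z * ‖Prog.projectAll Sum.inl z ψ‖ ^ 2 = ‖weightState g ψ‖ ^ 2 := by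
    rw [norm_sq_projectAll_sum, norm_sq_weightState h0]
  have e2 : (∑ z, g z * ‖p z‖ ^ 2) * ‖ψ‖ ^ 2 = ‖weightState g η‖ ^ 2 := by
    rw [norm_sq_weightState h0, hη, sum_norm_sq_tensorState, hφ]
  have t1 : ‖weightState g ψ‖ ≤ ‖weightState g η‖ + δ * ‖ψ‖ := by
    have : weightState g ψ = weightState g η + weightState g (ψ - η) := by
      rw [← weightState_add]; simp
    rw [this]
    exact (norm_add_le _ _).trans (add_le_add le_rfl ((norm_weightState_le h0 h1 _).trans h))
  have t2 := norm_weightState_le h0 h1 ψ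
  have t3 := norm_weightState_le h0 h1 η
  rw [hηn] at t3
  have t4 := norm_nonneg (weightState g ψ)
  have t5 := norm_nonneg (weightState g η)
  have t6 : 0 ≤ δ * ‖ψ‖ := (norm_nonneg _).trans h
  rw [e1, add_mul, e2]
  nlinarith [norm_nonneg ψ]

theorem hasPrepared_smul {a : ℕ} {p : QState (Fin (idxLen n))} {δ : ℝ} {ψ : QState (Wires n a)}
    (c : ℂ) (h : HasPrepared p δ ψ) : HasPrepared p δ (c • ψ) := by
  obtain ⟨φ, h1, h2⟩ := h
  refine ⟨c • φ, by rw [norm_smul, norm_smul, h1], ?_⟩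
  have : c • ψ - tensorState p (c • φ) = c • (ψ - tensorState p φ) := by
    ext x; simp [tensorState]; ring
  rw [this, norm_smul, norm_smul]
  nlinarith [norm_nonneg c]

open Classical in
/-- The probability of preparing `p` scales with the squared norm of the initial state. -/
theorem expect_hasPrepared_smul {a b : ℕ} (p : QState (Fin (idxLen n))) (δ : ℝ)
    (P : Prog (Wires n a) (idxLen n) b Unit) (c : ℂ) (ψ : QState (Wires n a)) :
    P.expect X (fun _ χ => if HasPrepared p δ χ then ‖χ‖ ^ 2 else 0) (c • ψ)
      = ‖c‖ ^ 2 * P.expect X (fun _ χ => if HasPrepared p δ χ then ‖χ‖ ^ 2 else 0) ψ := by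
  refine Prog.expect_smul (fun _ c χ => ?_) P c ψ
  by_cases hc : c = 0
  · simp [hc]
  · have : HasPrepared p δ (c • χ) ↔ HasPrepared p δ χ := by
      refine ⟨fun h => ?_, hasPrepared_smul c⟩
      have := hasPrepared_smul c⁻¹ h
      rwa [smul_smul, inv_mul_cancel₀ hc, one_smul] at this
    by_cases h : HasPrepared p δ χ <;> simp [this, h, norm_smul, mul_pow]

/-! ### Correctness of the algorithm with an adequate state preparation -/

theorem norm_targetState [NeZero n] (ks : List (Fin n)) : ‖targetState X ε ks‖ = 1 := by
  have h := sum_mul_norm_sq_targetState (X := X) (ε := ε) ks fun _ => 1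
  have hP := potential_pos (X := X) (ε := ε) ks
  simp only [one_mul, mul_one, ← norm_sq_eq_sum, ← Finset.sum_div] at h
  have h2 : ‖targetState X ε ks‖ ^ 2 = 1 ^ 2 := by
    rw [h, one_pow]; exact div_self hP.ne'
  exact (sq_eq_sq₀ (norm_nonneg _) (by norm_num)).1 h2

open Classical in
/-- Failure bound for the remaining `t` rounds: the truncated potential, discounted to the last
round, plus `3 δ` for every imperfect preparation (`δ` for its failure, `2 δ` for its error). -/
theorem expect_rounds_le [NeZero n] {b a : ℕ} (hX : IsInput b X)
    {prep : List (Fin n) → Prog (Wires n a) (idxLen n) b Unit} (hprep : IsStatePrep X ε prep)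
    (hε : 0 < ε) (t : ℕ) (ks : List (Fin n)) (hlen : ks.length + t = numRounds n ε)
    (ψ : QState (Wires n a)) :
    (rounds prep t ks).expect X (fun l χ => if l.length ≠ numRounds n ε ∨
        ∃ i, ε * numRounds n ε < score X l i then ‖χ‖ ^ 2 else 0) ψ
      ≤ (min 1 (Real.exp (t * (ε ^ 2 / 8) - ε ^ 2 * numRounds n ε / 2) * potential X ε ks)
          + 3 * t * tolerance n ε) * ‖ψ‖ ^ 2 := by
  set T := numRounds n ε with hT
  set δ := tolerance n ε with hδ
  have hδ0 : 0 ≤ δ := by rw [hδ, tolerance]; positivity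
  induction t generalizing ks ψ with
  | zero =>
    simp only [rounds, Prog.expect]
    have hl : ks.length = T := by omega
    split_ifs with h
    · obtain ⟨i, hi⟩ := h.resolve_left (by simp [hl])
      have h1 : Real.exp (ε ^ 2 * T / 2) ≤ potential X ε ks := by
        refine le_trans (Real.exp_le_exp.2 ?_)
          (Finset.single_le_sum (f := fun i => Real.exp (ε * score X ks i / 2))
            (fun _ _ => (Real.exp_pos _).le) (Finset.mem_univ i))
        nlinarith
      have h2 : 1 ≤ Real.exp ((0 : ℕ) * (ε ^ 2 / 8) - ε ^ 2 * T / 2) * potential X ε ks := by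
        refine le_trans ?_ (mul_le_mul_of_nonneg_left h1 (Real.exp_pos _).le)
        rw [← Real.exp_add]; simp
      rw [min_eq_left h2]; simp
    · have := potential_pos (X := X) (ε := ε) ks
      have h1 : 0 ≤ min 1 (Real.exp ((0 : ℕ) * (ε ^ 2 / 8) - ε ^ 2 * T / 2) * potential X ε ks) :=
        le_min zero_le_one (by positivity)
      have h2 : 0 ≤ 3 * ((0 : ℕ) : ℝ) * δ := by simp
      exact mul_nonneg (add_nonneg h1 h2) (sq_nonneg _)
  | succ t ih =>
    have hlt : ks.length < T := by omega
    set c := Real.exp (t * (ε ^ 2 / 8) - ε ^ 2 * T / 2) with hc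
    set G : Fin n → ℝ := fun k => min 1 (c * potential X ε (ks ++ [k])) with hG
    have hG0 : ∀ k, 0 ≤ G k := fun k =>
      le_min zero_le_one (mul_nonneg (Real.exp_pos _).le (potential_pos _).le)
    have hG1 : ∀ k, G k ≤ 1 := fun k => min_le_left _ _
    set g : (Fin (idxLen n) → Bool) → ℝ := fun z => G (Fin.ofNat n (Nat.ofBits z)) with hg
    set A := min 1 (Real.exp ((t + 1 : ℕ) * (ε ^ 2 / 8) - ε ^ 2 * T / 2) * potential X ε ks)
      with hA
    have hA0 : 0 ≤ A := le_min zero_le_one (mul_nonneg (Real.exp_pos _).le (potential_pos _).le)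
    have hgp : ∑ z, g z * ‖targetState X ε ks z‖ ^ 2 ≤ A := by
      rw [hg, sum_mul_norm_sq_targetState]
      have hP := potential_pos (X := X) (ε := ε) ks
      refine le_min ?_ ?_
      · calc _ ≤ ∑ k, Real.exp (ε * score X ks k / 2) / potential X ε ks * 1 :=
              Finset.sum_le_sum fun k _ => mul_le_mul_of_nonneg_left (hG1 k) (by positivity)
          _ = 1 := by
              simp only [mul_one, ← Finset.sum_div]
              exact div_self hP.ne'
      · calc _ ≤ ∑ k, Real.exp (ε * score X ks k / 2) / potential X ε ks
                * (c * potential X ε (ks ++ [k])) :=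
              Finset.sum_le_sum fun k _ =>
                mul_le_mul_of_nonneg_left (min_le_right _ _) (by positivity)
          _ = c * ∑ k, Real.exp (ε * score X ks k / 2) / potential X ε ks
                * potential X ε (ks ++ [k]) := by
              rw [Finset.mul_sum]; exact Finset.sum_congr rfl fun k _ => by ring
          _ ≤ c * (Real.exp (ε ^ 2 / 8) * potential X ε ks) :=
              mul_le_mul_of_nonneg_left (sum_potential_append_le hX.antisymm hX.bounded ks)
                (Real.exp_pos _).le
          _ = _ := by
              rw [hc, ← mul_assoc, ← Real.exp_add]; congr 2; push_cast; ring
    have hstep : ∀ z (χ : QState (Wires n a)),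
        (rounds prep t (ks ++ [Fin.ofNat n (Nat.ofBits z)])).expect X (fun l χ =>
          if l.length ≠ T ∨ ∃ i, ε * T < score X l i then ‖χ‖ ^ 2 else 0)
            (Prog.projectAll Sum.inl z χ)
          ≤ (g z + 3 * t * δ) * ‖Prog.projectAll Sum.inl z χ‖ ^ 2 := fun z χ =>
      ih _ _ (by rw [List.length_append, List.length_singleton]; omega)
    have htot : ∀ χ : QState (Wires n a),
        ∑ z, ‖Prog.projectAll (Sum.inl : Fin (idxLen n) → Wires n a) z χ‖ ^ 2 = ‖χ‖ ^ 2 := by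
      intro χ
      have := norm_sq_projectAll_sum (fun _ => 1) χ
      simpa only [one_mul, ← norm_sq_eq_sum] using this
    have hpt : ∀ (_ : Unit) (χ : QState (Wires n a)),
        ((Prog.measureAll (idxLen n) Sum.inl).bind fun x =>
          rounds prep t (ks ++ [Fin.ofNat n (Nat.ofBits x)])).expect X (fun l χ =>
          if l.length ≠ T ∨ ∃ i, ε * T < score X l i then ‖χ‖ ^ 2 else 0) χ
        ≤ (A + 2 * δ + 3 * t * δ + 1) * ‖χ‖ ^ 2
            + (-1) * (if HasPrepared (targetState X ε ks) δ χ then ‖χ‖ ^ 2 else 0) := by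
      intro _ χ
      rw [Prog.expect_bind, Prog.expect_measureAll]
      refine (Finset.sum_le_sum fun z _ => hstep z χ).trans ?_
      simp only [add_mul, Finset.sum_add_distrib]
      rw [← Finset.mul_sum, htot]
      have hχ := sq_nonneg ‖χ‖
      split_ifs with h
      · obtain ⟨φ, h1, h2⟩ := h
        have := sum_projectAll_le_of_near (g := g) (fun z => hG0 _) (fun z => hG1 _)
          (norm_targetState ks) h1 h2
        nlinarith
      · have : ∑ z, g z * ‖Prog.projectAll Sum.inl z χ‖ ^ 2 ≤ ‖χ‖ ^ 2 := by
          rw [← htot χ]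
          refine Finset.sum_le_sum fun z _ => ?_
          nlinarith [hG1 (Fin.ofNat n (Nat.ofBits z)),
            sq_nonneg ‖Prog.projectAll Sum.inl z χ‖]
        nlinarith [mul_nonneg hA0 hχ, mul_nonneg hδ0 hχ]
    have hprob := hprep ks hlt
    unfold Prepares Prog.prob at hprob
    rw [Prog.probFrom_eq_expect] at hprob
    have hfin := Prog.expect_mono (X := X) hpt (prep ks) ((‖ψ‖ : ℂ) • zeroState _)
    rw [Prog.expect_add, Prog.expect_const_mul, Prog.expect_const_mul, Prog.expect_norm_sq,
      expect_hasPrepared_smul] at hfin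
    simp only [norm_smul, norm_zeroState, Complex.norm_real, norm_norm, mul_one] at hfin
    simp only [rounds, Prog.expect]
    rw [Prog.expect_bind]
    refine hfin.trans ?_
    push_cast
    nlinarith [sq_nonneg ‖ψ‖, mul_le_mul_of_nonneg_left hprob (sq_nonneg ‖ψ‖)]

theorem sum_mul_count (ks : List (Fin n)) (f : Fin n → ℝ) :
    ∑ k, f k * (ks.count k : ℝ) = (ks.map f).sum := by
  induction ks with
  | nil => simp
  | cons a l ih =>
    simp only [List.count_cons, List.map_cons, List.sum_cons, ← ih]
    simp [mul_add, Finset.sum_add_distrib, add_comm]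

theorem numRounds_pos (n : ℕ) (hε : 0 < ε) : 0 < numRounds n ε := by
  refine Nat.ceil_pos.2 (div_pos (mul_pos (by norm_num) (Real.log_pos ?_)) (by positivity))
  have : 27 ≤ max n 27 := le_max_right _ _
  exact_mod_cast lt_of_lt_of_le (by norm_num) this

/-- The failure probability is at most `2 / 9` for the potential plus `1 / 9` for the
preparations. -/
theorem two_thirds_le_successProb [NeZero n] {b a : ℕ} (hX : IsInput b X) (hε : 0 < ε)
    {prep : List (Fin n) → Prog (Wires n a) (idxLen n) b Unit} (hprep : IsStatePrep X ε prep) :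
    2 / 3 ≤ successProb X ε prep := by
  classical
  set T := numRounds n ε with hT
  have hT0 : 0 < T := numRounds_pos n hε
  have hTr : (0 : ℝ) < T := by exact_mod_cast hT0
  set N := max n 27 with hN
  have hN27 : (27 : ℝ) ≤ N := by exact_mod_cast le_max_right n 27
  have hnN : (n : ℝ) ≤ N := by exact_mod_cast le_max_left n 27
  have hfail := expect_rounds_le hX hprep hε T [] (by simp [hT]) (zeroState _)
  rw [norm_zeroState] at hfail
  have hpot : potential X ε [] = n := by simp [potential, score]
  -- The potential bound: `n exp(-3 ε² T / 8) ≤ N ^ (-1/2) ≤ 2/9`.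
  have h1 : Real.exp (T * (ε ^ 2 / 8) - ε ^ 2 * T / 2) * n ≤ 2 / 9 := by
    have hlog : 4 * Real.log N ≤ ε ^ 2 * T := by
      have := Nat.le_ceil (4 * Real.log (max n 27 : ℕ) / ε ^ 2)
      rw [div_le_iff₀ (by positivity)] at this
      rw [hT, numRounds]; linarith
    have hNpos : (0 : ℝ) < N := by linarith
    have hexp : Real.exp (T * (ε ^ 2 / 8) - ε ^ 2 * T / 2) ≤ Real.exp (-(3 / 2) * Real.log N) :=
      Real.exp_le_exp.2 (by linarith)
    have h2 : Real.exp (-(3 / 2) * Real.log N) ^ 2 * N ^ 3 = 1 := by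
      have : (N : ℝ) = Real.exp (Real.log N) := (Real.exp_log hNpos).symm
      nth_rewrite 2 [this]
      rw [← Real.exp_nat_mul, ← Real.exp_nat_mul, ← Real.exp_add]
      simp; ring
    set E := Real.exp (-(3 / 2) * Real.log N)
    have hE : 0 < E := Real.exp_pos _
    have h3 : E * N ≤ 2 / 9 := by
      have h4 : (E * N) ^ 2 * N = 1 := by rw [← h2]; ring
      by_contra hcon
      push Not at hcon
      nlinarith [mul_pos hE hNpos]
    calc _ ≤ E * N := mul_le_mul hexp hnN (by positivity) hE.le
      _ ≤ _ := h3
  have h2 : 3 * (T : ℝ) * tolerance n ε ≤ 1 / 9 := by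
    have : 3 * (T : ℝ) * tolerance n ε = 3 / N := by
      rw [tolerance, ← hT, ← hN]; field_simp
    rw [this, div_le_div_iff₀ (by linarith) (by norm_num)]; linarith
  have h3 := min_le_right 1
    (Real.exp (T * (ε ^ 2 / 8) - ε ^ 2 * T / 2) * potential X ε [])
  rw [hpot] at h3 hfail
  rw [← hT] at hfail
  unfold successProb Prog.prob algorithm
  rw [Prog.probFrom_eq_expect, Prog.expect_bind, ← hT]
  have htot := Prog.expect_norm_sq (X := X) (rounds prep T []) (zeroState _)
  rw [norm_zeroState] at htot
  have hle : ∀ (l : List (Fin n)) (χ : QState (Wires n a)), ‖χ‖ ^ 2 ≤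
      (Prog.ret (fun i => (l.count i : ℝ) / T) :
        Prog (Wires n a) (idxLen n) b (Fin n → ℝ)).expect X (fun w χ =>
          if w ∈ stdSimplex ℝ (Fin n) ∧ ∀ i, (X *ᵥ w) i ≤ ε then ‖χ‖ ^ 2 else 0) χ
      + (if l.length ≠ T ∨ ∃ i, ε * T < score X l i then ‖χ‖ ^ 2 else 0) := by
    intro l χ
    simp only [Prog.expect]
    by_cases hl : l.length ≠ T ∨ ∃ i, ε * T < score X l i
    · rw [if_pos hl]; split_ifs <;> nlinarith [sq_nonneg ‖χ‖]
    · rw [if_neg hl, if_pos]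
      · simp
      push Not at hl
      refine ⟨⟨fun i => by positivity, ?_⟩, fun i => ?_⟩
      · have := sum_mul_count l fun _ => 1
        simp only [one_mul] at this
        rw [← Finset.sum_div, this]
        simp [hl.1, hTr.ne']
      · have : (X *ᵥ fun i => (l.count i : ℝ) / T) i = score X l i / T := by
          rw [score, ← sum_mul_count, Finset.sum_div]
          change ∑ k, X i k * ((l.count k : ℝ) / T) = _
          exact Finset.sum_congr rfl fun k _ => by ring
        rw [this, div_le_iff₀ hTr]
        exact hl.2 i
  have hmono := Prog.expect_mono (X := X) hle (rounds prep T []) (zeroState _)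
  rw [Prog.expect_add, htot] at hmono
  have h9 : (2 : ℝ) / 3 ≤ 1 - (min 1 (Real.exp (T * (ε ^ 2 / 8) - ε ^ 2 * T / 2) * n)
      + 3 * T * tolerance n ε) * 1 ^ 2 := by linarith
  have hm := sub_le_iff_le_add.2 hmono
  refine (h9.trans (le_trans (by linarith) hm)).trans (le_of_eq ?_)
  congr!

end

section

/-! ### Measurement-free circuits -/

/-- An instruction of a circuit: a two-qubit gate or an oracle query. -/
inductive Op (W : Type) (q b : ℕ) : Type
  /-- a two-qubit gate -/
  | gate (u v : W) (huv : u ≠ v) (G : Matrix.unitaryGroup (Bool × Bool) ℂ) : Op W q b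
  /-- an oracle query -/
  | query (r : Registers W q b) : Op W q b

namespace Op

variable {W : Type} {n q b : ℕ}

/-- The action of an instruction on states. -/
def app [DecidableEq W] (X : Matrix (Fin n) (Fin n) ℝ) : Op W q b → QState W → QState W
  | gate u v _ G => applyGate u v G.1
  | query r => applyOracle X r

/-- The inverse instruction; a query is its own inverse. -/
def inv : Op W q b → Op W q b
  | gate u v huv G => gate u v huv G⁻¹
  | query r => query r

/-- The program that starts with the given instruction. -/
def cons {α : Type} : Op W q b → Prog W q b α → Prog W q b α
  | gate u v huv G, P => .gate u v huv G P
  | query r, P => .query r P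

end Op

/-- A circuit: a list of instructions, carried out from left to right. -/
abbrev Circ (W : Type) (q b : ℕ) : Type := List (Op W q b)

theorem applyGate_applyGate {W : Type} [DecidableEq W] {u v : W} (huv : u ≠ v)
    (G H : Matrix (Bool × Bool) (Bool × Bool) ℂ) (ψ : QState W) :
    applyGate u v G (applyGate u v H ψ) = applyGate u v (G * H) ψ := by
  ext x
  have hc : ∀ c d : Bool × Bool, Function.update (Function.update (Function.update
      (Function.update x u c.1) v c.2) u d.1) v d.2
        = Function.update (Function.update x u d.1) v d.2 := fun c d => by
    rw [Function.update_comm huv.symm, Function.update_idem, Function.update_idem]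
  rw [applyGate_apply, applyGate_apply]
  simp only [applyGate_apply, hc, Function.update_self, Function.update_of_ne huv, Matrix.mul_apply,
    Finset.sum_mul, Finset.mul_sum]
  rw [Finset.sum_comm]
  exact Finset.sum_congr rfl fun d _ => Finset.sum_congr rfl fun c _ => by ring

theorem applyGate_one {W : Type} [DecidableEq W] {u v : W} (ψ : QState W) :
    applyGate u v 1 ψ = ψ := by
  ext x
  rw [applyGate_apply, Finset.sum_eq_single (x u, x v)]
  · simp
  · intro c _ hc; simp [Matrix.one_apply_ne hc.symm]
  · simp

namespace Circ

section

variable {W : Type} {q b : ℕ}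

/-- The inverse circuit. -/
def inv (c : Circ W q b) : Circ W q b := (c.map Op.inv).reverse

/-- The program that carries out a circuit and continues with a given program. -/
def toProg {α : Type} (c : Circ W q b) (P : Prog W q b α) : Prog W q b α := c.foldr Op.cons P

theorem inv_append (c d : Circ W q b) : inv (c ++ d) = inv d ++ inv c := by simp [inv]

theorem inv_cons (o : Op W q b) (c : Circ W q b) : inv (o :: c) = inv c ++ [o.inv] := by
  simp [inv]

theorem cost_toProg {α : Type} (c : Circ W q b) (P : Prog W q b α) :
    (toProg c P).cost = c.length + P.cost := by
  induction c with
  | nil => simp [toProg]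
  | cons o c ih =>
    have : (toProg (o :: c) P).cost = 1 + (toProg c P).cost := by cases o <;> rfl
    rw [this, ih, List.length_cons]; omega

theorem length_inv (c : Circ W q b) : (inv c).length = c.length := by simp [inv]

end

variable {W : Type} [DecidableEq W] {n q b : ℕ} {X : Matrix (Fin n) (Fin n) ℝ}

/-- The action of a circuit on states. -/
def run (X : Matrix (Fin n) (Fin n) ℝ) : Circ W q b → QState W → QState W
  | [], ψ => ψ
  | o :: c, ψ => run X c (o.app X ψ)

theorem run_append (c d : Circ W q b) (ψ : QState W) : run X (c ++ d) ψ = run X d (run X c ψ) := by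
  induction c generalizing ψ with
  | nil => rfl
  | cons o c ih => exact ih _

theorem run_add (c : Circ W q b) (ψ φ : QState W) :
    run X c (ψ + φ) = run X c ψ + run X c φ := by
  induction c generalizing ψ φ with
  | nil => rfl
  | cons o c ih =>
    cases o <;> simp only [run, Op.app, applyGate_add, applyOracle_add, ih]

theorem run_smul (c : Circ W q b) (a : ℂ) (ψ : QState W) : run X c (a • ψ) = a • run X c ψ := by
  induction c generalizing ψ with
  | nil => rfl
  | cons o c ih =>
    cases o <;> simp only [run, Op.app, applyGate_smul, applyOracle_smul, ih]

theorem app_inv_app (o : Op W q b) (ψ : QState W) : o.inv.app X (o.app X ψ) = ψ := by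
  cases o with
  | gate u v huv G =>
    simp only [Op.inv, Op.app, applyGate_applyGate huv]
    rw [← Submonoid.coe_mul, inv_mul_cancel, Submonoid.coe_one, applyGate_one]
  | query r => ext x; simp [Op.inv, Op.app, applyOracle, oracleBasis_involutive r x]

theorem app_app_inv (o : Op W q b) (ψ : QState W) : o.app X (o.inv.app X ψ) = ψ := by
  cases o with
  | gate u v huv G =>
    simp only [Op.inv, Op.app, applyGate_applyGate huv]
    rw [← Submonoid.coe_mul, mul_inv_cancel, Submonoid.coe_one, applyGate_one]
  | query r => ext x; simp [Op.inv, Op.app, applyOracle, oracleBasis_involutive r x]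

theorem run_inv_run (c : Circ W q b) (ψ : QState W) : run X (inv c) (run X c ψ) = ψ := by
  induction c generalizing ψ with
  | nil => rfl
  | cons o c ih => rw [inv_cons, run_append]; simp only [run]; rw [ih, app_inv_app]

theorem run_run_inv (c : Circ W q b) (ψ : QState W) : run X c (run X (inv c) ψ) = ψ := by
  induction c generalizing ψ with
  | nil => rfl
  | cons o c ih => rw [inv_cons, run_append]; simp only [run]; rw [app_app_inv, ih]

theorem norm_run [Fintype W] (c : Circ W q b) (ψ : QState W) : ‖run X c ψ‖ = ‖ψ‖ := by
  induction c generalizing ψ with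
  | nil => rfl
  | cons o c ih =>
    cases o with
    | gate u v huv G => simp only [run, ih, Op.app, norm_applyGate huv]
    | query r => simp only [run, ih, Op.app, norm_applyOracle]

/-- The action of a circuit as a linear isometry. -/
def isometry [Fintype W] (X : Matrix (Fin n) (Fin n) ℝ) (c : Circ W q b) :
    QState W →ₗᵢ[ℂ] QState W where
  toFun := run X c
  map_add' := run_add c
  map_smul' := run_smul c
  norm_map' := norm_run c

theorem run_sum [Fintype W] {ι : Type*} (s : Finset ι) (c : Circ W q b) (f : ι → QState W) :
    run X c (∑ i ∈ s, f i) = ∑ i ∈ s, run X c (f i) :=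
  map_sum (isometry X c) f s

theorem inner_run_run [Fintype W] (c : Circ W q b) (ψ φ : QState W) :
    inner ℂ (run X c ψ) (run X c φ) = inner ℂ ψ φ :=
  (isometry X c).inner_map_map ψ φ

theorem expect_toProg [Fintype W] {α : Type} (F : α → QState W → ℝ) (c : Circ W q b)
    (P : Prog W q b α) (ψ : QState W) :
    (toProg c P).expect X F ψ = P.expect X F (run X c ψ) := by
  induction c generalizing ψ with
  | nil => rfl
  | cons o c ih =>
    cases o <;> exact ih _

end Circ

/-! ### Controlled one-qubit gates -/

/-- The diagonal one-qubit gate with phases `f false` and `f true`. -/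
def phaseGate (f : Bool → ℝ) : Matrix.unitaryGroup Bool ℂ :=
  ⟨Matrix.diagonal fun c => Complex.exp (f c * Complex.I), by
    rw [Matrix.mem_unitaryGroup_iff, Matrix.star_eq_conjTranspose, Matrix.diagonal_conjTranspose,
      Matrix.diagonal_mul_diagonal, ← Matrix.diagonal_one]
    congr 1
    funext c
    rw [Pi.star_apply, Complex.star_def, ← Complex.exp_conj, ← Complex.exp_add]
    simp⟩

/-- The Hadamard gate. -/
def hadamard : Matrix.unitaryGroup Bool ℂ :=
  ⟨Matrix.of fun a c => ((1 / √2 : ℝ) : ℂ) * if a && c then -1 else 1, by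
    have h : ((1 / √2 : ℝ) : ℂ) * ((1 / √2 : ℝ) : ℂ) = 1 / 2 := by
      rw [← Complex.ofReal_mul, div_mul_div_comm, Real.mul_self_sqrt (by norm_num)]; simp
    rw [Matrix.mem_unitaryGroup_iff, Matrix.star_eq_conjTranspose]
    ext a c
    rw [Matrix.mul_apply, Fintype.sum_bool]
    simp only [Matrix.conjTranspose_apply, Matrix.of_apply, star_mul', Complex.star_def,
      Complex.conj_ofReal]
    generalize ((1 / √2 : ℝ) : ℂ) = κ at h ⊢
    cases a <;> cases c <;> simp <;> linear_combination 2 * h⟩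

/-- The gate that negates a qubit. -/
def notGate : Matrix.unitaryGroup Bool ℂ :=
  ⟨Matrix.of fun a c => if a = c then 0 else 1, by
    rw [Matrix.mem_unitaryGroup_iff, Matrix.star_eq_conjTranspose]
    ext a c
    rw [Matrix.mul_apply, Fintype.sum_bool]
    cases a <;> cases c <;> simp⟩

/-- The real rotation that takes `|0⟩` to `y |0⟩ + √(1 - y²) |1⟩`, where `y ∈ [-1, 1]`. -/
def rotation (y : ℝ) : Matrix.unitaryGroup Bool ℂ :=
  ⟨Matrix.of fun a c => if a = c then ((Real.cos (Real.arccos y) : ℝ) : ℂ)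
      else if a then ((Real.sin (Real.arccos y) : ℝ) : ℂ)
      else ((-Real.sin (Real.arccos y) : ℝ) : ℂ), by
    have h := Real.sin_sq_add_cos_sq (Real.arccos y)
    have h2 : ((Real.sin (Real.arccos y) : ℝ) : ℂ) ^ 2 + ((Real.cos (Real.arccos y) : ℝ) : ℂ) ^ 2
        = 1 := by exact_mod_cast h
    rw [Matrix.mem_unitaryGroup_iff, Matrix.star_eq_conjTranspose]
    ext a c
    rw [Matrix.mul_apply, Fintype.sum_bool]
    simp only [Matrix.conjTranspose_apply, Matrix.of_apply]
    cases a <;> cases c <;>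
      simp only [reduceCtorEq, if_true, if_false, Complex.star_def, Complex.conj_ofReal,
        Matrix.one_apply, Complex.ofReal_neg, map_neg, Bool.false_eq_true] <;>
      first | linear_combination h2 | ring⟩

theorem rotation_false_false {y : ℝ} (h0 : -1 ≤ y) (h1 : y ≤ 1) :
    (rotation y).1 false false = y := by
  simp [rotation, Real.cos_arccos h0 h1]

namespace Circ

variable {W : Type} [DecidableEq W] {n q b : ℕ} {X : Matrix (Fin n) (Fin n) ℝ}

/-- The gate that applies to the qubit `v` the one-qubit gate `V β`, where `β` is the value of the
qubit `u`. It is the empty circuit if `u = v`. -/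
def ctrl (u v : W) (V : Bool → Matrix.unitaryGroup Bool ℂ) : Circ W q b :=
  if h : v = u then [] else
    [Op.gate v u h ⟨Matrix.blockDiagonal fun β => (V β).1, by
      rw [Matrix.mem_unitaryGroup_iff, Matrix.star_eq_conjTranspose,
        Matrix.blockDiagonal_conjTranspose, ← Matrix.blockDiagonal_mul, ← Matrix.blockDiagonal_one]
      congr 1
      funext β
      exact Matrix.mem_unitaryGroup_iff.1 (V β).2⟩]

theorem run_ctrl {u v : W} (h : v ≠ u) (V : Bool → Matrix.unitaryGroup Bool ℂ) (ψ : QState W)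
    (x : W → Bool) : run X (ctrl u v V : Circ W q b) ψ x =
      ∑ c, (V (x u)).1 (x v) c * ψ (Function.update x v c) := by
  have hx : ∀ c, Function.update (Function.update x v c) u (x u) = Function.update x v c := by
    intro c
    rw [Function.update_eq_self_iff, Function.update_of_ne h.symm]
  simp only [ctrl, h, dif_neg, not_false_eq_true, run, Op.app, applyGate_apply]
  rw [Fintype.sum_prod_type]
  refine Finset.sum_congr rfl fun c _ => ?_
  rw [Finset.sum_eq_single (x u)]
  · rw [Matrix.blockDiagonal_apply_eq, hx]
  · intro d _ hd; simp [Matrix.blockDiagonal_apply_ne _ _ _ hd.symm]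
  · simp

theorem inv_ctrl (u v : W) (V : Bool → Matrix.unitaryGroup Bool ℂ) :
    inv (ctrl u v V : Circ W q b) = ctrl u v fun β => (V β)⁻¹ := by
  unfold ctrl
  split_ifs with h
  · rfl
  · simp only [inv, List.map_cons, List.map_nil, List.reverse_singleton, Op.inv]
    congr 2
    apply Subtype.ext
    change star (Matrix.blockDiagonal fun β => (V β).1) = _
    rw [Matrix.star_eq_conjTranspose, Matrix.blockDiagonal_conjTranspose]
    rfl

theorem length_ctrl_le (u v : W) (V : Bool → Matrix.unitaryGroup Bool ℂ) :
    (ctrl u v V : Circ W q b).length ≤ 1 := by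
  unfold ctrl; split_ifs <;> simp

variable [Nontrivial W]

/-- The one-qubit gate `V` on the qubit `v`, as a two-qubit gate that ignores its other qubit. -/
def single (v : W) (V : Matrix.unitaryGroup Bool ℂ) : Circ W q b :=
  ctrl (exists_ne v).choose v fun _ => V

theorem run_single (v : W) (V : Matrix.unitaryGroup Bool ℂ) (ψ : QState W) (x : W → Bool) :
    run X (single v V : Circ W q b) ψ x = ∑ c, V.1 (x v) c * ψ (Function.update x v c) :=
  run_ctrl (exists_ne v).choose_spec.symm _ ψ x

theorem length_single_le (v : W) (V : Matrix.unitaryGroup Bool ℂ) :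
    (single v V : Circ W q b).length ≤ 1 := length_ctrl_le _ _ _

end Circ

end

section

/-! ### Basis states -/

/-- The computational basis state `|x⟩`. -/
def ket {W : Type} [DecidableEq W] [Fintype W] (x : W → Bool) : QState W :=
  EuclideanSpace.single x 1

section

variable {W : Type} [DecidableEq W] [Fintype W]

theorem ket_apply (x y : W → Bool) : ket x y = if y = x then 1 else 0 := by
  simp [ket]

theorem zeroState_eq_ket : zeroState W = ket fun _ => false := by
  ext x; simp [zeroState, ket_apply]

theorem eq_sum_ket (ψ : QState W) : ψ = ∑ x, ψ x • ket x := by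
  ext y
  simp [ket_apply]

theorem inner_ket (x : W → Bool) (ψ : QState W) : inner ℂ (ket x) ψ = ψ x := by
  simp [ket, EuclideanSpace.inner_single_left]

end

namespace Circ

variable {W : Type} [DecidableEq W] {n q b : ℕ} {X : Matrix (Fin n) (Fin n) ℝ}

theorem run_ctrl_ket [Fintype W] {u v : W} (h : v ≠ u) (V : Bool → Matrix.unitaryGroup Bool ℂ)
    (x : W → Bool) : run X (ctrl u v V : Circ W q b) (ket x) =
      ∑ c, (V (x u)).1 c (x v) • ket (Function.update x v c) := by
  ext y
  rw [run_ctrl h]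
  simp only [WithLp.ofLp_sum, WithLp.ofLp_smul, Finset.sum_apply, Pi.smul_apply, ket_apply,
    Function.update_eq_iff, Function.eq_update_iff, smul_eq_mul, mul_ite, mul_one, mul_zero]
  by_cases hy : ∀ w, w ≠ v → y w = x w
  · rw [Finset.sum_eq_single (x v), Finset.sum_eq_single (y v)]
    · simp only [true_and, hy u h.symm]
    · intro c _ hc; simp [hc.symm]
    · simp
    · intro c _ hc; simp [hc]
    · simp
  · simp [hy]

theorem run_single_ket [Fintype W] [Nontrivial W] (v : W) (V : Matrix.unitaryGroup Bool ℂ)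
    (x : W → Bool) : run X (single v V : Circ W q b) (ket x) =
      ∑ c, V.1 c (x v) • ket (Function.update x v c) :=
  run_ctrl_ket (exists_ne v).choose_spec.symm _ x

/-! ### Diagonal circuits -/

/-- The circuit `c` multiplies the basis state `|x⟩` by the phase `exp (i φ x)`. -/
def IsDiag (X : Matrix (Fin n) (Fin n) ℝ) (c : Circ W q b) (φ : (W → Bool) → ℝ) : Prop :=
  ∀ ψ x, run X c ψ x = Complex.exp (φ x * Complex.I) * ψ x

theorem isDiag_nil : IsDiag X ([] : Circ W q b) fun _ => 0 := fun ψ x => by simp [run]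

theorem IsDiag.append {c d : Circ W q b} {φ χ : (W → Bool) → ℝ} (hc : IsDiag X c φ)
    (hd : IsDiag X d χ) : IsDiag X (c ++ d) fun x => φ x + χ x := fun ψ x => by
  rw [run_append, hd, hc, ← mul_assoc, ← Complex.exp_add]
  congr 2; push_cast; ring

theorem IsDiag.flatMap {ι : Type*} {f : ι → Circ W q b} {φ : ι → (W → Bool) → ℝ} {l : List ι}
    (h : ∀ i ∈ l, IsDiag X (f i) (φ i)) :
    IsDiag X (l.flatMap f) fun x => (l.map fun i => φ i x).sum := by
  induction l with
  | nil => simpa using isDiag_nil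
  | cons i l ih =>
    simpa using (h i (by simp)).append (ih fun j hj => h j (List.mem_cons_of_mem _ hj))

theorem IsDiag.inv {c : Circ W q b} {φ : (W → Bool) → ℝ} (hc : IsDiag X c φ) :
    IsDiag X (Circ.inv c) fun x => -φ x := fun ψ x => by
  have h := hc (run X (Circ.inv c) ψ) x
  rw [run_run_inv] at h
  rw [h, ← mul_assoc, ← Complex.exp_add]
  simp

theorem IsDiag.run_ket [Fintype W] {c : Circ W q b} {φ : (W → Bool) → ℝ} (hc : IsDiag X c φ)
    (x : W → Bool) : run X c (ket x) = Complex.exp (φ x * Complex.I) • ket x := by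
  ext y
  rw [hc]
  by_cases h : y = x <;> simp [ket_apply, h]

theorem IsDiag.congr {c : Circ W q b} {φ χ : (W → Bool) → ℝ} (hc : IsDiag X c φ)
    (h : ∀ x, φ x = χ x) : IsDiag X c χ := by
  rwa [← funext h]

/-- Conjugation of a diagonal circuit by circuits that permute the basis states. -/
theorem IsDiag.conj {c d e : Circ W q b} {φ : (W → Bool) → ℝ} {π : (W → Bool) → W → Bool}
    (hd : IsDiag X d φ) (hc : ∀ ψ x, run X c ψ x = ψ (π x)) (he : ∀ ψ x, run X e ψ x = ψ (π x))
    (hπ : Function.Involutive π) : IsDiag X (c ++ d ++ e) fun x => φ (π x) := fun ψ x => by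
  rw [run_append, run_append, he, hd, hc, hπ]

/-- The phase gate `|x⟩ ↦ exp (i θ) |x⟩` if both qubits `u` and `v` are set. -/
def cphase (u v : W) (θ : ℝ) : Circ W q b :=
  ctrl u v fun β => phaseGate fun c => if β && c then θ else 0

theorem isDiag_cphase {u v : W} (h : v ≠ u) (θ : ℝ) :
    IsDiag X (cphase u v θ : Circ W q b) fun x => if x u && x v then θ else 0 := fun ψ x => by
  rw [cphase, run_ctrl h, Finset.sum_eq_single (x v)]
  · simp [phaseGate]
  · intro c _ hc
    simp [phaseGate, Matrix.diagonal_apply_ne _ hc.symm]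
  · simp

variable [Nontrivial W]

theorem isDiag_single (v : W) (f : Bool → ℝ) :
    IsDiag X (single v (phaseGate f) : Circ W q b) fun x => f (x v) := fun ψ x => by
  rw [run_single, Finset.sum_eq_single (x v)]
  · simp [phaseGate]
  · intro c _ hc
    simp [phaseGate, Matrix.diagonal_apply_ne _ hc.symm]
  · simp

/-! ### Negating several qubits -/

/-- The basis state `x` with the qubits of the list `l` negated. -/
def flipBits {W : Type} [DecidableEq W] (l : List W) (x : W → Bool) : W → Bool :=
  fun w => xor (x w) (decide (w ∈ l))

theorem flipBits_of_mem {W : Type} [DecidableEq W] {l : List W} {w : W} (h : w ∈ l)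
    (x : W → Bool) : flipBits l x w = !x w := by simp [flipBits, h]

theorem flipBits_of_notMem {W : Type} [DecidableEq W] {l : List W} {w : W} (h : w ∉ l)
    (x : W → Bool) : flipBits l x w = x w := by simp [flipBits, h]

theorem flipBits_involutive {W : Type} [DecidableEq W] (l : List W) :
    Function.Involutive (flipBits l) := fun x => by funext w; simp [flipBits]

/-- Negate the qubits of the list `l`. -/
def flips (l : List W) : Circ W q b := l.flatMap fun v => single v notGate

theorem run_flips (l : List W) (hl : l.Nodup) (ψ : QState W) (x : W → Bool) :
    run X (flips l : Circ W q b) ψ x = ψ (flipBits l x) := by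
  unfold flipBits
  induction l generalizing ψ with
  | nil => simp [flips, run]
  | cons v l ih =>
    have hv := (List.nodup_cons.1 hl).1
    have : (flips (v :: l) : Circ W q b) = single v notGate ++ flips l := by simp [flips]
    rw [this, run_append, ih (List.nodup_cons.1 hl).2, run_single]
    have e : ∀ y : W → Bool, ∑ c, notGate.1 (y v) c * ψ (Function.update y v c)
        = ψ (Function.update y v (!y v)) := fun y => by
      rw [Fintype.sum_bool]; cases y v <;> simp [notGate]
    refine (e fun w => xor (x w) (decide (w ∈ l))).trans (congrArg _ (funext fun w => ?_))
    by_cases hw : w = v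
    · subst hw; simp [hv]
    · simp [hw]

theorem length_flips_le (l : List W) : (flips l : Circ W q b).length ≤ l.length := by
  induction l with
  | nil => simp [flips]
  | cons v l ih =>
    have : (flips (v :: l) : Circ W q b) = single v notGate ++ flips l := by simp [flips]
    rw [this, List.length_append, List.length_cons]
    have := length_single_le (q := q) (b := b) v notGate
    omega

end Circ

/-! ### Two's complement bits of integers -/

/-- The bit number `l` of the two's complement representation of `z`. -/
def zbit (z : ℤ) (l : ℕ) : Bool := decide (z / 2 ^ l % 2 = 1)

theorem testBit_eq_zbit (z : ℤ) (l : ℕ) : Int.testBit z l = zbit z l := by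
  induction l generalizing z with
  | zero =>
    rw [← Int.bit_decomp z, Int.testBit_bit_zero]
    unfold zbit Int.bit
    cases z.bodd <;> simp
  | succ l ih =>
    rw [← Int.bit_decomp z, Int.testBit_bit_succ, ih]
    have : Int.bit z.bodd z.div2 / 2 ^ (l + 1) = z.div2 / 2 ^ l := by
      rw [pow_succ', ← Int.ediv_ediv_of_nonneg (by norm_num)]
      congr 1
      unfold Int.bit
      cases z.bodd <;> (simp; try omega)
    simp [zbit, this]

theorem zbit_add (z : ℤ) (s l : ℕ) : zbit z (s + l) = zbit (z / 2 ^ s) l := by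
  unfold zbit
  rw [pow_add, Int.ediv_ediv_of_nonneg (by positivity)]

theorem sum_zbit (z : ℤ) (l : ℕ) :
    ∑ m ∈ Finset.range l, (if zbit z m then (2 : ℤ) ^ m else 0) = z % 2 ^ l := by
  induction l with
  | zero => simp
  | succ l ih =>
    rw [Finset.sum_range_succ, ih]
    have h1 := Int.emod_add_mul_ediv z (2 ^ l)
    have h2 := Int.emod_add_mul_ediv z (2 ^ (l + 1))
    have h3 : z / 2 ^ (l + 1) = z / 2 ^ l / 2 := by
      rw [pow_succ, ← Int.ediv_ediv_of_nonneg (by positivity)]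
    have h4 := Int.emod_add_mul_ediv (z / 2 ^ l) 2
    rw [h3, pow_succ] at h2
    have h5 : (if zbit z l then (2 : ℤ) ^ l else 0) = 2 ^ l * (z / 2 ^ l % 2) := by
      unfold zbit
      rcases Int.emod_two_eq_zero_or_one (z / 2 ^ l) with h | h <;> simp [h]
    rw [h5, pow_succ]
    generalize z / 2 ^ l = y at *
    generalize (2 : ℤ) ^ l = p at *
    linear_combination h1 - h2 + p * h4

/-- The sign bit. -/
theorem zbit_eq_decide_neg {z : ℤ} {l : ℕ} (h1 : -2 ^ l ≤ z) (h2 : z < 2 ^ l) :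
    zbit z l = decide (z < 0) := by
  unfold zbit
  by_cases h : z < 0
  · have : z / 2 ^ l = -1 := by
      rw [Int.ediv_eq_iff_of_pos (by positivity)]
      constructor <;> linarith
    simp [this, h]
  · have : z / 2 ^ l = 0 := Int.ediv_eq_zero_of_lt (not_lt.1 h) h2
    simp [this, h]

/-- Two's complement: the bit number `l` has weight `-2 ^ l`. -/
theorem sum_zbit_sub_sign {z : ℤ} {l : ℕ} (h1 : -2 ^ l ≤ z) (h2 : z < 2 ^ l) :
    ∑ m ∈ Finset.range l, (if zbit z m then (2 : ℤ) ^ m else 0)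
      + (if zbit z l then -2 ^ l else 0) = z := by
  rw [sum_zbit, zbit_eq_decide_neg h1 h2]
  by_cases h : z < 0
  · have : z % 2 ^ l = z + 2 ^ l := by
      rw [← Int.add_emod_right, Int.emod_eq_of_lt (by linarith) (by linarith)]
    simp [h, this]
  · simp [h, Int.emod_eq_of_lt (not_lt.1 h) h2]

end

section

namespace Circ

/-! ### Computing an integer-valued linear form into a register -/

/-- The basis state `x` with the qubits `v 0, …, v (k-1)` set to `β 0, …, β (k-1)`. -/
def setBits {W : Type} [DecidableEq W] (v : ℕ → W) (β : ℕ → Bool) :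
    ℕ → (W → Bool) → W → Bool
  | 0, x => x
  | k + 1, x => Function.update (setBits v β k x) (v k) (β k)

theorem setBits_of_notMem {W : Type} [DecidableEq W] {v : ℕ → W} {β : ℕ → Bool} {k : ℕ}
    {x : W → Bool} {w : W} (h : ∀ l < k, v l ≠ w) : setBits v β k x w = x w := by
  induction k with
  | zero => rfl
  | succ k ih =>
    rw [setBits, Function.update_of_ne (h k (by omega)).symm, ih fun l hl => h l (by omega)]

theorem setBits_apply {W : Type} [DecidableEq W] {v : ℕ → W} {β : ℕ → Bool} {k : ℕ}
    {x : W → Bool} (hv : ∀ l < k, ∀ m < k, v l = v m → l = m) {l : ℕ} (hl : l < k) :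
    setBits v β k x (v l) = β l := by
  induction k with
  | zero => omega
  | succ k ih =>
    by_cases h : l = k
    · subst h; simp [setBits]
    · have h1 : v l ≠ v k := fun h' => h (hv l hl k (by omega) h')
      rw [setBits, Function.update_of_ne h1]
      exact ih (fun l hl m hm => hv l (by omega) m (by omega)) (by omega)

theorem setBits_induction {W : Type} [DecidableEq W] {v : ℕ → W} {β : ℕ → Bool} {k : ℕ}
    {x : W → Bool} {p : (W → Bool) → Prop} (hx : p x)
    (h : ∀ l < k, ∀ y c, p y → p (Function.update y (v l) c)) : p (setBits v β k x) := by
  induction k with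
  | zero => exact hx
  | succ k ih => exact h k (by omega) _ _ (ih fun l hl => h l (by omega))

variable {W : Type} [DecidableEq W] {n q b : ℕ} {X : Matrix (Fin n) (Fin n) ℝ}

/-- The phases that remove the contribution of the bits below `l` in stage `l` of `compute`. -/
def corrections (v : ℕ → W) (l : ℕ) : Circ W q b :=
  (List.range l).flatMap fun m => cphase (v m) (v l) (-(2 * Real.pi * 2 ^ m / 2 ^ (l + 1)))

theorem sum_map_range {M : Type*} [AddCommMonoid M] (f : ℕ → M) (l : ℕ) :
    ((List.range l).map f).sum = ∑ m ∈ Finset.range l, f m := by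
  induction l with
  | zero => rfl
  | succ l ih => rw [List.range_succ, Finset.sum_range_succ]; simp [ih]

theorem isDiag_corrections {v : ℕ → W} {l : ℕ} (hv : ∀ m < l, v l ≠ v m) :
    IsDiag X (corrections v l : Circ W q b) fun x => ∑ m ∈ Finset.range l,
      if x (v m) && x (v l) then -(2 * Real.pi * 2 ^ m / 2 ^ (l + 1)) else 0 := by
  refine (IsDiag.flatMap fun m hm => isDiag_cphase (hv m (by simpa using hm)) _).congr fun x => ?_
  rw [sum_map_range]

theorem length_flatMap_le {W : Type} {ι : Type*} {f : ι → Circ W q b} {K : ℕ} (l : List ι)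
    (h : ∀ i, (f i).length ≤ K) : (l.flatMap f).length ≤ l.length * K := by
  induction l with
  | nil => simp
  | cons i l ih =>
    rw [List.flatMap_cons, List.length_append, List.length_cons, Nat.succ_mul]
    have := h i
    omega

theorem length_corrections_le (v : ℕ → W) (l : ℕ) :
    (corrections v l : Circ W q b).length ≤ l := by
  refine (length_flatMap_le (K := 1) _ fun m => length_ctrl_le _ _ _).trans ?_
  simp

/-- Write the `k` lowest bits of an integer `L x` into the qubits `v 0, v 1, …`, given circuits
`D l` for the phase `exp (2 π i L / 2 ^ (l + 1))` on the set qubit `v l`. In stage `l`, between two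
Hadamard gates, this phase, freed from the bits already known, is `(-1)` to the power of bit `l`. -/
def compute [Nontrivial W] (v : ℕ → W) (D : ℕ → Circ W q b) : ℕ → Circ W q b
  | 0 => []
  | l + 1 => compute v D l ++ (single (v l) hadamard ++ (D l ++ corrections v l)
      ++ single (v l) hadamard)

theorem run_compute_ket [Fintype W] [Nontrivial W] {v : ℕ → W} {D : ℕ → Circ W q b} {R : ℕ}
    (hv : ∀ l < R, ∀ m < R, v l = v m → l = m) {φ : ℕ → (W → Bool) → ℝ}
    (hD : ∀ l < R, IsDiag X (D l) (φ l)) {A : (W → Bool) → Prop} {L : (W → Bool) → ℤ}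
    (hφ : ∀ l < R, ∀ x, A x → φ l x = if x (v l) then 2 * Real.pi * L x / 2 ^ (l + 1) else 0)
    (hA : ∀ l < R, ∀ x c, A x → A (Function.update x (v l) c))
    (hL : ∀ l < R, ∀ x c, A x → L (Function.update x (v l) c) = L x)
    {x : W → Bool} (hx : A x) (hx0 : ∀ l < R, x (v l) = false) {k : ℕ} (hk : k ≤ R) :
    run X (compute v D k) (ket x) = ket (setBits v (zbit (L x)) k x) := by
  induction k with
  | zero => rfl
  | succ k ih =>
    have hkR : k < R := hk
    set y := setBits v (zbit (L x)) k x with hy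
    have hAy : A y ∧ L y = L x := by
      refine setBits_induction (p := fun y => A y ∧ L y = L x) ⟨hx, rfl⟩ fun l hl y c h => ?_
      exact ⟨hA l (by omega) y c h.1, (hL l (by omega) y c h.1).trans h.2⟩
    have hne : ∀ m < k, v k ≠ v m := fun m hm h => by
      have := hv k hkR m (by omega) h; omega
    have hyk : y (v k) = false := by
      rw [hy, setBits_of_notMem fun l hl => (hne l hl).symm, hx0 k hkR]
    have hym : ∀ m < k, y (v m) = zbit (L x) m := fun m hm =>
      setBits_apply (fun l hl m hm => hv l (by omega) m (by omega)) hm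
    set Φ : (W → Bool) → ℝ := fun x => φ k x + ∑ m ∈ Finset.range k,
      if x (v m) && x (v k) then -(2 * Real.pi * 2 ^ m / 2 ^ (k + 1)) else 0 with hΦ
    have hdiag : IsDiag X (D k ++ corrections v k) Φ := (hD k hkR).append (isDiag_corrections hne)
    have h0 : Φ (Function.update y (v k) false) = 0 := by
      rw [hΦ]
      simp [hφ k hkR _ (hA k hkR y false hAy.1)]
    have h1 : Complex.exp (Φ (Function.update y (v k) true) * Complex.I)
        = if zbit (L x) k then -1 else 1 := by
      have e1 : ∀ m ∈ Finset.range k,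
          (if Function.update y (v k) true (v m) && Function.update y (v k) true (v k)
            then -(2 * Real.pi * 2 ^ m / 2 ^ (k + 1)) else 0 : ℝ)
          = -(2 * Real.pi / 2 ^ (k + 1)) * ((if zbit (L x) m then (2 : ℤ) ^ m else 0 : ℤ) : ℝ) := by
        intro m hm
        rw [Finset.mem_range] at hm
        rw [Function.update_self, Function.update_of_ne (hne m hm).symm, hym m hm]
        cases zbit (L x) m <;> simp; ring
      have e2 : Φ (Function.update y (v k) true) = Real.pi * ((L x / 2 ^ k : ℤ) : ℝ) := by
        rw [hΦ]
        simp only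
        rw [Finset.sum_congr rfl e1, ← Finset.mul_sum, ← Int.cast_sum, sum_zbit,
          hφ k hkR _ (hA k hkR y true hAy.1), hL k hkR y true hAy.1, hAy.2]
        have h3 := Int.emod_add_mul_ediv (L x) (2 ^ k)
        have h4 : (L x : ℝ) = (L x % 2 ^ k : ℤ) + 2 ^ k * (L x / 2 ^ k : ℤ) := by
          exact_mod_cast h3.symm
        rw [Function.update_self, if_pos rfl, h4]
        field_simp
        ring
      rw [e2]
      have h5 := Int.emod_add_mul_ediv (L x / 2 ^ k) 2
      unfold zbit
      have h6 : Complex.exp (((Real.pi * ((L x / 2 ^ k : ℤ) : ℝ) : ℝ) : ℂ) * Complex.I)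
          = Complex.exp (((L x / 2 ^ k % 2 : ℤ) : ℂ) * (Real.pi * Complex.I)) := by
        rw [Complex.exp_eq_exp_iff_exists_int]
        refine ⟨L x / 2 ^ k / 2, ?_⟩
        have h7 : ((L x / 2 ^ k : ℤ) : ℂ) = (L x / 2 ^ k % 2 : ℤ) + 2 * (L x / 2 ^ k / 2 : ℤ) := by
          exact_mod_cast h5.symm
        push_cast at h7 ⊢
        rw [h7]; ring
      rw [h6]
      rcases Int.emod_two_eq_zero_or_one (L x / 2 ^ k) with h | h <;> simp [h]
    rw [compute, run_append, ih (by omega), run_append, run_append, run_single_ket,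
      Fintype.sum_bool, run_add, run_smul, run_smul, hdiag.run_ket, hdiag.run_ket, h0, h1,
      run_add, run_smul, run_smul, run_smul, run_smul, run_single_ket, run_single_ket,
      Fintype.sum_bool, Fintype.sum_bool]
    simp only [Function.update_self, Function.update_idem, setBits, ← hy, hyk]
    have h : ((1 / √2 : ℝ) : ℂ) * ((1 / √2 : ℝ) : ℂ) = 1 / 2 := by
      rw [← Complex.ofReal_mul, div_mul_div_comm, Real.mul_self_sqrt (by norm_num)]; simp
    simp only [hadamard, Matrix.of_apply]
    generalize ((1 / √2 : ℝ) : ℂ) = κ at h ⊢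
    ext z
    cases zbit (L x) k <;>
      simp only [WithLp.ofLp_add, WithLp.ofLp_smul, Pi.add_apply, Pi.smul_apply, smul_eq_mul,
        Bool.and_false, Bool.and_true, Bool.false_eq_true, if_true, if_false, Complex.ofReal_zero,
        zero_mul, Complex.exp_zero] <;>
      first
      | linear_combination 2 * h * ket (Function.update y (v k) false) z
      | linear_combination 2 * h * ket (Function.update y (v k) true) z

/-! ### Reflections -/

/-- A circuit that acts on basis states with a property `p` by phases acts by them on all
combinations of such states. -/
theorem run_apply_of_ket [Fintype W] {c : Circ W q b} {e : (W → Bool) → ℂ}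
    {p : (W → Bool) → Prop} (h : ∀ x, p x → run X c (ket x) = e x • ket x) {ψ : QState W}
    (hψ : ∀ x, ¬ p x → ψ x = 0) (x : W → Bool) : run X c ψ x = e x * ψ x := by
  have h1 : run X c ψ = ∑ y, ψ y • (e y • ket y) := by
    conv_lhs => rw [eq_sum_ket ψ]
    rw [run_sum]
    refine Finset.sum_congr rfl fun y _ => ?_
    rw [run_smul]
    by_cases hy : p y
    · rw [h y hy]
    · rw [hψ y hy, zero_smul, zero_smul]
  rw [h1]
  simp [ket_apply, mul_comm]

/-- Minus the number of set qubits of the list `ws` is computed into the register `v`, which must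
start in the state zero and whose sign bit then tells whether some qubit is set. The basis states
where this is so (`s = true`), or not so (`s = false`), are negated. -/
def reflect [Nontrivial W] (ws : List W) (v : ℕ → W) (m : ℕ) (s : Bool) : Circ W q b :=
  let C := compute v (fun l => ws.flatMap fun w => cphase w (v l) (-(2 * Real.pi / 2 ^ (l + 1))))
    (m + 1)
  C ++ single (v m) (phaseGate fun c => if c = s then Real.pi else 0) ++ inv C

theorem run_reflect [Fintype W] [Nontrivial W] {ws : List W} {v : ℕ → W} {m : ℕ}
    (hm : ws.length ≤ m)
    (hv : ∀ l < m + 1, ∀ k < m + 1, v l = v k → l = k) (hws : ∀ w ∈ ws, ∀ l < m + 1, v l ≠ w)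
    (s : Bool) {ψ : QState W} (hψ : ∀ x, (∃ l < m + 1, x (v l) = true) → ψ x = 0)
    (x : W → Bool) : run X (reflect ws v m s : Circ W q b) ψ x =
      (if decide (∃ w ∈ ws, x w = true) = s then -1 else 1) * ψ x := by
  refine run_apply_of_ket (p := fun x => ∀ l < m + 1, x (v l) = false)
    (e := fun x => if decide (∃ w ∈ ws, x w = true) = s then -1 else 1) ?_ ?_ x
  · intro x hx
    set D : ℕ → Circ W q b :=
      fun l => ws.flatMap fun w => cphase w (v l) (-(2 * Real.pi / 2 ^ (l + 1))) with hD
    set L : (W → Bool) → ℤ := fun x => -(ws.countP x : ℤ) with hLdef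
    have hC := run_compute_ket (X := X) (v := v) (D := D) (R := m + 1) hv
      (φ := fun l x => (ws.map fun w => if x w && x (v l) then
        -(2 * Real.pi / 2 ^ (l + 1)) else 0 : List ℝ).sum)
      (fun l hl => IsDiag.flatMap fun w hw => isDiag_cphase (hws w hw l hl) _)
      (A := fun _ => True) (L := L)
      (fun l hl x _ => by
        rw [hLdef]
        have : ∀ ws : List W, (ws.map fun w => if x w && x (v l) then
            -(2 * Real.pi / 2 ^ (l + 1)) else 0 : List ℝ).sum
            = if x (v l) then 2 * Real.pi * ((-(ws.countP x : ℤ) : ℤ) : ℝ) / 2 ^ (l + 1)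
              else 0 := by
          intro ws
          induction ws with
          | nil => simp
          | cons w ws ih =>
            rw [List.map_cons, List.sum_cons, ih, List.countP_cons]
            cases x w <;> cases x (v l) <;> simp; ring
        exact this ws)
      (fun _ _ _ _ _ => trivial)
      (fun l hl x c _ => by
        rw [hLdef]
        simp only
        congr 2
        refine List.countP_congr fun w hw => ?_
        rw [Function.update_of_ne (hws w hw l hl).symm]) trivial hx le_rfl
    have hr : (reflect ws v m s : Circ W q b) = compute v D (m + 1) ++
      single (v m) (phaseGate fun c => if c = s then Real.pi else 0) ++ inv (compute v D (m + 1)) :=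
      rfl
    rw [hr, run_append, run_append, hC, (isDiag_single _ _).run_ket,
      setBits_apply hv (by omega : m < m + 1), run_smul, ← hC, run_inv_run]
    congr 1
    have hcount : ws.countP x ≤ m := (List.countP_le_length).trans hm
    have h2 : (m : ℤ) < 2 ^ m := by exact_mod_cast Nat.lt_two_pow_self
    rw [zbit_eq_decide_neg (by rw [hLdef]; simp only; omega) (by rw [hLdef]; simp only; omega)]
    have h3 : decide (L x < 0) = decide (∃ w ∈ ws, x w = true) := by
      rw [decide_eq_decide, hLdef]
      simp only [Left.neg_neg_iff, Nat.cast_pos, List.countP_pos_iff]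
    rw [h3]
    split_ifs <;> simp
  · intro x hx
    push Not at hx
    obtain ⟨l, hl, h⟩ := hx
    exact hψ x ⟨l, hl, by simpa using h⟩

/-! ### Qubits that stay zero -/

/-- All qubits of `Z` are in the state `|0⟩`. -/
def Vanishes (Z : Set W) (ψ : QState W) : Prop := ∀ x, (∃ w ∈ Z, x w = true) → ψ x = 0

/-- The circuit keeps the qubits of `Z` in the state `|0⟩`. -/
def Keeps (X : Matrix (Fin n) (Fin n) ℝ) (Z : Set W) (c : Circ W q b) : Prop :=
  ∀ ψ, Vanishes Z ψ → Vanishes Z (run X c ψ)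

variable {Z : Set W}

theorem Keeps.append {c d : Circ W q b} (hc : Keeps X Z c) (hd : Keeps X Z d) :
    Keeps X Z (c ++ d) := fun ψ h => by
  rw [run_append]; exact hd _ (hc _ h)

theorem keeps_nil : Keeps X Z ([] : Circ W q b) := fun _ h => h

theorem Keeps.flatMap {ι : Type*} {f : ι → Circ W q b} {l : List ι}
    (h : ∀ i ∈ l, Keeps X Z (f i)) : Keeps X Z (l.flatMap f) := by
  induction l with
  | nil => exact keeps_nil
  | cons i l ih =>
    rw [List.flatMap_cons]
    exact (h i (by simp)).append (ih fun j hj => h j (List.mem_cons_of_mem _ hj))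

theorem IsDiag.keeps {c : Circ W q b} {φ : (W → Bool) → ℝ} (h : IsDiag X c φ) :
    Keeps X Z c := fun ψ hψ x hx => by
  rw [h, hψ x hx, mul_zero]

theorem keeps_ctrl (u : W) {v : W} (hv : v ∉ Z) (V : Bool → Matrix.unitaryGroup Bool ℂ) :
    Keeps X Z (ctrl u v V : Circ W q b) := fun ψ hψ x hx => by
  by_cases h : v = u
  · simpa [ctrl, h, run] using hψ x hx
  · obtain ⟨w, hw, hxw⟩ := hx
    rw [run_ctrl h]
    refine Finset.sum_eq_zero fun c _ => ?_
    have hwv : w ≠ v := fun h' => hv (h' ▸ hw)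
    rw [hψ _ ⟨w, hw, by rwa [Function.update_of_ne hwv]⟩, mul_zero]

theorem keeps_inv_ctrl (u : W) {v : W} (hv : v ∉ Z) (V : Bool → Matrix.unitaryGroup Bool ℂ) :
    Keeps X Z (inv (ctrl u v V : Circ W q b)) := by
  rw [inv_ctrl]; exact keeps_ctrl u hv _

theorem inv_flatMap {W : Type} {ι : Type*} (f : ι → Circ W q b) (l : List ι) :
    inv (l.flatMap f) = l.reverse.flatMap fun i => inv (f i) := by
  induction l with
  | nil => rfl
  | cons i l ih => rw [List.flatMap_cons, inv_append, ih]; simp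

theorem keeps_compute [Nontrivial W] {v : ℕ → W} {D : ℕ → Circ W q b} {φ : ℕ → (W → Bool) → ℝ}
    {R : ℕ}
    (hv : ∀ l < R, ∀ m < R, v l = v m → l = m) (hD : ∀ l < R, IsDiag X (D l) (φ l))
    (hZ : ∀ l < R, v l ∉ Z) :
    Keeps X Z (compute v D R) ∧ Keeps X Z (inv (compute v D R)) := by
  induction R with
  | zero => exact ⟨keeps_nil, keeps_nil⟩
  | succ k ih =>
    have h := ih (fun l hl m hm => hv l (by omega) m (by omega)) (fun l hl => hD l (by omega))
      fun l hl => hZ l (by omega)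
    have hd : IsDiag X (D k ++ corrections v k) _ := (hD k (by omega)).append
      (isDiag_corrections fun m hm h => by
        have := hv k (by omega) m (by omega) h; omega)
    have hZk := hZ k (by omega)
    rw [compute]
    refine ⟨h.1.append (((keeps_ctrl _ hZk _).append hd.keeps).append (keeps_ctrl _ hZk _)), ?_⟩
    rw [inv_append, inv_append, inv_append]
    exact ((keeps_inv_ctrl _ hZk _).append
      (hd.inv.keeps.append (keeps_inv_ctrl _ hZk _))).append h.2

/-! ### Lengths -/

theorem length_compute_le [Nontrivial W] {v : ℕ → W} {D : ℕ → Circ W q b} {K : ℕ}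
    (hD : ∀ l, (D l).length ≤ K)
    (R : ℕ) : (compute v D R).length ≤ R * (K + R + 2) := by
  have h : ∀ k ≤ R, (compute v D k).length ≤ k * (K + R + 2) := by
    intro k hk
    induction k with
    | zero => simp [compute]
    | succ k ih =>
      have h1 := ih (by omega)
      have h2 := length_single_le (q := q) (b := b) (v k) hadamard
      have h3 := length_corrections_le (q := q) (b := b) v k
      have h4 := hD k
      rw [compute]
      simp only [List.length_append]
      rw [Nat.succ_mul]
      omega
  exact h R le_rfl

theorem length_reflect_le [Nontrivial W] (ws : List W) (v : ℕ → W) (m : ℕ) (s : Bool) :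
    (reflect ws v m s : Circ W q b).length ≤ 2 * ((m + 1) * (ws.length + (m + 1) + 2)) + 1 := by
  have h := length_compute_le (v := v) (D := fun l => (ws.flatMap fun w =>
    cphase w (v l) (-(2 * Real.pi / 2 ^ (l + 1))) : Circ W q b)) (K := ws.length)
    (fun l => (length_flatMap_le (K := 1) _ fun w => length_ctrl_le _ _ _).trans (by simp)) (m + 1)
  have h2 := length_single_le (q := q) (b := b) (v m)
    (phaseGate fun c => if c = s then Real.pi else 0)
  simp only [reflect, List.length_append, length_inv]
  omega

end Circ

end

section

/-! ### Amplitude amplification -/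

/-- The part of the state `ψ` on the basis states with the property `p`. -/
def restrict {W : Type} (p : (W → Bool) → Prop) [DecidablePred p] (ψ : QState W) : QState W :=
  WithLp.toLp 2 fun x => if p x then ψ x else 0

section

variable {W : Type} {p : (W → Bool) → Prop} [DecidablePred p]

theorem restrict_add (ψ φ : QState W) : restrict p (ψ + φ) = restrict p ψ + restrict p φ := by
  ext x; by_cases h : p x <;> simp [restrict, h]

theorem restrict_smul (c : ℂ) (ψ : QState W) : restrict p (c • ψ) = c • restrict p ψ := by
  ext x; by_cases h : p x <;> simp [restrict, h]

theorem restrict_restrict (ψ : QState W) : restrict p (restrict p ψ) = restrict p ψ := by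
  ext x; by_cases h : p x <;> simp [restrict, h]

theorem restrict_sub_restrict (ψ : QState W) : restrict p (ψ - restrict p ψ) = 0 := by
  ext x; by_cases h : p x <;> simp [restrict, h]

theorem inner_restrict_sub [DecidableEq W] [Fintype W] (ψ : QState W) :
    inner ℂ (restrict p ψ) (ψ - restrict p ψ) = 0 := by
  rw [PiLp.inner_apply]
  refine Finset.sum_eq_zero fun x _ => ?_
  by_cases h : p x <;> simp [restrict, h]

end

namespace Circ

/-- The `j`-fold repetition of a circuit. -/
def iter {W : Type} {q b : ℕ} (c : Circ W q b) : ℕ → Circ W q b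
  | 0 => []
  | j + 1 => iter c j ++ c

theorem length_iter {W : Type} {q b : ℕ} (c : Circ W q b) (j : ℕ) :
    (iter c j).length = j * c.length := by
  induction j with
  | zero => simp [iter]
  | succ j ih => rw [iter, List.length_append, ih]; ring

variable {W : Type} [DecidableEq W] [Fintype W] {n q b : ℕ} {X : Matrix (Fin n) (Fin n) ℝ}

/-- Amplitude amplification: if `sin θ` is the norm of the good part `g` of the state `Ψ` that `U`
prepares, then after `j` Grover iterations the good part of the state is a multiple of `g`, of norm
`|sin ((2 j + 1) θ)|`. -/
theorem exists_restrict_run_iter {p : (W → Bool) → Prop} [DecidablePred p] {Z : Set W}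
    {U S G : Circ W q b} (hU : Keeps X Z U) (hU' : Keeps X Z (inv U))
    (hS : ∀ ψ, Vanishes Z ψ → ∀ x, run X S ψ x = (if x = fun _ => false then 1 else -1) * ψ x)
    (hG : ∀ ψ, Vanishes Z ψ → ∀ x, run X G ψ x = (if p x then -1 else 1) * ψ x) (j : ℕ) :
    ∃ a : ℝ, restrict p (run X (iter (G ++ inv U ++ S ++ U) j) (run X U (zeroState W)))
        = (a : ℂ) • restrict p (run X U (zeroState W)) ∧
      a * ‖restrict p (run X U (zeroState W))‖
        = Real.sin ((2 * j + 1) * Real.arcsin ‖restrict p (run X U (zeroState W))‖) := by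
  set Ψ := run X U (zeroState W) with hΨ
  set g := restrict p Ψ with hg
  set h := Ψ - g with hh
  have hgh : inner ℂ g h = 0 := inner_restrict_sub Ψ
  have hhg : inner ℂ h g = 0 := inner_eq_zero_symm.1 hgh
  have hΨgh : Ψ = g + h := by rw [hh]; abel
  have hn : ‖g‖ ^ 2 + ‖h‖ ^ 2 = 1 := by
    have h1 := norm_add_sq_eq_norm_sq_add_norm_sq_of_inner_eq_zero g h hgh
    rw [← hΨgh, hΨ, norm_run, norm_zeroState] at h1
    nlinarith
  have hz : Vanishes Z (zeroState W) := fun x hx => by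
    obtain ⟨w, _, hw⟩ := hx
    rw [zeroState_eq_ket, ket_apply, if_neg]
    rintro rfl
    exact Bool.false_ne_true hw
  have hΨv : Vanishes Z Ψ := hU _ hz
  have hgv : Vanishes Z g := fun x hx => by
    change (if p x then Ψ x else 0) = 0
    rw [hΨv x hx, ite_self]
  have hhv : Vanishes Z h := fun x hx => by
    change Ψ x - g x = 0
    rw [hΨv x hx, hgv x hx, sub_zero]
  have hlin : ∀ (a c : ℂ), Vanishes Z (a • g + c • h) := fun a c x hx => by
    change a * g x + c * h x = 0
    rw [hgv x hx, hhv x hx]; simp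
  -- The two reflections, on the plane spanned by `g` and `h`.
  have hGp : ∀ a c : ℂ, run X G (a • g + c • h) = (-a) • g + c • h := fun a c => by
    ext x
    rw [hG _ (hlin a c)]
    change (if p x then -1 else 1) * (a * (if p x then Ψ x else 0)
      + c * (Ψ x - if p x then Ψ x else 0)) = -a * (if p x then Ψ x else 0)
      + c * (Ψ x - if p x then Ψ x else 0)
    split_ifs <;> ring
  have hSp : ∀ φ, Vanishes Z φ →
      run X (inv U ++ S ++ U) φ = (2 * inner ℂ Ψ φ) • Ψ - φ := fun φ hφ => by
    have h1 : run X S (run X (inv U) φ)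
        = (2 * inner ℂ Ψ φ) • zeroState W - run X (inv U) φ := by
      ext x
      rw [hS _ (hU' _ hφ)]
      have h2 : inner ℂ Ψ φ = run X (inv U) φ fun _ => false := by
        rw [← inner_ket, ← zeroState_eq_ket, ← inner_run_run (X := X) U (zeroState W)
            (run X (inv U) φ),
          run_run_inv]
      rw [zeroState_eq_ket, h2]
      change _ = (2 * _) * ket _ x - run X (inv U) φ x
      rw [ket_apply]
      split_ifs with hx
      · rw [hx]; ring
      · ring
    rw [run_append, run_append, h1]
    have h3 : ∀ α β : QState W, run X U (α - β) = run X U α - run X U β :=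
      fun α β => map_sub (isometry X U) α β
    rw [h3, run_smul, run_run_inv]
  have hQ : ∀ a c : ℝ, run X (G ++ inv U ++ S ++ U) ((a : ℂ) • g + (c : ℂ) • h)
      = ((2 * (-a * ‖g‖ ^ 2 + c * ‖h‖ ^ 2) + a : ℝ) : ℂ) • g
        + ((2 * (-a * ‖g‖ ^ 2 + c * ‖h‖ ^ 2) - c : ℝ) : ℂ) • h := fun a c => by
    rw [List.append_assoc, List.append_assoc, run_append, ← List.append_assoc, hGp, hSp _
        (hlin _ _)]
    have h1 : inner ℂ Ψ ((-(a : ℂ)) • g + (c : ℂ) • h)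
        = ((-a * ‖g‖ ^ 2 + c * ‖h‖ ^ 2 : ℝ) : ℂ) := by
      rw [hΨgh, inner_add_left, inner_add_right, inner_add_right, inner_smul_right,
        inner_smul_right, inner_smul_right, inner_smul_right, hgh, hhg,
        inner_self_eq_norm_sq_to_K, inner_self_eq_norm_sq_to_K]
      push_cast
      simp
    rw [h1, hΨgh]
    push_cast
    module
  set θ := Real.arcsin ‖g‖ with hθ
  have hs : Real.sin θ = ‖g‖ := Real.sin_arcsin (by linarith [norm_nonneg g]) (by
    nlinarith [norm_nonneg g, sq_nonneg ‖h‖])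
  have hc : Real.cos θ = ‖h‖ := by
    rw [hθ, Real.cos_arcsin, ← hn, add_sub_cancel_left, Real.sqrt_sq (norm_nonneg _)]
  have main : ∃ a c : ℝ, run X (iter (G ++ inv U ++ S ++ U) j) Ψ = (a : ℂ) • g + (c : ℂ) • h ∧
      a * Real.sin θ = Real.sin ((2 * j + 1) * θ) ∧
      c * Real.cos θ = Real.cos ((2 * j + 1) * θ) := by
    induction j with
    | zero => exact ⟨1, 1, by simpa [iter, run] using hΨgh, by simp, by simp⟩
    | succ j ih =>
      obtain ⟨a, c, h1, h2, h3⟩ := ih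
      refine ⟨_, _, by rw [iter, run_append, h1, hQ], ?_, ?_⟩
      · have e1 : Real.sin ((2 * ((j + 1 : ℕ) : ℝ) + 1) * θ)
            = Real.sin ((2 * j + 1) * θ) * Real.cos (2 * θ)
              + Real.cos ((2 * j + 1) * θ) * Real.sin (2 * θ) := by
          rw [← Real.sin_add]; push_cast; ring_nf
        rw [e1, ← h2, ← h3, ← hs, ← hc, Real.cos_two_mul, Real.sin_two_mul]
        have := Real.sin_sq_add_cos_sq θ
        linear_combination (-2 * a * Real.sin θ) * this
      · have e1 : Real.cos ((2 * ((j + 1 : ℕ) : ℝ) + 1) * θ)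
            = Real.cos ((2 * j + 1) * θ) * Real.cos (2 * θ)
              - Real.sin ((2 * j + 1) * θ) * Real.sin (2 * θ) := by
          rw [← Real.cos_add]; push_cast; ring_nf
        rw [e1, ← h2, ← h3, ← hs, ← hc, Real.cos_two_mul, Real.sin_two_mul]
        ring
  obtain ⟨a, c, h1, h2, -⟩ := main
  refine ⟨a, ?_, by rw [← hs, h2]⟩
  rw [h1, restrict_add, restrict_smul, restrict_smul, hh, restrict_sub_restrict, hg,
    restrict_restrict]
  simp

end Circ

/-- With a random number of Grover iterations below `m`, the average success probability is at
least `1/4` as soon as `m sin (2 θ) ≥ 1`. -/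
theorem quarter_le_avg_sin_sq {θ : ℝ} {m : ℕ} (h : 1 ≤ m * Real.sin (2 * θ)) :
    (m : ℝ) / 4 ≤ ∑ j ∈ Finset.range m, Real.sin ((2 * j + 1) * θ) ^ 2 := by
  have hs : 0 < Real.sin (2 * θ) := by
    by_contra hcon
    push Not at hcon
    nlinarith [(Nat.cast_nonneg m : (0 : ℝ) ≤ m)]
  have tel : ∀ k : ℕ, 2 * Real.sin (2 * θ) * ∑ j ∈ Finset.range k, Real.cos ((2 * j + 1) * (2 * θ))
      = Real.sin (2 * k * (2 * θ)) := by
    intro k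
    induction k with
    | zero => simp
    | succ k ih =>
      rw [Finset.sum_range_succ, mul_add, ih]
      have e1 : 2 * (k : ℝ) * (2 * θ) = (2 * k + 1) * (2 * θ) - 2 * θ := by ring
      have e2 : 2 * ((k + 1 : ℕ) : ℝ) * (2 * θ) = (2 * k + 1) * (2 * θ) + 2 * θ := by
        push_cast; ring
      rw [e1, e2, Real.sin_sub, Real.sin_add]
      ring
  have e : ∑ j ∈ Finset.range m, Real.sin ((2 * j + 1) * θ) ^ 2
      = m / 2 - (∑ j ∈ Finset.range m, Real.cos ((2 * j + 1) * (2 * θ))) / 2 := by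
    have : ∀ j ∈ Finset.range m, Real.sin ((2 * j + 1) * θ) ^ 2
        = 1 / 2 - Real.cos ((2 * j + 1) * (2 * θ)) / 2 := fun j _ => by
      rw [Real.sin_sq_eq_half_sub]; ring_nf
    rw [Finset.sum_congr rfl this, Finset.sum_sub_distrib, Finset.sum_const, Finset.card_range,
      nsmul_eq_mul, mul_one_div, Finset.sum_div]
  have h1 := tel m
  have h2 := Real.sin_le_one (2 * m * (2 * θ))
  rw [e]
  set C := ∑ j ∈ Finset.range m, Real.cos ((2 * j + 1) * (2 * θ))
  have h3 : C ≤ m / 2 := by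
    by_contra hcon
    push Not at hcon
    nlinarith
  linarith

/-- The bound on `y ^ 2` keeps the angle below `π / 4`, where `sin (2 θ)` is at least `sin θ`. -/
theorem one_le_mul_sin_two_arcsin {y m : ℝ} (h0 : 0 ≤ y) (h1 : y ^ 2 ≤ 1 / 2) (h : 1 ≤ m * y) :
    1 ≤ m * Real.sin (2 * Real.arcsin y) := by
  have hc : 1 / 2 ≤ Real.cos (Real.arcsin y) := by
    rw [Real.cos_arcsin]
    exact Real.le_sqrt_of_sq_le (by linarith)
  have hm : 0 < m := by
    by_contra hcon
    push Not at hcon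
    nlinarith
  rw [Real.sin_two_mul, Real.sin_arcsin (by linarith) (by nlinarith)]
  nlinarith [mul_nonneg hm.le h0]

end

section

/-! ### Layout of the qubits -/

/-- The ancillas of the state preparation: the column index and the entry for oracle queries, the
register `reg` of the exponents, a qubit `rot l` for the damping factor of each bit of `reg`, a coin
that halves all probabilities, and the register `tst` for reflections. -/
inductive Anc (q b R m : ℕ) : Type
  /-- column index -/
  | col (k : Fin q)
  /-- entry of the matrix -/
  | ent (l : Fin (b + 2))
  /-- exponent -/
  | reg (l : Fin R)
  /-- damping by a bit of the exponent -/
  | rot (l : Fin R)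
  /-- damping by a constant -/
  | coin
  /-- register for reflections -/
  | tst (l : Fin (m + 1))

variable {q b R m a n : ℕ}

/-- The qubits of the ancillas, numbered consecutively. -/
def ancEmb (q b R m : ℕ) : Anc q b R m ↪
    Fin (Fintype.card (Fin q ⊕ Fin (b + 2) ⊕ Fin R ⊕ Fin R ⊕ Unit ⊕ Fin (m + 1))) :=
  Function.Embedding.trans
    ⟨fun
      | .col k => Sum.inl k
      | .ent l => Sum.inr (Sum.inl l)
      | .reg l => Sum.inr (Sum.inr (Sum.inl l))
      | .rot l => Sum.inr (Sum.inr (Sum.inr (Sum.inl l)))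
      | .coin => Sum.inr (Sum.inr (Sum.inr (Sum.inr (Sum.inl ()))))
      | .tst l => Sum.inr (Sum.inr (Sum.inr (Sum.inr (Sum.inr l)))),
      fun x y => by cases x <;> cases y <;> simp⟩
    (Fintype.equivFin _).toEmbedding

section

variable (e : Anc q b R m ↪ Fin a)

/-- The registers of the oracle queries. -/
def registers : Registers (Fin q ⊕ Fin a) q b :=
  ⟨Sum.elim Sum.inl (Sum.elim (fun k => Sum.inr (e (.col k))) fun l => Sum.inr (e (.ent l))), by
    rintro (x | x | x) (y | y | y) <;> simp⟩

/-- The qubit number `l` of the entry register. -/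
def entW (l : ℕ) : Fin q ⊕ Fin a := Sum.inr (e (.ent (Fin.ofNat _ l)))

/-- The qubit number `l` of the register for reflections. -/
def tstW (l : ℕ) : Fin q ⊕ Fin a := Sum.inr (e (.tst (Fin.ofNat _ l)))

/-- The qubit number `l` of the exponent. -/
def regW [NeZero R] (l : ℕ) : Fin q ⊕ Fin a := Sum.inr (e (.reg (Fin.ofNat _ l)))

/-- The damping qubit for bit `l` of the exponent. -/
def rotW [NeZero R] (l : ℕ) : Fin q ⊕ Fin a := Sum.inr (e (.rot (Fin.ofNat _ l)))

/-- The coin. -/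
def coinW : Fin q ⊕ Fin a := Sum.inr (e .coin)

end

theorem ofNat_inj {R l k : ℕ} [NeZero R] (hl : l < R) (hk : k < R)
    (h : Fin.ofNat R l = Fin.ofNat R k) : l = k := by
  have := congrArg Fin.val h
  simpa [Nat.mod_eq_of_lt hl, Nat.mod_eq_of_lt hk] using this

/-! ### The phase of a matrix entry -/

/-- The entry of `X` in row `i` and column `k`, in units of `2⁻ᵖ` and rounded down; `0` if there
is no such entry. It is determined by the leading `p + 2` of the `b + 2` bits. -/
def truncEntry (X : Matrix (Fin n) (Fin n) ℝ) (b p i k : ℕ) : ℤ :=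
  if h : i < n ∧ k < n then ⌊X ⟨i, h.1⟩ ⟨k, h.2⟩ * 2 ^ b⌋ / 2 ^ (b - p) else 0

theorem floor_bounds {y : ℝ} (hy : |y| ≤ 1) (b : ℕ) :
    -2 ^ b ≤ ⌊y * 2 ^ b⌋ ∧ ⌊y * 2 ^ b⌋ ≤ 2 ^ b := by
  have h := abs_le.1 hy
  have hb : (0 : ℝ) < 2 ^ b := by positivity
  constructor
  · rw [Int.le_floor]; push_cast; nlinarith
  · have : ((⌊y * 2 ^ b⌋ : ℤ) : ℝ) ≤ ((2 ^ b : ℤ) : ℝ) := by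
      push_cast; exact (Int.floor_le _).trans (by nlinarith)
    exact_mod_cast this

theorem abs_truncEntry_le {X : Matrix (Fin n) (Fin n) ℝ} (hX : ∀ i j, |X i j| ≤ 1) {p : ℕ}
    (hp : p ≤ b) (i k : ℕ) : |truncEntry X b p i k| ≤ 2 ^ p := by
  unfold truncEntry
  split_ifs with h
  · obtain ⟨h1, h2⟩ := floor_bounds (hX ⟨i, h.1⟩ ⟨k, h.2⟩) b
    have hb : (2 : ℤ) ^ b = 2 ^ p * 2 ^ (b - p) := by rw [← pow_add]; congr 1; omega
    have hpos : (0 : ℤ) < 2 ^ (b - p) := by positivity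
    rw [abs_le]
    constructor
    · rw [Int.le_ediv_iff_mul_le hpos]; linarith
    · have := Int.ediv_le_ediv hpos h2
      rwa [hb, Int.mul_ediv_cancel _ hpos.ne'] at this
  · simp

theorem sum_inputBit {X : Matrix (Fin n) (Fin n) ℝ} (hX : ∀ i j, |X i j| ≤ 1) {p : ℕ}
    (hp : p ≤ b) (i k : ℕ) :
    ∑ l ∈ Finset.range (p + 2), (if inputBit b X i k (Fin.ofNat _ (b - p + l))
      then (if l = p + 1 then -2 ^ l else 2 ^ l : ℤ) else 0) = truncEntry X b p i k := by
  have hT := abs_le.1 (abs_truncEntry_le hX hp i k)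
  unfold truncEntry inputBit at *
  by_cases h : i < n ∧ k < n
  · simp only [dif_pos h] at hT ⊢
    set z := ⌊X ⟨i, h.1⟩ ⟨k, h.2⟩ * 2 ^ b⌋ with hz
    have hpp : (2 : ℤ) ^ p < 2 ^ (p + 1) := by
      rw [pow_succ]; have : (0 : ℤ) < 2 ^ p := by positivity
      linarith
    rw [← sum_zbit_sub_sign (z := z / 2 ^ (b - p)) (l := p + 1) (by linarith) (by linarith),
      Finset.sum_range_succ]
    have hbit : ∀ l ≤ p + 1, entryBit b (X ⟨i, h.1⟩ ⟨k, h.2⟩) (Fin.ofNat _ (b - p + l))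
        = zbit (z / 2 ^ (b - p)) l := by
      intro l hl
      rw [entryBit, testBit_eq_zbit, ← zbit_add, ← hz]
      congr 1
      simp only [Fin.val_ofNat]
      exact Nat.mod_eq_of_lt (by omega)
    congr 1
    · refine Finset.sum_congr rfl fun l hl => ?_
      rw [Finset.mem_range] at hl
      rw [hbit l hl.le, if_neg hl.ne]
    · rw [hbit _ le_rfl]; simp
  · simp [h]

theorem ofBits_eq_sum {k : ℕ} (x : Fin k → Bool) :
    Nat.ofBits x = ∑ i, if x i then 2 ^ (i : ℕ) else 0 := by
  induction k with
  | zero => simp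
  | succ k ih =>
    rw [Nat.ofBits_succ, ih, Fin.sum_univ_succ, Finset.mul_sum, add_comm]
    congr 1
    · cases x 0 <;> simp
    · refine Finset.sum_congr rfl fun i _ => ?_
      simp only [Function.comp, Fin.val_succ, pow_succ]
      split_ifs <;> ring

end

section

open Circ

variable {q b R m a n : ℕ} (e : Anc q b R m ↪ Fin a) {X : Matrix (Fin n) (Fin n) ℝ}

theorem regW_inj [NeZero R] : ∀ l < R, ∀ k < R, regW e l = regW e k → l = k := fun l hl k hk h =>
  ofNat_inj hl hk (by simpa [regW] using h)

theorem rotW_inj [NeZero R] : ∀ l < R, ∀ k < R, rotW e l = rotW e k → l = k := fun l hl k hk h =>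
  ofNat_inj hl hk (by simpa [rotW] using h)

theorem tstW_inj : ∀ l < m + 1, ∀ k < m + 1, tstW e l = tstW e k → l = k := fun l hl k hk h =>
  ofNat_inj hl hk (by simpa [tstW] using h)

theorem registers_row (k : Fin q) : registers e (Sum.inl k) = Sum.inl k := rfl

theorem registers_col (k : Fin q) : registers e (Sum.inr (Sum.inl k)) = Sum.inr (e (.col k)) := rfl

theorem registers_ent (l : Fin (b + 2)) :
    registers e (Sum.inr (Sum.inr l)) = Sum.inr (e (.ent l)) := rfl

/-- The qubits of the column register that are set in the binary representation of `k`. -/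
def colWires (k : ℕ) : List (Fin q ⊕ Fin a) :=
  ((List.finRange q).filter fun j : Fin q => k.testBit j).map fun j => Sum.inr (e (.col j))

theorem nodup_colWires (k : ℕ) : (colWires e k).Nodup :=
  ((List.nodup_finRange q).filter _).map fun x y h => by simpa using h

theorem length_colWires_le (k : ℕ) : (colWires e k).length ≤ q := by
  rw [colWires, List.length_map]
  exact (List.length_filter_le _ _).trans (by simp)

/-- Exchange the column index `0` for `k`. -/
def setCol (k : ℕ) (x : Fin q ⊕ Fin a → Bool) : Fin q ⊕ Fin a → Bool := flipBits (colWires e k) x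

/-- The value of the phase when the registers for queries are zero. -/
theorem phase_entryPhase (hX : ∀ i j, |X i j| ≤ 1) {p : ℕ} (hp : p ≤ b) {k : ℕ} (hk : k < 2 ^ q)
    {v : Fin q ⊕ Fin a} (hv : ∀ l, v ≠ entW e l) (hv' : ∀ j, v ≠ Sum.inr (e (.col j))) (θ : ℝ)
    {x : Fin q ⊕ Fin a → Bool} (hc : ∀ j, x (Sum.inr (e (.col j))) = false)
    (he : ∀ l, x (Sum.inr (e (.ent l))) = false) :
    (∑ l ∈ Finset.range (p + 2),
      if oracleBasis X (registers e) (setCol e k x) (entW e (b - p + l))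
        && oracleBasis X (registers e) (setCol e k x) v
      then θ * ((if l = p + 1 then -2 ^ l else 2 ^ l : ℤ) : ℝ) else 0)
    = if x v then θ * truncEntry X b p (Nat.ofBits fun j => x (Sum.inl j)) k else 0 := by
  have hxv : oracleBasis X (registers e) (setCol e k x) v = x v := by
    rw [oracleBasis_of_notMem]
    · have : v ∉ colWires e k := by
        simp only [colWires, List.mem_map, not_exists, not_and]
        exact fun j _ h => hv' j h.symm
      exact flipBits_of_notMem this x
    · intro l h
      refine hv l ?_
      rw [← h, registers_ent]
      simp [entW]
  have hent : ∀ l, oracleBasis X (registers e) (setCol e k x) (entW e l)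
      = inputBit b X (Nat.ofBits fun j => x (Sum.inl j)) k (Fin.ofNat _ l) := by
    intro l
    have h := oracleBasis_entry (X := X) (registers e) (setCol e k x) (Fin.ofNat _ l)
    have h1 : ∀ l : Fin (b + 2), setCol e k x (Sum.inr (e (.ent l))) = false := fun l => by
      rw [setCol, flipBits_of_notMem (by simp [colWires]), he]
    have h2 : ∀ j, setCol e k x (Sum.inl j) = x (Sum.inl j) := fun j =>
      flipBits_of_notMem (by simp [colWires]) x
    have h3 : ∀ j, setCol e k x (Sum.inr (e (.col j))) = k.testBit j := fun j => by
      have hmem : (Sum.inr (e (.col j)) : Fin q ⊕ Fin a) ∈ colWires e k ↔ k.testBit j = true := by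
        simp [colWires]
      cases hkj : k.testBit j
      · rw [setCol, flipBits_of_notMem (by simp [hmem, hkj]), hc]
      · rw [setCol, flipBits_of_mem (hmem.2 hkj), hc, Bool.not_false]
    have h4 : (Nat.ofBits fun j : Fin q => k.testBit j) = k := by
      rw [Nat.ofBits_testBit, Nat.mod_eq_of_lt hk]
    simp only [registers_row, registers_col, registers_ent, h1, h2, h3, h4, Bool.false_xor] at h
    exact h
  rw [← sum_inputBit hX hp]
  simp only [hxv, hent]
  cases x v
  · simp
  · simp only [Bool.and_true, if_true]
    push_cast
    rw [Finset.mul_sum]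
    refine Finset.sum_congr rfl fun l _ => ?_
    split_ifs <;> simp

section

variable [Nontrivial (Fin q ⊕ Fin a)]

/-- The phase `exp (i θ z)` on the set qubit `v`, where `z` is the rounded entry of the input matrix
in the row given by the index register and column `k`: the entry is queried, each of its bits
contributes its phase, and the query is undone. -/
def entryPhase (p k : ℕ) (v : Fin q ⊕ Fin a) (θ : ℝ) : Circ (Fin q ⊕ Fin a) q b :=
  flips (colWires e k) ++ ([Op.query (registers e)] ++
    ((List.range (p + 2)).flatMap fun l => cphase (entW e (b - p + l)) v
      (θ * ((if l = p + 1 then -2 ^ l else 2 ^ l : ℤ) : ℝ))) ++ [Op.query (registers e)])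
    ++ flips (colWires e k)

theorem isDiag_entryPhase (p k : ℕ) {v : Fin q ⊕ Fin a} (hv : ∀ l, v ≠ entW e l) (θ : ℝ) :
    IsDiag X (entryPhase e p k v θ) fun x => ∑ l ∈ Finset.range (p + 2),
      if oracleBasis X (registers e) (setCol e k x) (entW e (b - p + l))
        && oracleBasis X (registers e) (setCol e k x) v
      then θ * ((if l = p + 1 then -2 ^ l else 2 ^ l : ℤ) : ℝ) else 0 := by
  have h1 : IsDiag X ((List.range (p + 2)).flatMap fun l => cphase (entW e (b - p + l)) v
      (θ * ((if l = p + 1 then -2 ^ l else 2 ^ l : ℤ) : ℝ)) : Circ (Fin q ⊕ Fin a) q b) _ :=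
    IsDiag.flatMap fun l _ => isDiag_cphase (hv _) _
  have h2 := h1.conj (c := [Op.query (registers e)]) (e := [Op.query (registers e)])
    (π := oracleBasis X (registers e)) (fun ψ x => rfl) (fun ψ x => rfl)
    (oracleBasis_involutive _)
  have h3 := h2.conj (c := flips (colWires e k)) (e := flips (colWires e k)) (π := setCol e k)
    (fun ψ x => run_flips _ (nodup_colWires e k) ψ x)
    (fun ψ x => run_flips _ (nodup_colWires e k) ψ x) (flipBits_involutive _)
  exact h3.congr fun x => sum_map_range _ _

theorem length_entryPhase_le (p k : ℕ) (v : Fin q ⊕ Fin a) (θ : ℝ) :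
    (entryPhase e p k v θ).length ≤ 2 * q + p + 4 := by
  have h1 := (length_flips_le (q := q) (b := b) (colWires e k)).trans (length_colWires_le e k)
  have h2 : ((List.range (p + 2)).flatMap fun l => cphase (entW e (b - p + l)) v
      (θ * ((if l = p + 1 then -2 ^ l else 2 ^ l : ℤ) : ℝ)) : Circ (Fin q ⊕ Fin a) q b).length
      ≤ p + 2 := (length_flatMap_le (K := 1) _ fun l => length_ctrl_le _ _ _).trans (by simp)
  simp only [entryPhase, List.length_append, List.length_singleton]
  omega

/-! ### The exponent as an integer-valued form in the index -/

/-- The form `c₀ + c₁ i + c₂ ∑ₖ z i k` in the rounded entries `z` in row `i` and columns `ks`. -/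
def formVal (X : Matrix (Fin n) (Fin n) ℝ) (b p : ℕ) (c₀ c₁ c₂ : ℤ) (ks : List (Fin n)) (i : ℕ) :
    ℤ :=
  c₀ + c₁ * i + c₂ * (ks.map fun k : Fin n => truncEntry X b p i k).sum

/-- The phase `exp (i θ L)` on the set qubit `v`, where `L` is the value of the form `formVal` at
the index in the index register. -/
def formPhase (p : ℕ) (c₀ c₁ c₂ : ℤ) (ks : List (Fin n)) (v : Fin q ⊕ Fin a) (θ : ℝ) :
    Circ (Fin q ⊕ Fin a) q b :=
  single v (phaseGate fun c => if c then θ * c₀ else 0) ++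
    ((List.finRange q).flatMap fun k => cphase (Sum.inl k) v (θ * (c₁ * 2 ^ (k : ℕ)))) ++
    ks.flatMap fun k : Fin n => entryPhase e p k v (θ * c₂)

theorem exists_isDiag_formPhase (hX : ∀ i j, |X i j| ≤ 1) (hn : n ≤ 2 ^ q) {p : ℕ} (hp : p ≤ b)
    (c₀ c₁ c₂ : ℤ) (ks : List (Fin n)) {v : Fin q ⊕ Fin a} (hv : ∀ l, v ≠ entW e l)
    (hv' : ∀ j, v ≠ Sum.inr (e (.col j))) (hv'' : ∀ j, v ≠ Sum.inl j) (θ : ℝ) :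
    ∃ φ, IsDiag X (formPhase e p c₀ c₁ c₂ ks v θ) φ ∧ ∀ x : Fin q ⊕ Fin a → Bool,
      (∀ j, x (Sum.inr (e (.col j))) = false) → (∀ l, x (Sum.inr (e (.ent l))) = false) →
      φ x = if x v then
        θ * formVal X b p c₀ c₁ c₂ ks (Nat.ofBits fun j => x (Sum.inl j)) else 0 := by
  refine ⟨_, ((isDiag_single v _).append
      (IsDiag.flatMap fun k _ => isDiag_cphase (hv'' k) _)).append
    (IsDiag.flatMap fun k _ => isDiag_entryPhase e p k hv _), fun x hc he => ?_⟩
  have h1 : ∀ k : Fin n, (k : ℕ) < 2 ^ q := fun k => lt_of_lt_of_le k.2 hn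
  simp only [phase_entryPhase e hX hp (h1 _) hv hv' _ hc he]
  cases hxv : x v
  · simp
  · simp only [if_true, Bool.and_true, formVal]
    have h2 : ((List.finRange q).map fun k => if x (Sum.inl k) then θ * (c₁ * 2 ^ (k : ℕ))
        else 0 : List ℝ).sum = θ * c₁ * ((Nat.ofBits fun j => x (Sum.inl j) : ℕ) : ℝ) := by
      rw [ofBits_eq_sum, ← List.ofFn_eq_map, List.sum_ofFn]
      push_cast
      rw [Finset.mul_sum]
      refine Finset.sum_congr rfl fun k _ => ?_
      split_ifs <;> ring
    have h3 : ∀ l : List (Fin n), (l.map fun k : Fin n => θ * c₂ *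
        (truncEntry X b p (Nat.ofBits fun j => x (Sum.inl j)) k : ℝ)).sum
        = θ * c₂ * ((l.map fun k : Fin n => truncEntry X b p
            (Nat.ofBits fun j => x (Sum.inl j)) k).sum
          : ℤ) := by
      intro l
      induction l with
      | nil => simp
      | cons k l ih => simp only [List.map_cons, List.sum_cons, ih]; push_cast; ring
    rw [h2, h3]
    push_cast
    ring

theorem length_formPhase_le (p : ℕ) (c₀ c₁ c₂ : ℤ) (ks : List (Fin n)) (v : Fin q ⊕ Fin a)
    (θ : ℝ) : (formPhase e p c₀ c₁ c₂ ks v θ).length ≤ 1 + q + ks.length * (2 * q + p + 4) := by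
  have h1 := length_single_le (q := q) (b := b) v (phaseGate fun c => if c then θ * c₀ else 0)
  have h2 : ((List.finRange q).flatMap fun k => cphase (Sum.inl k) v (θ * (c₁ * 2 ^ (k : ℕ)))
      : Circ (Fin q ⊕ Fin a) q b).length ≤ q :=
    (length_flatMap_le (K := 1) _ fun l => length_ctrl_le _ _ _).trans (by simp)
  have h3 := length_flatMap_le (f := fun k : Fin n => entryPhase e p k v (θ * c₂)) ks
    fun k => length_entryPhase_le e p k v _
  simp only [formPhase, List.length_append]
  omega

variable [NeZero R]

/-- Write the exponent into the register `reg`. -/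
def formCirc (p : ℕ) (c₀ c₁ c₂ : ℤ) (ks : List (Fin n)) : Circ (Fin q ⊕ Fin a) q b :=
  compute (regW e) (fun l => formPhase e p c₀ c₁ c₂ ks (regW e l) (2 * Real.pi / 2 ^ (l + 1))) R

theorem run_formCirc_ket (hX : ∀ i j, |X i j| ≤ 1) (hn : n ≤ 2 ^ q) {p : ℕ} (hp : p ≤ b)
    (c₀ c₁ c₂ : ℤ) (ks : List (Fin n)) (i : Fin q → Bool) :
    run X (formCirc e p c₀ c₁ c₂ ks) (ket (Sum.elim i fun _ => false)) =
      ket (setBits (regW e) (zbit (formVal X b p c₀ c₁ c₂ ks (Nat.ofBits i))) R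
        (Sum.elim i fun _ => false)) := by
  choose φ hφ1 hφ2 using fun l : ℕ => exists_isDiag_formPhase e hX hn hp c₀ c₁ c₂ ks
    (v := regW e l) (by simp [regW, entW]) (by simp [regW]) (by simp [regW])
    (2 * Real.pi / 2 ^ (l + 1))
  refine run_compute_ket (regW_inj e) (fun l _ => hφ1 l)
    (A := fun x => (∀ j, x (Sum.inr (e (.col j))) = false) ∧ ∀ l, x (Sum.inr (e (.ent l))) = false)
    (L := fun x => formVal X b p c₀ c₁ c₂ ks (Nat.ofBits fun j => x (Sum.inl j)))
    (fun l _ x hx => ?_) (fun l _ x c hx => ?_) (fun l _ x c _ => ?_) ?_ ?_ le_rfl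
  · rw [hφ2 l x hx.1 hx.2]
    split_ifs <;> ring
  · simp [regW, hx.1, hx.2]
  · simp [regW]
  · simp
  · simp [regW]

theorem keeps_formCirc (hX : ∀ i j, |X i j| ≤ 1) (hn : n ≤ 2 ^ q) {p : ℕ} (hp : p ≤ b)
    (c₀ c₁ c₂ : ℤ) (ks : List (Fin n)) {Z : Set (Fin q ⊕ Fin a)} (hZ : ∀ l < R, regW e l ∉ Z) :
    Keeps X Z (formCirc e p c₀ c₁ c₂ ks) ∧ Keeps X Z (inv (formCirc e p c₀ c₁ c₂ ks)) := by
  choose φ hφ1 hφ2 using fun l : ℕ => exists_isDiag_formPhase e hX hn hp c₀ c₁ c₂ ks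
    (v := regW e l) (by simp [regW, entW]) (by simp [regW]) (by simp [regW])
    (2 * Real.pi / 2 ^ (l + 1))
  exact keeps_compute (regW_inj e) (fun l _ => hφ1 l) hZ

theorem length_formCirc_le (p : ℕ) (c₀ c₁ c₂ : ℤ) (ks : List (Fin n)) :
    (formCirc e p c₀ c₁ c₂ ks).length ≤
      R * (1 + q + ks.length * (2 * q + p + 4) + R + 2) :=
  length_compute_le (fun _ => length_formPhase_le e p c₀ c₁ c₂ ks _ _) R

end

end

section

open Circ

namespace Circ

/-! ### Hadamard gates and damping -/

variable {W : Type} [DecidableEq W] {n q b : ℕ} {X : Matrix (Fin n) (Fin n) ℝ}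

/-- Hadamard gates spread the state `|0⟩` over all values of the qubits `vs`. -/
theorem run_flatMap_hadamard [Fintype W] [Nontrivial W] (vs : List W) (hvs : vs.Nodup)
    (x : W → Bool) :
    run X (vs.flatMap fun v => single v hadamard : Circ W q b) (zeroState W) x =
      ((1 / √2 : ℝ) : ℂ) ^ vs.length * if ∀ w, w ∉ vs → x w = false then 1 else 0 := by
  have main : ∀ (us : List W) (c : ℂ) (ψ : QState W), (us ++ vs).Nodup →
      (∀ x, ψ x = c * if ∀ w, w ∉ us → x w = false then 1 else 0) →
      ∀ x, run X (vs.flatMap fun v => single v hadamard : Circ W q b) ψ x =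
        c * ((1 / √2 : ℝ) : ℂ) ^ vs.length * if ∀ w, w ∉ us ++ vs → x w = false then 1 else 0 := by
    clear hvs x
    induction vs with
    | nil => intro us c ψ _ h x; simpa [run] using h x
    | cons v vs ih =>
      intro us c ψ hnd h x
      rw [List.flatMap_cons, run_append]
      have hv : v ∉ us := fun hv => by
        rw [List.nodup_append] at hnd
        exact hnd.2.2 v hv v (by simp) rfl
      rw [ih (us ++ [v]) (c * ((1 / √2 : ℝ) : ℂ)) _ (by simpa using hnd)]
      · rw [List.append_assoc, List.singleton_append, List.length_cons, pow_succ']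
        ring
      · intro y
        rw [run_single, Fintype.sum_bool, h, h]
        have h1 : ¬ ∀ w, w ∉ us → Function.update y v true w = false := fun h' => by
          have := h' v hv
          simp at this
        have h2 : (∀ w, w ∉ us → Function.update y v false w = false) ↔
            ∀ w, w ∉ us ++ [v] → y w = false := by
          refine ⟨fun h' w hw => ?_, fun h' w hw => ?_⟩
          · simp only [List.mem_append, List.mem_singleton, not_or] at hw
            simpa [Function.update_of_ne hw.2] using h' w hw.1
          · by_cases hwv : w = v
            · subst hwv; simp
            · rw [Function.update_of_ne hwv]
              exact h' w (by simp [hw, hwv])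
        rw [if_neg h1]
        simp only [h2, hadamard, Matrix.of_apply, Bool.and_false]
        simp only [Bool.false_eq_true, if_false, mul_one, mul_zero, zero_add]
        ring
  have := main [] 1 (zeroState W) (by simpa using hvs) (fun x => by
    rw [zeroState_eq_ket, ket_apply, one_mul]
    congr 1
    simp [funext_iff]) x
  simpa using this

theorem prod_map_range {M : Type*} [CommMonoid M] (f : ℕ → M) (l : ℕ) :
    ((List.range l).map f).prod = ∏ m ∈ Finset.range l, f m := by
  induction l with
  | zero => rfl
  | succ l ih => rw [List.range_succ, Finset.prod_range_succ]; simp [ih]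

/-- Controlled by the qubits `u l`, the qubits `w l` are rotated. The part in which all of these
remain zero is damped by the factors `lam l` of the set qubits `u l`. -/
theorem run_flatMap_rotation {u w : ℕ → W} (ls : List ℕ)
    (hls : ls.Pairwise fun l k => w l ≠ w k) (huw : ∀ l k, u l ≠ w k) {lam : ℕ → ℝ}
    (hlam : ∀ l, lam l ∈ Set.Icc 0 1) {ψ : QState W}
    (hψ : ∀ x, (∃ l ∈ ls, x (w l) = true) → ψ x = 0) {x : W → Bool}
    (hx : ∀ l ∈ ls, x (w l) = false) :
    run X (ls.flatMap fun l => ctrl (u l) (w l) fun β => if β then rotation (lam l) else 1 :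
      Circ W q b) ψ x = (ls.map fun l => if x (u l) then (lam l : ℂ) else 1).prod * ψ x := by
  induction ls generalizing ψ with
  | nil => simp [run]
  | cons l ls ih =>
    rw [List.pairwise_cons] at hls
    rw [List.flatMap_cons, run_append, ih hls.2, List.map_cons, List.prod_cons]
    · have hxl := hx l (by simp)
      have h1 : ψ (Function.update x (w l) true) = 0 :=
        hψ _ ⟨l, by simp, by simp⟩
      have h2 : Function.update x (w l) false = x := by rw [← hxl, Function.update_eq_self]
      rw [run_ctrl (huw l l).symm, Fintype.sum_bool, h1, h2, hxl]
      cases x (u l)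
      · simp
      · have := rotation_false_false (y := lam l) (by linarith [(hlam l).1]) (hlam l).2
        simp only [if_true, this]
        ring
    · rintro y ⟨k, hk, hyk⟩
      rw [run_ctrl (huw l l).symm]
      refine Finset.sum_eq_zero fun c _ => ?_
      rw [hψ _ ⟨k, List.mem_cons_of_mem _ hk, by
        rwa [Function.update_of_ne (hls.1 k hk).symm]⟩, mul_zero]
    · exact fun k hk => hx k (List.mem_cons_of_mem _ hk)

end Circ

variable {q b R m a n : ℕ} (e : Anc q b R m ↪ Fin a) {X : Matrix (Fin n) (Fin n) ℝ}
  [Nontrivial (Fin q ⊕ Fin a)] [NeZero R]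

/-! ### The circuit to be amplified -/

/-- The damping qubits: all must be found zero. The coin among them keeps the squared norm of the
part to be amplified at most `1 / 2`. -/
def dampWires : List (Fin q ⊕ Fin a) := coinW e :: (List.range R).map (rotW e)

/-- The qubits that are not zero before and after all parts of the circuit `prepCirc`. -/
def mainWires : List (Fin q ⊕ Fin a) :=
  (List.finRange q).map Sum.inl ++ (List.range R).map (regW e) ++ dampWires e

/-- Damping by `1 / √2`, and by `lam l` for every set bit `l` of the exponent. -/
def dampCirc (lam : ℕ → ℝ) : Circ (Fin q ⊕ Fin a) q b :=
  single (coinW e) hadamard ++ (List.range R).flatMap fun l =>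
    ctrl (regW e l) (rotW e l) fun β => if β then rotation (lam l) else 1

/-- The uniform superposition over all indices. -/
def uniformCirc (q a b : ℕ) [Nontrivial (Fin q ⊕ Fin a)] : Circ (Fin q ⊕ Fin a) q b :=
  ((List.finRange q).map Sum.inl).flatMap fun v => single v hadamard

/-- Prepare the uniform superposition, compute the exponent and damp. -/
def prepCirc (p : ℕ) (c₀ c₁ c₂ : ℤ) (ks : List (Fin n)) (lam : ℕ → ℝ) :
    Circ (Fin q ⊕ Fin a) q b :=
  uniformCirc q a b ++ formCirc e p c₀ c₁ c₂ ks ++ dampCirc e lam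

/-- No damping qubit is set. -/
def IsGood (x : Fin q ⊕ Fin a → Bool) : Prop := ¬ ∃ w ∈ dampWires e, x w = true

instance : DecidablePred (IsGood e) := fun _ => Classical.propDecidable _

/-- The product of the damping factors of the set bits of `z`. -/
def damping (lam : ℕ → ℝ) (R : ℕ) (z : ℤ) : ℝ :=
  ∏ l ∈ Finset.range R, if zbit z l then lam l else 1

/-- The amplitudes of the good part of the prepared state. -/
def ampVec (X : Matrix (Fin n) (Fin n) ℝ) (q b p : ℕ) (c₀ c₁ c₂ : ℤ) (ks : List (Fin n))
    (lam : ℕ → ℝ) (R : ℕ) : QState (Fin q) :=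
  WithLp.toLp 2 fun i => (((1 / √2) ^ (q + 1) *
    damping lam R (formVal X b p c₀ c₁ c₂ ks (Nat.ofBits i)) : ℝ) : ℂ)

omit [Nontrivial (Fin q ⊕ Fin a)] in
theorem isGood_iff (x : Fin q ⊕ Fin a → Bool) :
    IsGood e x ↔ x (coinW e) = false ∧ ∀ l < R, x (rotW e l) = false := by
  simp [IsGood, dampWires]

theorem run_dampCirc {lam : ℕ → ℝ} (hlam : ∀ l, lam l ∈ Set.Icc 0 1)
    {ψ : QState (Fin q ⊕ Fin a)} (hψ : ∀ x, ¬ IsGood e x → ψ x = 0) {x : Fin q ⊕ Fin a → Bool}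
    (hx : IsGood e x) : run X (dampCirc e lam) ψ x =
      ((∏ l ∈ Finset.range R, if x (regW e l) then lam l else 1 : ℝ) : ℂ)
        * (((1 / √2 : ℝ) : ℂ) * ψ x) := by
  have hx' := (isGood_iff e x).1 hx
  have hcoin : ∀ y, run X (single (coinW e) hadamard : Circ (Fin q ⊕ Fin a) q b) ψ y
      = ((1 / √2 : ℝ) : ℂ) * ψ (Function.update y (coinW e) false) := fun y => by
    have h1 : ψ (Function.update y (coinW e) true) = 0 :=
      hψ _ fun h => by simpa using ((isGood_iff e _).1 h).1
    rw [run_single, Fintype.sum_bool, h1]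
    simp [hadamard]
  rw [dampCirc, run_append, run_flatMap_rotation (u := regW e) (w := rotW e) _ _ _ hlam, hcoin]
  · congr 1
    · rw [prod_map_range, Complex.ofReal_prod]
      exact Finset.prod_congr rfl fun l _ => by split_ifs <;> simp
    · rw [← hx'.1, Function.update_eq_self]
  · rintro y ⟨l, hl, hyl⟩
    rw [hcoin, hψ, mul_zero]
    intro h
    have := ((isGood_iff e _).1 h).2 l (by simpa using hl)
    rw [Function.update_of_ne (by simp [rotW, coinW])] at this
    simp [hyl] at this
  · exact fun l hl => hx'.2 l (by simpa using hl)
  · refine List.Nodup.pairwise_of_forall_ne (List.nodup_range) fun l hl k hk hlk h => ?_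
    exact hlk (rotW_inj e l (by simpa using hl) k (by simpa using hk) h)
  · simp [regW, rotW]

omit [Nontrivial (Fin q ⊕ Fin a)] [NeZero R] in
theorem tensorState_zeroState (v : QState (Fin q)) :
    tensorState v (zeroState (Fin a)) = ∑ i, v i • ket (Sum.elim i fun _ => false) := by
  ext x
  simp only [WithLp.ofLp_sum, WithLp.ofLp_smul, Finset.sum_apply, Pi.smul_apply, ket_apply,
    smul_eq_mul, zeroState_eq_ket, tensorState]
  rw [Finset.sum_eq_single fun i => x (Sum.inl i)]
  · congr 1
    refine if_congr ?_ rfl rfl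
    simp only [funext_iff, Sum.forall, Sum.elim_inl, Sum.elim_inr, implies_true, true_and]
  · intro i _ hi
    rw [if_neg, mul_zero]
    intro h
    exact hi (funext fun j => by rw [h]; rfl)
  · simp

theorem run_uniformCirc : run X (uniformCirc q a b) (zeroState _) =
    ((1 / √2 : ℝ) : ℂ) ^ q • ∑ i, ket (Sum.elim i fun _ => false) := by
  ext x
  have h1 : ∑ i : Fin q → Bool, (ket (Sum.elim i fun _ => false) : QState (Fin q ⊕ Fin a))
      = tensorState (WithLp.toLp 2 fun _ => 1) (zeroState (Fin a)) := by
    rw [tensorState_zeroState]; simp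
  rw [uniformCirc, run_flatMap_hadamard _ ((List.nodup_finRange q).map Sum.inl_injective), h1]
  simp only [WithLp.ofLp_smul, Pi.smul_apply, smul_eq_mul, List.length_map, List.length_finRange,
    tensorState, zeroState, one_mul]
  congr 1
  have h2 : (∀ w, w ∉ (List.finRange q).map (Sum.inl : Fin q → Fin q ⊕ Fin a) → x w = false)
      ↔ (fun v => x (Sum.inr v)) = fun _ => false := by
    simp [funext_iff]
  by_cases h : (fun v => x (Sum.inr v)) = fun _ => false
  · rw [if_pos (h2.2 h), if_pos h]
  · rw [if_neg fun h' => h (h2.1 h'), if_neg h]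

/-- The good part of the prepared state: once the exponent is uncomputed, it is the vector of
amplitudes, with all ancillas zero. -/
theorem run_inv_formCirc_restrict (hX : ∀ i j, |X i j| ≤ 1) (hn : n ≤ 2 ^ q) {p : ℕ} (hp : p ≤ b)
    (c₀ c₁ c₂ : ℤ) (ks : List (Fin n)) {lam : ℕ → ℝ} (hlam : ∀ l, lam l ∈ Set.Icc 0 1) :
    run X (inv (formCirc e p c₀ c₁ c₂ ks))
        (restrict (IsGood e) (run X (prepCirc e p c₀ c₁ c₂ ks lam) (zeroState _)))
      = tensorState (ampVec X q b p c₀ c₁ c₂ ks lam R) (zeroState (Fin a)) := by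
  set y : (Fin q → Bool) → Fin q ⊕ Fin a → Bool := fun i =>
    setBits (regW e) (zbit (formVal X b p c₀ c₁ c₂ ks (Nat.ofBits i))) R
        (Sum.elim i fun _ => false) with hy
  have hyg : ∀ i, IsGood e (y i) := fun i => by
    rw [isGood_iff, hy]
    simp only
    rw [setBits_of_notMem (by simp [regW, coinW])]
    refine ⟨rfl, fun l _ => ?_⟩
    rw [setBits_of_notMem (by simp [regW, rotW])]
    rfl
  have h1 : run X (formCirc e p c₀ c₁ c₂ ks) (run X (uniformCirc q a b) (zeroState _))
      = ((1 / √2 : ℝ) : ℂ) ^ q • ∑ i, ket (y i) := by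
    rw [run_uniformCirc, run_smul, run_sum]
    congr 1
    exact Finset.sum_congr rfl fun i _ => run_formCirc_ket e hX hn hp c₀ c₁ c₂ ks i
  have h2 : restrict (IsGood e) (run X (prepCirc e p c₀ c₁ c₂ ks lam) (zeroState _))
      = ∑ i, ampVec X q b p c₀ c₁ c₂ ks lam R i • ket (y i) := by
    ext x
    rw [prepCirc, run_append, run_append, h1]
    simp only [restrict]
    by_cases hx : IsGood e x
    · rw [if_pos hx, run_dampCirc e hlam _ hx]
      · simp only [WithLp.ofLp_sum, WithLp.ofLp_smul, Finset.sum_apply, Pi.smul_apply, ket_apply,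
          smul_eq_mul, Finset.mul_sum]
        refine Finset.sum_congr rfl fun i _ => ?_
        split_ifs with hxi
        · have : (∏ l ∈ Finset.range R, if x (regW e l) then lam l else 1 : ℝ)
              = damping lam R (formVal X b p c₀ c₁ c₂ ks (Nat.ofBits i)) := by
            refine Finset.prod_congr rfl fun l hl => ?_
            rw [hxi, hy]
            simp only [setBits_apply (regW_inj e) (Finset.mem_range.1 hl)]
          rw [this, ampVec]
          push_cast
          ring
        · simp
      · intro z hz
        simp only [WithLp.ofLp_sum, WithLp.ofLp_smul, Finset.sum_apply, Pi.smul_apply, ket_apply,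
          smul_eq_mul]
        rw [Finset.sum_eq_zero, mul_zero]
        intro i _
        rw [if_neg]
        rintro rfl
        exact hz (hyg i)
    · rw [if_neg hx]
      simp only [WithLp.ofLp_sum, WithLp.ofLp_smul, Finset.sum_apply, Pi.smul_apply, ket_apply,
        smul_eq_mul]
      symm
      refine Finset.sum_eq_zero fun i _ => ?_
      rw [if_neg, mul_zero]
      rintro rfl
      exact hx (hyg i)
  rw [h2, run_sum, tensorState_zeroState]
  refine Finset.sum_congr rfl fun i _ => ?_
  rw [run_smul, hy]
  simp only
  rw [← run_formCirc_ket e hX hn hp c₀ c₁ c₂ ks i, run_inv_run]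

/-! ### Amplification of the circuit -/

theorem keeps_prepCirc (hX : ∀ i j, |X i j| ≤ 1) (hn : n ≤ 2 ^ q) {p : ℕ} (hp : p ≤ b)
    (c₀ c₁ c₂ : ℤ) (ks : List (Fin n)) (lam : ℕ → ℝ) :
    Keeps X {w | w ∉ mainWires e} (prepCirc e p c₀ c₁ c₂ ks lam) ∧
      Keeps X {w | w ∉ mainWires e} (inv (prepCirc e p c₀ c₁ c₂ ks lam)) := by
  have hreg : ∀ l < R, regW e l ∉ {w | w ∉ mainWires e} := fun l hl h => h <| by
    simp only [mainWires, List.mem_append, List.mem_map, List.mem_range]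
    exact Or.inl (Or.inr ⟨l, hl, rfl⟩)
  have hrot : ∀ l < R, rotW e l ∉ {w | w ∉ mainWires e} := fun l hl h => h <| by
    simp only [mainWires, dampWires, List.mem_append, List.mem_map, List.mem_range, List.mem_cons]
    exact Or.inr (Or.inr ⟨l, hl, rfl⟩)
  have hcoin : coinW e ∉ {w | w ∉ mainWires e} := fun h => h <| by
    simp [mainWires, dampWires]
  have hrow : ∀ v ∈ (List.finRange q).map (Sum.inl : Fin q → Fin q ⊕ Fin a),
      v ∉ {w | w ∉ mainWires e} := fun v hv h => h <| by
    simp only [mainWires, List.mem_append]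
    exact Or.inl (Or.inl hv)
  have hD := keeps_formCirc e hX hn hp c₀ c₁ c₂ ks hreg
  refine ⟨((Keeps.flatMap fun v hv => keeps_ctrl _ (hrow v hv) _).append hD.1).append
    ((keeps_ctrl _ hcoin _).append (Keeps.flatMap fun l hl => keeps_ctrl _
      (hrot l (by simpa using hl)) _)), ?_⟩
  rw [prepCirc, inv_append, inv_append, dampCirc, inv_append, inv_flatMap, uniformCirc, inv_flatMap]
  exact ((Keeps.flatMap fun l hl => keeps_inv_ctrl _ (hrot l (by simpa using hl)) _).append
    (keeps_inv_ctrl _ hcoin _)).append (hD.2.append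
      (Keeps.flatMap fun v hv => keeps_inv_ctrl _ (hrow v (by simpa using hv)) _))

/-- One Grover iteration: a reflection at the good basis states, and one at the prepared state. -/
def grover (p : ℕ) (c₀ c₁ c₂ : ℤ) (ks : List (Fin n)) (lam : ℕ → ℝ) : Circ (Fin q ⊕ Fin a) q b :=
  reflect (dampWires e) (tstW e) m false ++ inv (prepCirc e p c₀ c₁ c₂ ks lam) ++
    reflect (mainWires e) (tstW e) m true ++ prepCirc e p c₀ c₁ c₂ ks lam

omit [Nontrivial (Fin q ⊕ Fin a)] in
theorem length_mainWires : (mainWires e).length = q + 2 * R + 1 := by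
  simp [mainWires, dampWires]; ring

/-- After `j` Grover iterations, the good part of the state has norm `|sin ((2 j + 1) θ)|`, and it
is a multiple of the vector of amplitudes. -/
theorem exists_restrict_run_grover (hX : ∀ i j, |X i j| ≤ 1) (hn : n ≤ 2 ^ q) {p : ℕ} (hp : p ≤ b)
    (hm : q + 2 * R + 1 ≤ m) (c₀ c₁ c₂ : ℤ) (ks : List (Fin n)) {lam : ℕ → ℝ}
    (hlam : ∀ l, lam l ∈ Set.Icc 0 1) (j : ℕ) :
    ∃ s : ℝ, run X (inv (formCirc e p c₀ c₁ c₂ ks)) (restrict (IsGood e)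
        (run X (prepCirc e p c₀ c₁ c₂ ks lam ++ iter (grover e p c₀ c₁ c₂ ks lam) j)
          (zeroState _)))
        = (s : ℂ) • tensorState (ampVec X q b p c₀ c₁ c₂ ks lam R) (zeroState (Fin a)) ∧
      s * ‖ampVec X q b p c₀ c₁ c₂ ks lam R‖
        = Real.sin ((2 * j + 1) * Real.arcsin ‖ampVec X q b p c₀ c₁ c₂ ks lam R‖) := by
  have hU := keeps_prepCirc e hX hn hp c₀ c₁ c₂ ks lam
  have hlen := length_mainWires e
  have htst : ∀ w ∈ mainWires e, ∀ l < m + 1, tstW e l ≠ w := by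
    intro w hw l _ h
    subst h
    simp [mainWires, dampWires, tstW, regW, rotW, coinW] at hw
  have hz : ∀ ψ : QState (Fin q ⊕ Fin a), Vanishes {w | w ∉ mainWires e} ψ →
      ∀ x, (∃ l < m + 1, x (tstW e l) = true) → ψ x = 0 := fun ψ hψ x ⟨l, hl, hx⟩ =>
    hψ x ⟨tstW e l, fun hw => htst _ hw l hl rfl, hx⟩
  obtain ⟨s, h1, h2⟩ := exists_restrict_run_iter (p := IsGood e) (Z := {w | w ∉ mainWires e})
    (S := reflect (mainWires e) (tstW e) m true) (G := reflect (dampWires e) (tstW e) m false)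
    hU.1 hU.2 (fun ψ hψ x => by
      rw [run_reflect (by omega) (tstW_inj e) htst _ (hz ψ hψ)]
      by_cases hx : ∃ w ∈ mainWires e, x w = true
      · have : x ≠ fun _ => false := by
          rintro rfl
          simp at hx
        simp [hx, this]
      · by_cases hx0 : x = fun _ => false
        · simp [hx0]
        · have : ψ x = 0 := hψ x <| by
            by_contra hcon
            refine hx0 (funext fun w => ?_)
            by_contra hw
            rw [Bool.not_eq_false] at hw
            by_cases hwm : w ∈ mainWires e
            · exact hx ⟨w, hwm, hw⟩
            · exact hcon ⟨w, hwm, hw⟩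
          simp [this])
    (fun ψ hψ x => by
      have hsub : ∀ w ∈ dampWires e, w ∈ mainWires e := fun w hw => by simp [mainWires, hw]
      have hlen' : (dampWires e).length ≤ (mainWires e).length := by
        simp only [mainWires, List.length_append]; omega
      rw [run_reflect (by omega) (tstW_inj e) (fun w hw => htst w (hsub w hw)) _ (hz ψ hψ)]
      congr 1
      refine if_congr ?_ rfl rfl
      rw [decide_eq_false_iff_not, IsGood]) j
  have hg := run_inv_formCirc_restrict e hX hn hp c₀ c₁ c₂ ks hlam
  have hnorm : ‖restrict (IsGood e) (run X (prepCirc e p c₀ c₁ c₂ ks lam) (zeroState _))‖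
      = ‖ampVec X q b p c₀ c₁ c₂ ks lam R‖ := by
    rw [← norm_run (X := X) (inv (formCirc e p c₀ c₁ c₂ ks)), hg, norm_tensorState, norm_zeroState,
      mul_one]
  rw [hnorm] at h2
  refine ⟨s, ?_, h2⟩
  rw [run_append, grover, h1, run_smul, hg]

end

section

open Circ

namespace Prog

/-! ### Random numbers and repetition -/

variable {W : Type} {n q b : ℕ} {α : Type} {X : Matrix (Fin n) (Fin n) ℝ}

/-- Append `k` random bits to the number `j` and continue with the program for the result. Each bit
comes from a measurement of the qubit `v` after a Hadamard gate. -/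
def randNat [DecidableEq W] [Nontrivial W] (v : W) (f : ℕ → Prog W q b α) : ℕ → ℕ → Prog W q b α
  | 0, j => f j
  | k + 1, j => fresh (toProg (single v hadamard)
      (measure v fun c => randNat v f k (2 * j + c.toNat)))

theorem expect_randNat [DecidableEq W] [Nontrivial W] [Fintype W] (v : W) {f : ℕ → Prog W q b α}
    {F : α → QState W → ℝ}
    {V : ℕ → ℝ} (hV : ∀ j ψ, (f j).expect X F ψ = V j * ‖ψ‖ ^ 2) (k j : ℕ) (ψ : QState W) :
    (randNat v f k j).expect X F ψ =
      (∑ i ∈ Finset.range (2 ^ k), V (2 ^ k * j + i)) / 2 ^ k * ‖ψ‖ ^ 2 := by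
  induction k generalizing j ψ with
  | zero => simp [randNat, hV]
  | succ k ih =>
    have hs : ((1 / √2 : ℝ)) ^ 2 = 1 / 2 := by
      rw [div_pow, Real.sq_sqrt (by norm_num)]; norm_num
    have h1 : ∀ c : Bool, ‖project v c (run X (single v hadamard : Circ W q b)
        ((‖ψ‖ : ℂ) • zeroState W))‖ ^ 2 = ‖ψ‖ ^ 2 / 2 := by
      intro c
      have h2 : project v c (run X (single v hadamard : Circ W q b) (zeroState W))
          = ((1 / √2 : ℝ) : ℂ) • ket (Function.update (fun _ => false) v c) := by
        rw [zeroState_eq_ket, run_single_ket, Fintype.sum_bool]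
        ext x
        simp only [project, WithLp.ofLp_add, WithLp.ofLp_smul, Pi.add_apply, Pi.smul_apply,
          ket_apply, smul_eq_mul, hadamard, Matrix.of_apply, Bool.and_false]
        by_cases hx : x v = c
        · rw [if_pos hx]
          have h3 : ∀ d, d ≠ c → x ≠ Function.update (fun _ => false) v d := by
            rintro d hd rfl
            simp at hx
            exact hd hx
          cases c
          · have h6 := h3 true (by simp)
            simp only [if_neg h6]
            simp
          · have h6 := h3 false (by simp)
            simp only [if_neg h6]
            simp
        · rw [if_neg hx, if_neg, mul_zero]
          rintro rfl
          simp at hx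
      have h4 : ‖(ket (Function.update (fun _ => false) v c) : QState W)‖ = 1 := by simp [ket]
      rw [run_smul, project_smul, h2, norm_smul, norm_smul, h4, Complex.norm_real,
        Complex.norm_real, norm_norm, mul_pow, mul_pow, Real.norm_eq_abs, sq_abs, hs]
      ring
    have h5 := Finset.sum_range_add (fun i => V (2 ^ (k + 1) * j + i)) (2 ^ k) (2 ^ k)
    simp only [randNat, expect, expect_toProg, ih, h1]
    rw [← two_mul, ← pow_succ'] at h5
    rw [h5]
    have e1 : ∀ i, 2 ^ k * (2 * j + Bool.toNat false) + i = 2 ^ (k + 1) * j + i := fun i => by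
      simp; ring
    have e2 : ∀ i, 2 ^ k * (2 * j + Bool.toNat true) + i = 2 ^ (k + 1) * j + (2 ^ k + i) :=
      fun i => by simp; ring
    simp only [e1, e2, pow_succ]
    field_simp

theorem cost_randNat_le [DecidableEq W] [Nontrivial W] (v : W) {f : ℕ → Prog W q b α} {K k : ℕ}
    {j : ℕ}
    (h : ∀ i < 2 ^ k, (f (2 ^ k * j + i)).cost ≤ K) : (randNat v f k j).cost ≤ 3 * k + K := by
  induction k generalizing j with
  | zero => simpa [randNat] using h 0 (by norm_num)
  | succ k ih =>
    have h1 := length_single_le (q := q) (b := b) v hadamard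
    have h2 : (randNat v f k (2 * j + Bool.toNat false)).cost ≤ 3 * k + K := ih fun i hi => by
      have := h i (by rw [pow_succ]; omega)
      simpa [pow_succ, mul_assoc] using this
    have h3 : (randNat v f k (2 * j + Bool.toNat true)).cost ≤ 3 * k + K := ih fun i hi => by
      have := h (2 ^ k + i) (by rw [pow_succ]; omega)
      have e : 2 ^ k * (2 * j + Bool.toNat true) + i = 2 ^ (k + 1) * j + (2 ^ k + i) := by
        simp; ring
      rwa [e]
    simp only [randNat, cost, cost_toProg]
    omega

/-- Repeat a program until it reports success, at most `k` times. -/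
def retry (P : Prog W q b Bool) : ℕ → Prog W q b Bool
  | 0 => ret false
  | k + 1 => bind P fun ok => if ok then ret true else retry P k

theorem expect_retry [DecidableEq W] [Fintype W] {P : Prog W q b Bool} {F : Bool → QState W → ℝ}
    {g κ π : ℝ}
    (hP : ∀ (κ : ℝ) (ψ : QState W), P.expect X (fun ok χ => if ok then F true χ else κ * ‖χ‖ ^ 2) ψ
      = (g * π + κ * (1 - π)) * ‖ψ‖ ^ 2) (hF : ∀ χ, F false χ = κ * ‖χ‖ ^ 2) (k : ℕ)
    (ψ : QState W) : (retry P k).expect X F ψ =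
      (g * (1 - (1 - π) ^ k) + κ * (1 - π) ^ k) * ‖ψ‖ ^ 2 := by
  induction k generalizing ψ with
  | zero => simp [retry, expect, hF]
  | succ k ih =>
    have h : (fun ok χ => (if ok then ret true else retry P k : Prog W q b Bool).expect X F χ)
        = fun (ok : Bool) χ => if ok then F true χ else
          (g * (1 - (1 - π) ^ k) + κ * (1 - π) ^ k) * ‖χ‖ ^ 2 := by
      funext ok χ
      cases ok
      · simpa using ih χ
      · simp [expect]
    rw [retry, expect_bind, h, hP, pow_succ]
    ring

theorem cost_retry_le (P : Prog W q b Bool) (k : ℕ) : (retry P k).cost ≤ k * P.cost := by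
  induction k with
  | zero => simp [retry, cost]
  | succ k ih =>
    rw [retry, Nat.succ_mul, add_comm (k * _)]
    refine cost_bind_le _ _ fun ok => ?_
    cases ok
    · simpa using ih
    · simp [cost]

end Prog

/-! ### One attempt of amplification -/

variable {q b R m a n : ℕ} (e : Anc q b R m ↪ Fin a) {X : Matrix (Fin n) (Fin n) ℝ}
  [Nontrivial (Fin q ⊕ Fin a)] [NeZero R]

/-- Measure the damping qubits. If all are zero, uncompute the exponent and report success. -/
def checkProg (p : ℕ) (c₀ c₁ c₂ : ℤ) (ks : List (Fin n)) : Prog (Fin q ⊕ Fin a) q b Bool :=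
  (Prog.measureAll (dampWires e).length (dampWires e).get).bind fun z =>
    if z = fun _ => false then toProg (inv (formCirc e p c₀ c₁ c₂ ks)) (.ret true) else .ret false

/-- Prepare the state, apply a random number below `2 ^ t` of Grover iterations, and check. -/
def attempt (p : ℕ) (c₀ c₁ c₂ : ℤ) (ks : List (Fin n)) (lam : ℕ → ℝ) (t : ℕ) :
    Prog (Fin q ⊕ Fin a) q b Bool :=
  Prog.randNat (coinW e) (fun j => .fresh (toProg (prepCirc e p c₀ c₁ c₂ ks lam ++
    iter (grover e p c₀ c₁ c₂ ks lam) j) (checkProg e p c₀ c₁ c₂ ks))) t 0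

/-- The average success probability of `attempt` if the good part of the prepared state has
norm `s`. -/
def successAvg (s : ℝ) (t : ℕ) : ℝ :=
  (∑ j ∈ Finset.range (2 ^ t), Real.sin ((2 * j + 1) * Real.arcsin s) ^ 2) / 2 ^ t

theorem expect_checkProg (p : ℕ) (c₀ c₁ c₂ : ℤ) (ks : List (Fin n))
    {F : Bool → QState (Fin q ⊕ Fin a) → ℝ} {κ : ℝ} (hF : ∀ χ, F false χ = κ * ‖χ‖ ^ 2)
    (ψ : QState (Fin q ⊕ Fin a)) :
    (checkProg e p c₀ c₁ c₂ ks).expect X F ψ =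
      F true (run X (inv (formCirc e p c₀ c₁ c₂ ks)) (restrict (IsGood e) ψ))
        + κ * (‖ψ‖ ^ 2 - ‖restrict (IsGood e) ψ‖ ^ 2) := by
  set w := (dampWires e).get with hw
  have h0 : Prog.projectAll w (fun _ => false) ψ = restrict (IsGood e) ψ := by
    ext x
    have : (∀ i, x (w i) = false) ↔ IsGood e x := by
      rw [IsGood, hw]
      constructor
      · rintro h ⟨v, hv, hxv⟩
        obtain ⟨i, rfl⟩ := List.mem_iff_get.1 hv
        rw [h i] at hxv
        exact Bool.false_ne_true hxv
      · intro h i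
        by_contra hcon
        exact h ⟨_, List.get_mem _ _, by simpa using hcon⟩
    by_cases hx : IsGood e x
    · simp [Prog.projectAll, restrict, hx, this.2 hx]
    · have h' : ¬ ∀ i, x (w i) = false := fun h => hx (this.1 h)
      simp only [Prog.projectAll, restrict, if_neg hx, if_neg h']
  have htot : ∑ z, ‖Prog.projectAll w z ψ‖ ^ 2 = ‖ψ‖ ^ 2 := by
    have h1 := Prog.expect_norm_sq (X := X)
      (Prog.measureAll (q := q) (b := b) (dampWires e).length w) ψ
    rwa [Prog.expect_measureAll] at h1
  rw [checkProg, Prog.expect_bind, Prog.expect_measureAll]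
  have h2 : ∀ z, ((if z = fun _ => false then toProg (inv (formCirc e p c₀ c₁ c₂ ks)) (.ret true)
      else .ret false : Prog (Fin q ⊕ Fin a) q b Bool)).expect X F (Prog.projectAll w z ψ)
      = κ * ‖Prog.projectAll w z ψ‖ ^ 2 + if z = fun _ => false then
        F true (run X (inv (formCirc e p c₀ c₁ c₂ ks)) (restrict (IsGood e) ψ))
          - κ * ‖restrict (IsGood e) ψ‖ ^ 2 else 0 := by
    intro z
    split_ifs with hz
    · rw [hz, h0, expect_toProg, Prog.expect]; ring
    · rw [Prog.expect, hF, add_zero]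
  rw [Finset.sum_congr rfl fun z _ => h2 z, Finset.sum_add_distrib, ← Finset.mul_sum, htot,
    Finset.sum_ite_eq' _ _ _, if_pos (Finset.mem_univ _)]
  ring

theorem expect_attempt (hX : ∀ i j, |X i j| ≤ 1) (hn : n ≤ 2 ^ q) {p : ℕ} (hp : p ≤ b)
    (hm : q + 2 * R + 1 ≤ m) (c₀ c₁ c₂ : ℤ) (ks : List (Fin n)) {lam : ℕ → ℝ}
    (hlam : ∀ l, lam l ∈ Set.Icc 0 1) (t : ℕ) {F : Bool → QState (Fin q ⊕ Fin a) → ℝ} {g : ℝ}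
    (hF : ∀ s : ℂ, F true (s • tensorState (ampVec X q b p c₀ c₁ c₂ ks lam R) (zeroState (Fin a)))
      = g * ‖s • tensorState (ampVec X q b p c₀ c₁ c₂ ks lam R) (zeroState (Fin a))‖ ^ 2)
    (κ : ℝ) (ψ : QState (Fin q ⊕ Fin a)) :
    (attempt e p c₀ c₁ c₂ ks lam t).expect X (fun ok χ => if ok then F true χ else κ * ‖χ‖ ^ 2) ψ
      = (g * successAvg ‖ampVec X q b p c₀ c₁ c₂ ks lam R‖ t
        + κ * (1 - successAvg ‖ampVec X q b p c₀ c₁ c₂ ks lam R‖ t)) * ‖ψ‖ ^ 2 := by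
  set v := ampVec X q b p c₀ c₁ c₂ ks lam R with hv
  rw [attempt, Prog.expect_randNat (V := fun j =>
    g * Real.sin ((2 * j + 1) * Real.arcsin ‖v‖) ^ 2
      + κ * (1 - Real.sin ((2 * j + 1) * Real.arcsin ‖v‖) ^ 2))]
  · congr 1
    simp only [mul_zero, zero_add, Finset.sum_add_distrib, ← Finset.mul_sum, successAvg,
      Finset.sum_sub_distrib, Finset.sum_const, Finset.card_range, nsmul_eq_mul]
    generalize ∑ j ∈ Finset.range (2 ^ t), Real.sin ((2 * j + 1) * Real.arcsin ‖v‖) ^ 2 = S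
    push_cast
    field_simp
  · intro j ψ
    obtain ⟨s, h1, h2⟩ := exists_restrict_run_grover e hX hn hp hm c₀ c₁ c₂ ks hlam j
    rw [← hv] at h1 h2
    have hτ : ‖tensorState v (zeroState (Fin a))‖ = ‖v‖ := by
      rw [norm_tensorState, norm_zeroState, mul_one]
    have hs : ‖((‖ψ‖ : ℂ) * (s : ℂ)) • tensorState v (zeroState (Fin a))‖ ^ 2
        = Real.sin ((2 * j + 1) * Real.arcsin ‖v‖) ^ 2 * ‖ψ‖ ^ 2 := by
      rw [norm_smul, hτ, ← h2, norm_mul, Complex.norm_real, Complex.norm_real, norm_norm,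
        Real.norm_eq_abs, mul_pow, mul_pow, sq_abs]
      ring
    have h3 : run X (inv (formCirc e p c₀ c₁ c₂ ks)) (restrict (IsGood e)
        (run X (prepCirc e p c₀ c₁ c₂ ks lam ++ iter (grover e p c₀ c₁ c₂ ks lam) j)
          ((‖ψ‖ : ℂ) • zeroState _))) = ((‖ψ‖ : ℂ) * (s : ℂ)) • tensorState v (zeroState _) := by
      rw [run_smul, restrict_smul, run_smul, h1, smul_smul]
    have h4 : ‖restrict (IsGood e)
        (run X (prepCirc e p c₀ c₁ c₂ ks lam ++ iter (grover e p c₀ c₁ c₂ ks lam) j)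
          ((‖ψ‖ : ℂ) • zeroState _))‖ ^ 2
        = Real.sin ((2 * j + 1) * Real.arcsin ‖v‖) ^ 2 * ‖ψ‖ ^ 2 := by
      rw [← norm_run (X := X) (inv (formCirc e p c₀ c₁ c₂ ks)), h3, hs]
    rw [Prog.expect, expect_toProg, expect_checkProg e (κ := κ) p c₀ c₁ c₂ ks (by simp), h3, h4,
      if_pos rfl, hF, hs, norm_run, norm_smul, norm_zeroState]
    simp
    ring

theorem successAvg_zero (t : ℕ) : successAvg 0 t = 0 := by simp [successAvg]

theorem quarter_le_successAvg {s : ℝ} {t : ℕ} (h0 : 0 ≤ s) (h1 : s ^ 2 ≤ 1 / 2)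
    (h : 1 ≤ 2 ^ t * s) : 1 / 4 ≤ successAvg s t := by
  have := quarter_le_avg_sin_sq (θ := Real.arcsin s) (m := 2 ^ t)
    (by push_cast; exact one_le_mul_sin_two_arcsin h0 h1 h)
  rw [successAvg, le_div_iff₀ (by positivity)]
  push_cast at this
  linarith

theorem successAvg_le_one (s : ℝ) (t : ℕ) : successAvg s t ≤ 1 := by
  rw [successAvg, div_le_one (by positivity)]
  refine (Finset.sum_le_sum fun j _ => Real.sin_sq_le_one _).trans ?_
  simp

end

section

/-! ### Damping factors for an exponential weight -/

/-- The factors with which the bits of the exponent damp the amplitudes. If `d` is the number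
written in the lowest `s` bits, then bit by bit they multiply to `exp (-θ d)`. Bit `s` is the sign
of `d`, and bit `s + 1 + q` is the sign of the whole exponent. -/
def dampFactor (s q : ℕ) (θ : ℝ) (l : ℕ) : ℝ :=
  if l = s ∨ l = s + 1 + q then 0 else if l < s then Real.exp (-(θ * 2 ^ l)) else 1

theorem dampFactor_mem {s q : ℕ} {θ : ℝ} (hθ : 0 ≤ θ) (l : ℕ) :
    dampFactor s q θ l ∈ Set.Icc 0 1 := by
  unfold dampFactor
  split_ifs
  · simp
  · exact ⟨(Real.exp_pos _).le, Real.exp_le_one_iff.2 (by simp; positivity)⟩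
  · simp

theorem damping_eq_zero {lam : ℕ → ℝ} {R l : ℕ} {z : ℤ} (hl : l < R) (h : lam l = 0)
    (hz : zbit z l = true) : damping lam R z = 0 :=
  Finset.prod_eq_zero (Finset.mem_range.2 hl) (by simp [hz, h])

/-- Damping leaves the weight `exp (-θ d)` if the index `i` is in range and `0 ≤ d`, and nothing
otherwise. -/
theorem damping_dampFactor {n q s : ℕ} (hpos : 0 < n) (hn : n ≤ 2 ^ q) {d : ℤ}
    (hd : |d| < 2 ^ s) (θ : ℝ) {i : ℕ} (hi : i < 2 ^ q) :
    damping (dampFactor s q θ) (s + 1 + q + 1) (2 ^ (s + 1) * ((n : ℤ) - 1 - i) + d)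
      = if i < n ∧ 0 ≤ d then Real.exp (-(θ * d)) else 0 := by
  obtain ⟨hd1, hd2⟩ := abs_lt.1 hd
  have hs : (0 : ℤ) < 2 ^ s := by positivity
  have hpos' : (1 : ℤ) ≤ n := by exact_mod_cast hpos
  have hn' : (n : ℤ) ≤ 2 ^ q := by exact_mod_cast hn
  have hi' : (i : ℤ) < 2 ^ q := by exact_mod_cast hi
  set L := 2 ^ (s + 1) * ((n : ℤ) - 1 - i) + d with hL
  have hpow : (2 : ℤ) ^ (s + 1 + q) = 2 ^ s * (2 * 2 ^ q) := by rw [pow_add, pow_succ]; ring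
  have hL' : L = d + 2 ^ s * (2 * ((n : ℤ) - 1 - i)) := by rw [hL, pow_succ]; ring
  have htop : zbit L (s + 1 + q) = decide (L < 0) := by
    apply zbit_eq_decide_neg <;> rw [hpow, hL']
    · nlinarith
    · nlinarith
  by_cases hin : i < n
  · have hin' : (i : ℤ) < n := by exact_mod_cast hin
    have hdiv : L / 2 ^ s = d / 2 ^ s + 2 * ((n : ℤ) - 1 - i) := by
      rw [hL', Int.add_mul_ediv_left _ _ hs.ne']
    by_cases h0 : 0 ≤ d
    · have hsgn : zbit L s = false := by
        have : d / 2 ^ s = 0 := Int.ediv_eq_zero_of_lt h0 hd2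
        simp [zbit, hdiv, this]
      have hL0 : 0 ≤ L := by rw [hL']; nlinarith
      have hsum := sum_zbit L s
      rw [hL', Int.add_mul_emod_self_left, Int.emod_eq_of_lt h0 hd2, ← hL'] at hsum
      have hlow : ∏ l ∈ Finset.range s, (if zbit L l then dampFactor s q θ l else 1)
          = Real.exp (-(θ * d)) := by
        have h1 : ∀ l ∈ Finset.range s, (if zbit L l then dampFactor s q θ l else 1)
            = Real.exp (-θ * ((if zbit L l then (2 : ℤ) ^ l else 0 : ℤ) : ℝ)) := by
          intro l hl
          have hl' := Finset.mem_range.1 hl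
          have h2 : dampFactor s q θ l = Real.exp (-(θ * 2 ^ l)) := by
            rw [dampFactor, if_neg (by omega), if_pos hl']
          rw [h2]
          split_ifs <;> simp
        rw [Finset.prod_congr rfl h1, ← Real.exp_sum, ← Finset.mul_sum, ← Int.cast_sum, hsum]
        congr 1; ring
      have hmid : ∀ l, (if zbit L (s + 1 + l) then dampFactor s q θ (s + 1 + l) else 1)
          = if l = q ∧ zbit L (s + 1 + l) then 0 else 1 := by
        intro l
        by_cases hl : l = q
        · subst hl; simp [dampFactor]
        · have h2 : dampFactor s q θ (s + 1 + l) = 1 := by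
            rw [dampFactor, if_neg (by omega), if_neg (by omega)]
          simp [hl, h2]
      rw [damping, Finset.prod_range_succ, Finset.prod_range_add, Finset.prod_range_succ, hlow,
        hsgn, htop]
      have hmid' : ∏ l ∈ Finset.range q,
          (if zbit L (s + 1 + l) then dampFactor s q θ (s + 1 + l) else 1) = 1 := by
        refine Finset.prod_eq_one fun l hl => ?_
        rw [hmid, if_neg fun h => (Finset.mem_range.1 hl).ne h.1]
      rw [hmid']
      simp [hL0, hin, h0]
    · rw [if_neg fun h => h0 h.2]
      refine damping_eq_zero (l := s) (by omega) (by simp [dampFactor]) ?_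
      have : d / 2 ^ s = -1 := by
        rw [Int.ediv_eq_iff_of_pos hs]
        constructor <;> linarith
      simp only [zbit, hdiv, this, decide_eq_true_eq]
      omega
  · rw [if_neg fun h => hin h.1]
    have hin' : (n : ℤ) ≤ i := by exact_mod_cast not_lt.1 hin
    refine damping_eq_zero (l := s + 1 + q) (by omega) (by simp [dampFactor]) ?_
    rw [htop, decide_eq_true_eq, hL']
    nlinarith

/-! ### Amplitudes of the sampler -/

variable {n q b : ℕ} {X : Matrix (Fin n) (Fin n) ℝ}

/-- The truncated score of the row `i`: an integer multiple of `2⁻ᵖ`, written without the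
denominator. -/
def truncScore (X : Matrix (Fin n) (Fin n) ℝ) (b p : ℕ) (ks : List (Fin n)) (i : ℕ) : ℤ :=
  (ks.map fun k : Fin n => truncEntry X b p i k).sum

/-- The good amplitudes for the exponent `d i = D + c₂ * truncScore i`: up to a constant, they are
`exp (-θ (d i))` where `0 ≤ d i`. The multiples of `2 ^ (s + 1)` added to `d i` are negative exactly
for the values of the index register that are not below `n`. -/
def expVec (X : Matrix (Fin n) (Fin n) ℝ) (q b p s : ℕ) (D c₂ : ℤ) (ks : List (Fin n)) (θ : ℝ) :
    QState (Fin q) :=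
  ampVec X q b p (2 ^ (s + 1) * ((n : ℤ) - 1) + D) (-2 ^ (s + 1)) c₂ ks (dampFactor s q θ)
    (s + 1 + q + 1)

section

variable [NeZero n] {p s : ℕ} {D c₂ : ℤ} {ks : List (Fin n)} {θ : ℝ}

theorem expVec_apply (hn : n ≤ 2 ^ q) (hd : ∀ i, |D + c₂ * truncScore X b p ks i| < 2 ^ s)
    (x : Fin q → Bool) : expVec X q b p s D c₂ ks θ x =
      (((1 / √2) ^ (q + 1) * if Nat.ofBits x < n ∧ 0 ≤ D + c₂ * truncScore X b p ks (Nat.ofBits x)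
        then Real.exp (-(θ * (D + c₂ * truncScore X b p ks (Nat.ofBits x) : ℤ))) else 0 : ℝ) :
            ℂ) := by
  rw [← damping_dampFactor (NeZero.pos n) hn (hd _) θ (Nat.ofBits_lt_two_pow x)]
  simp only [expVec, ampVec, formVal, truncScore]
  congr 3
  ring

theorem norm_sq_expVec (hn : n ≤ 2 ^ q) (hd : ∀ i, |D + c₂ * truncScore X b p ks i| < 2 ^ s) :
    ‖expVec X q b p s D c₂ ks θ‖ ^ 2 = ∑ i : Fin n, (1 / 2) ^ (q + 1) *
      if 0 ≤ D + c₂ * truncScore X b p ks i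
        then Real.exp (-(θ * (D + c₂ * truncScore X b p ks i : ℤ))) ^ 2 else 0 := by
  rw [norm_sq_eq_sum, ← sum_ofBits_dite hn]
  refine Finset.sum_congr rfl fun x _ => ?_
  have h2 : ((1 / √2 : ℝ) ^ (q + 1)) ^ 2 = (1 / 2) ^ (q + 1) := by
    rw [← pow_mul, mul_comm, pow_mul, div_pow, Real.sq_sqrt (by norm_num), one_pow]
  rw [expVec_apply hn hd, Complex.norm_real, Real.norm_eq_abs, sq_abs, mul_pow, h2]
  by_cases h : Nat.ofBits x < n
  · simp only [h, true_and, dif_pos]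
    split_ifs <;> simp
  · simp [h]

theorem norm_sq_expVec_le (hn : n ≤ 2 ^ q) (hd : ∀ i, |D + c₂ * truncScore X b p ks i| < 2 ^ s)
    (hθ : 0 ≤ θ) : ‖expVec X q b p s D c₂ ks θ‖ ^ 2 ≤ 1 / 2 := by
  rw [norm_sq_expVec hn hd]
  have h1 : ∀ i : Fin n, (1 / 2 : ℝ) ^ (q + 1) * (if 0 ≤ D + c₂ * truncScore X b p ks i
      then Real.exp (-(θ * (D + c₂ * truncScore X b p ks i : ℤ))) ^ 2 else 0)
      ≤ (1 / 2) ^ (q + 1) := by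
    intro i
    refine mul_le_of_le_one_right (by positivity) ?_
    split_ifs with h
    · have h' : (0 : ℝ) ≤ (D + c₂ * truncScore X b p ks i : ℤ) := by exact_mod_cast h
      exact pow_le_one₀ (Real.exp_pos _).le (Real.exp_le_one_iff.2 (by nlinarith))
    · norm_num
  refine (Finset.sum_le_sum fun i _ => h1 i).trans ?_
  have hn' : (n : ℝ) ≤ 2 ^ q := by exact_mod_cast hn
  rw [Finset.sum_const, Finset.card_univ, Fintype.card_fin, nsmul_eq_mul, pow_succ, one_div_pow,
    ← mul_assoc]
  have : (n : ℝ) * (1 / 2 ^ q) ≤ 1 := by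
    rw [mul_one_div]; exact (div_le_one (by positivity)).2 hn'
  linarith

theorem expVec_eq_zero (hn : n ≤ 2 ^ q) (hd : ∀ i, |D + c₂ * truncScore X b p ks i| < 2 ^ s)
    (h : ∀ i : Fin n, D + c₂ * truncScore X b p ks i < 0) : expVec X q b p s D c₂ ks θ = 0 := by
  have h1 : ‖expVec X q b p s D c₂ ks θ‖ ^ 2 = 0 := by
    rw [norm_sq_expVec hn hd]
    exact Finset.sum_eq_zero fun i _ => by rw [if_neg (not_le.2 (h i)), mul_zero]
  simpa using h1

/-- With an index of exponent `0`, or with a marked index in the undamped case `θ = 0`, a random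
number of iterations below `2 ^ t` succeeds with probability at least `1 / 4`. -/
theorem quarter_le_successAvg_expVec (hn : n ≤ 2 ^ q)
    (hd : ∀ i, |D + c₂ * truncScore X b p ks i| < 2 ^ s) (hθ : 0 ≤ θ) {t : ℕ} (ht : q + 1 ≤ 2 * t)
    (i : Fin n) (h0 : 0 ≤ D + c₂ * truncScore X b p ks i)
    (h1 : θ * (D + c₂ * truncScore X b p ks i : ℤ) = 0) :
    1 / 4 ≤ successAvg ‖expVec X q b p s D c₂ ks θ‖ t := by
  refine quarter_le_successAvg (norm_nonneg _) (norm_sq_expVec_le hn hd hθ) ?_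
  have h2 : (1 / 2 : ℝ) ^ (q + 1) ≤ ‖expVec X q b p s D c₂ ks θ‖ ^ 2 := by
    rw [norm_sq_expVec hn hd]
    refine le_trans (le_of_eq ?_) (Finset.single_le_sum (fun j _ => ?_) (Finset.mem_univ i))
    · rw [if_pos h0, h1]; simp
    · positivity
  have h3 : (1 : ℝ) ≤ (2 ^ t * ‖expVec X q b p s D c₂ ks θ‖) ^ 2 := by
    rw [mul_pow]
    calc (1 : ℝ) = 2 ^ (q + 1) * (1 / 2) ^ (q + 1) := by rw [← mul_pow]; norm_num
      _ ≤ (2 ^ t) ^ 2 * ‖expVec X q b p s D c₂ ks θ‖ ^ 2 := by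
        refine mul_le_mul ?_ h2 (by positivity) (by positivity)
        rw [← pow_mul]
        exact pow_le_pow_right₀ (by norm_num) (by omega)
  exact (one_le_sq_iff₀ (by positivity)).1 h3

end

/-! ### Finding the maximal score -/

section

variable {m a s : ℕ} (e : Anc q b (s + 1 + q + 1) m ↪ Fin a) [Nontrivial (Fin q ⊕ Fin a)]

/-- One attempt to prepare the direction of `expVec`. -/
def sampler (p : ℕ) (D c₂ : ℤ) (ks : List (Fin n)) (θ : ℝ) (t : ℕ) :
    Prog (Fin q ⊕ Fin a) q b Bool :=
  attempt e p (2 ^ (s + 1) * ((n : ℤ) - 1) + D) (-2 ^ (s + 1)) c₂ ks (dampFactor s q θ) t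

/-- Find the maximal truncated score, which is known to lie in the interval `[lo, lo + 2 ^ k)`, by
bisection, and prepare `expVec` for the distance to the maximum. Every step asks, with at most `K`
attempts, whether some score lies in the upper half of the interval. -/
def prepByBisection (p : ℕ) (ks : List (Fin n)) (θ : ℝ) (t K : ℕ) :
    ℕ → ℤ → Prog (Fin q ⊕ Fin a) q b Unit
  | 0, lo => (Prog.retry (sampler e p lo (-1) ks θ t) K).bind fun _ => .ret ()
  | k + 1, lo => (Prog.retry (sampler e p (-(lo + 2 ^ k)) 1 ks 0 t) K).bind fun ok =>
      if ok then prepByBisection p ks θ t K k (lo + 2 ^ k) else prepByBisection p ks θ t K k lo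

variable {p : ℕ} {ks : List (Fin n)} {θ : ℝ} {t K : ℕ}

theorem expect_retry_sampler (hX : ∀ i j, |X i j| ≤ 1) (hn : n ≤ 2 ^ q) (hp : p ≤ b)
    (hm : q + 2 * (s + 1 + q + 1) + 1 ≤ m) (D c₂ : ℤ) (hθ : 0 ≤ θ)
    {F : Bool → QState (Fin q ⊕ Fin a) → ℝ} {g κ : ℝ}
    (hF : ∀ c : ℂ, F true (c • tensorState (expVec X q b p s D c₂ ks θ) (zeroState (Fin a)))
      = g * ‖c • tensorState (expVec X q b p s D c₂ ks θ) (zeroState (Fin a))‖ ^ 2)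
    (hF' : ∀ χ, F false χ = κ * ‖χ‖ ^ 2) (ψ : QState (Fin q ⊕ Fin a)) :
    (Prog.retry (sampler e p D c₂ ks θ t) K).expect X F ψ =
      (g * (1 - (1 - successAvg ‖expVec X q b p s D c₂ ks θ‖ t) ^ K)
        + κ * (1 - successAvg ‖expVec X q b p s D c₂ ks θ‖ t) ^ K) * ‖ψ‖ ^ 2 :=
  Prog.expect_retry (fun κ ψ => expect_attempt e hX hn hp hm _ _ _ ks (dampFactor_mem hθ) t hF κ ψ)
    hF' K ψ

variable [NeZero n]

/-- Each of the `k + 1` repeated attempts errs with probability at most `(3 / 4) ^ K`. -/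
theorem le_expect_prepByBisection (hX : ∀ i j, |X i j| ≤ 1) (hn : n ≤ 2 ^ q) (hp : p ≤ b)
    (hm : q + 2 * (s + 1 + q + 1) + 1 ≤ m) (hθ : 0 ≤ θ) (ht : q + 1 ≤ 2 * t) {B : ℤ}
    (hB : ∀ i, |truncScore X b p ks i| ≤ B) (hB' : 2 * B < 2 ^ s)
    {G : QState (Fin q ⊕ Fin a) → Prop} [DecidablePred G]
    (hG : ∀ M : ℤ, (∃ i : Fin n, truncScore X b p ks i = M) →
      (∀ i : Fin n, truncScore X b p ks i ≤ M) →
      ∀ c : ℂ, G (c • tensorState (expVec X q b p s M (-1) ks θ) (zeroState (Fin a))))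
    (k : ℕ) (lo : ℤ) (h1 : -B ≤ lo) (h2 : lo + 2 ^ k ≤ 2 ^ s - 2 * B)
    (h3 : ∃ i : Fin n, lo ≤ truncScore X b p ks i)
    (h4 : ∀ i : Fin n, truncScore X b p ks i < lo + 2 ^ k) (ψ : QState (Fin q ⊕ Fin a)) :
    (1 - (k + 1) * (3 / 4) ^ K) * ‖ψ‖ ^ 2 ≤ (prepByBisection e p ks θ t K k lo).expect X
      (fun _ χ => if G χ then ‖χ‖ ^ 2 else 0) ψ := by
  set η : ℝ := (3 / 4) ^ K with hη
  have hη0 : 0 ≤ η := by positivity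
  have hpow : ∀ u : ℝ, 1 / 4 ≤ u → u ≤ 1 → (1 - u) ^ K ≤ η := fun u hu hu' =>
    pow_le_pow_left₀ (by linarith) (by linarith) K
  have hnn : ∀ (k : ℕ) (lo : ℤ) (χ : QState (Fin q ⊕ Fin a)), 0 ≤
      (prepByBisection e p ks θ t K k lo).expect X (fun _ χ => if G χ then ‖χ‖ ^ 2 else 0) χ := by
    intro k lo χ
    have h := Prog.expect_mono (X := X) (F := fun _ χ => 0 * ‖χ‖ ^ 2)
      (G := fun _ χ => if G χ then ‖χ‖ ^ 2 else 0)
      (fun _ χ => by split_ifs <;> simp) (prepByBisection e p ks θ t K k lo) χ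
    rwa [Prog.expect_const_mul, zero_mul] at h
  have hB0 : 0 ≤ B := (abs_nonneg _).trans (hB 0)
  induction k generalizing lo ψ with
  | zero =>
    obtain ⟨i, hi⟩ := h3
    have hmax : ∀ j : Fin n, truncScore X b p ks j ≤ lo := fun j => by
      have := h4 j; simp only [pow_zero] at this; omega
    have hi' : truncScore X b p ks i = lo := le_antisymm (hmax i) hi
    have hd : ∀ j, |lo + -1 * truncScore X b p ks j| < 2 ^ s := fun j => by
      have hj := abs_le.1 (hB j)
      have hi := abs_le.1 (hB i)
      rw [abs_lt]; constructor <;> linarith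
    have hu := quarter_le_successAvg_expVec (θ := θ) hn hd hθ ht i (by linarith) (by simp [hi'])
    have hu1 := hpow _ hu (successAvg_le_one _ _)
    have hGc := hG lo ⟨i, hi'⟩ hmax
    have hmono := Prog.expect_mono (X := X)
      (F := fun (ok : Bool) χ => if ok then (if G χ then ‖χ‖ ^ 2 else 0) else 0)
      (G := fun _ χ => if G χ then ‖χ‖ ^ 2 else 0)
      (fun ok χ => by cases ok <;> simp; split_ifs <;> simp)
      (Prog.retry (sampler e p lo (-1) ks θ t) K) ψ
    rw [expect_retry_sampler e hX hn hp hm lo (-1) hθ (g := 1) (κ := 0)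
      (fun c => by rw [if_pos rfl, if_pos (hGc c), one_mul]) (by simp)] at hmono
    rw [prepByBisection, Prog.expect_bind]
    refine le_trans ?_ hmono
    refine mul_le_mul_of_nonneg_right ?_ (sq_nonneg _)
    push_cast
    linarith
  | succ k ih =>
    have h2k : (2 : ℤ) ^ (k + 1) = 2 * 2 ^ k := pow_succ' _ _
    have hk0 : (0 : ℤ) < 2 ^ k := by positivity
    rw [h2k] at h2 h4
    have hd : ∀ j, |-(lo + 2 ^ k) + 1 * truncScore X b p ks j| < 2 ^ s := fun j => by
      have hj := abs_le.1 (hB j)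
      rw [abs_lt]; constructor <;> linarith
    have hkη : 0 ≤ ((k : ℝ) + 1) * η := by positivity
    -- The lower bound for the rest of the program in the half that contains the maximum.
    have key : ∀ (g κ : ℝ), (∀ χ, g * ‖χ‖ ^ 2 ≤ (prepByBisection e p ks θ t K k (lo + 2 ^ k)).expect
        X (fun _ χ => if G χ then ‖χ‖ ^ 2 else 0) χ) →
        (∀ χ, κ * ‖χ‖ ^ 2 ≤ (prepByBisection e p ks θ t K k lo).expect
        X (fun _ χ => if G χ then ‖χ‖ ^ 2 else 0) χ) →
        (g * (1 - (1 - successAvg ‖expVec X q b p s (-(lo + 2 ^ k)) 1 ks 0‖ t) ^ K)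
        + κ * (1 - successAvg ‖expVec X q b p s (-(lo + 2 ^ k)) 1 ks 0‖ t) ^ K) * ‖ψ‖ ^ 2
        ≤ (prepByBisection e p ks θ t K (k + 1) lo).expect X
          (fun _ χ => if G χ then ‖χ‖ ^ 2 else 0) ψ := by
      intro g κ hg hκ
      rw [prepByBisection, Prog.expect_bind, ← expect_retry_sampler e hX hn hp hm _ _ le_rfl
        (F := fun ok χ => if ok then g * ‖χ‖ ^ 2 else κ * ‖χ‖ ^ 2) (by simp) (by simp)]
      refine Prog.expect_mono (fun ok χ => ?_) _ _
      cases ok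
      · simpa using hκ χ
      · simpa using hg χ
    by_cases hup : ∃ i : Fin n, lo + 2 ^ k ≤ truncScore X b p ks i
    · have hg := fun χ => ih (lo + 2 ^ k) (by linarith) (by linarith) hup
        (fun i => by have := h4 i; linarith) χ
      refine le_trans ?_ (key _ 0 hg fun χ => by rw [zero_mul]; exact hnn _ _ _)
      obtain ⟨i, hi⟩ := hup
      have hu := quarter_le_successAvg_expVec (θ := 0) hn hd le_rfl ht i (by linarith) (zero_mul _)
      have hu0 := successAvg_le_one ‖expVec X q b p s (-(lo + 2 ^ k)) 1 ks 0‖ t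
      have hu1 := hpow _ hu hu0
      have hu2 : 0 ≤ (1 - successAvg ‖expVec X q b p s (-(lo + 2 ^ k)) 1 ks 0‖ t) ^ K :=
        pow_nonneg (by linarith) _
      refine mul_le_mul_of_nonneg_right ?_ (sq_nonneg _)
      push_cast
      nlinarith
    · push Not at hup
      have hκ := fun χ => ih lo h1 (by linarith) h3 hup χ
      refine le_trans ?_ (key 0 _ (fun χ => by rw [zero_mul]; exact hnn _ _ _) hκ)
      rw [expVec_eq_zero hn hd fun i => by have := hup i; linarith, norm_zero, successAvg_zero]
      refine mul_le_mul_of_nonneg_right ?_ (sq_nonneg _)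
      push_cast
      simp
      linarith

end

end

section

/-! ### Accuracy of the prepared state -/

variable {n b : ℕ} {X : Matrix (Fin n) (Fin n) ℝ}

/-- Truncation to `p₀` bits, or to all `b` bits if there are fewer. -/
theorem abs_truncEntry_div_sub_le (hX : IsInput b X) (p₀ : ℕ) (i k : Fin n) :
    |(truncEntry X b (min p₀ b) i k : ℝ) / 2 ^ min p₀ b - X i k| ≤ 1 / 2 ^ p₀ := by
  obtain ⟨z, hz⟩ := hX.representable i k
  have h1 : ⌊X i k * 2 ^ b⌋ = z := by
    rw [hz, div_mul_cancel₀ _ (by positivity)]; exact Int.floor_intCast z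
  have h2 : truncEntry X b (min p₀ b) i k = z / 2 ^ (b - min p₀ b) := by
    simp [truncEntry, h1]
  rw [h2, hz]
  rcases le_total b p₀ with h | h
  · rw [min_eq_right h]; simp
  · rw [min_eq_left h]
    set y := z / 2 ^ (b - p₀) with hy
    have hb : (2 : ℝ) ^ b = 2 ^ p₀ * 2 ^ (b - p₀) := by rw [← pow_add]; congr 1; omega
    have hpos : (0 : ℝ) < 2 ^ (b - p₀) := by positivity
    have h3 : (y : ℝ) * 2 ^ (b - p₀) ≤ z := by
      exact_mod_cast Int.ediv_mul_le z (by positivity)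
    have h4 : (z : ℝ) < (y + 1) * 2 ^ (b - p₀) := by
      exact_mod_cast Int.lt_ediv_add_one_mul_self z (by positivity)
    have h5 : (z : ℝ) / 2 ^ b = z / 2 ^ (b - p₀) / 2 ^ p₀ := by rw [hb]; field_simp
    rw [h5, ← sub_div, abs_div, abs_of_pos (by positivity : (0 : ℝ) < 2 ^ p₀)]
    refine div_le_div_of_nonneg_right ?_ (by positivity)
    rw [abs_le]
    rw [← le_div_iff₀ hpos] at h3
    rw [← div_lt_iff₀ hpos] at h4
    constructor <;> linarith

theorem abs_sum_map_le {α : Type*} (f : α → ℝ) {c : ℝ} (hf : ∀ x, |f x| ≤ c) (l : List α) :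
    |(l.map f).sum| ≤ l.length * c := by
  induction l with
  | nil => simp
  | cons x l ih =>
    rw [List.map_cons, List.sum_cons, List.length_cons]
    push_cast
    linarith [abs_add_le (f x) (l.map f).sum, hf x]

theorem abs_truncScore_le (hX : ∀ i j, |X i j| ≤ 1) {p : ℕ} (hp : p ≤ b) (ks : List (Fin n))
    (i : ℕ) : |truncScore X b p ks i| ≤ ks.length * 2 ^ p := by
  have h := abs_sum_map_le (fun k : Fin n => (truncEntry X b p i k : ℝ)) (c := 2 ^ p)
    (fun k => by exact_mod_cast abs_truncEntry_le hX hp i k) ks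
  have h2 : (truncScore X b p ks i : ℝ) =
      (ks.map fun k : Fin n => (truncEntry X b p i k : ℝ)).sum := by
    rw [truncScore, Int.cast_list_sum, List.map_map]; rfl
  rw [← h2] at h
  exact_mod_cast h

theorem abs_truncScore_div_sub_le (hX : IsInput b X) (p₀ : ℕ) (ks : List (Fin n)) (i : Fin n) :
    |(truncScore X b (min p₀ b) ks i : ℝ) / 2 ^ min p₀ b - (ks.map fun k => X i k).sum|
      ≤ ks.length / 2 ^ p₀ := by
  have h := abs_sum_map_le (fun k : Fin n => (truncEntry X b (min p₀ b) i k : ℝ) / 2 ^ min p₀ b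
    - X i k) (abs_truncEntry_div_sub_le hX p₀ i) ks
  have h2 : (ks.map fun k : Fin n => (truncEntry X b (min p₀ b) i k : ℝ) / 2 ^ min p₀ b
      - X i k).sum = (truncScore X b (min p₀ b) ks i : ℝ) / 2 ^ min p₀ b
        - (ks.map fun k => X i k).sum := by
    clear h
    unfold truncScore
    induction ks with
    | nil => simp
    | cons k ks ih =>
      simp only [List.map_cons, List.sum_cons, ih]
      push_cast
      ring
  rw [h2, mul_one_div] at h
  exact h

/-- A vector `v` close to a multiple of a unit vector `w` points nearly in the direction of `w`. -/
theorem hasPrepared_tensorState {a : ℕ} {v w : QState (Fin (idxLen n))} (hw : ‖w‖ = 1) {c δ : ℝ}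
    (hc : 0 ≤ c) (h : ‖v - (c : ℂ) • w‖ ≤ δ * ‖v‖) :
    HasPrepared (a := a) w (2 * δ) (tensorState v (zeroState (Fin a))) := by
  have hn : ‖tensorState v (zeroState (Fin a))‖ = ‖v‖ := by
    rw [norm_tensorState, norm_zeroState, mul_one]
  refine ⟨(‖v‖ : ℂ) • zeroState (Fin a), ?_, ?_⟩
  · rw [norm_smul, norm_zeroState, hn]; simp
  have h1 : tensorState v (zeroState (Fin a)) - tensorState w ((‖v‖ : ℂ) • zeroState (Fin a))
      = tensorState (v - (‖v‖ : ℂ) • w) (zeroState (Fin a)) := by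
    ext x; simp [tensorState]; ring
  have h2 : ‖(c : ℂ) • w - (‖v‖ : ℂ) • w‖ ≤ ‖v - (c : ℂ) • w‖ := by
    have h3 : ‖(c : ℂ) • w‖ = c := by
      rw [norm_smul, hw, mul_one, Complex.norm_real, Real.norm_of_nonneg hc]
    rw [← sub_smul, norm_smul, hw, mul_one, ← Complex.ofReal_sub, Complex.norm_real,
      Real.norm_eq_abs, abs_sub_comm]
    have := abs_norm_sub_norm_le v ((c : ℂ) • w)
    rwa [h3] at this
  rw [h1, norm_tensorState, norm_zeroState, mul_one, hn]
  linarith [norm_sub_le_norm_sub_add_norm_sub v ((c : ℂ) • w) ((‖v‖ : ℂ) • w)]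

theorem norm_le_of_forall_norm_le {W : Type} [Fintype W] [DecidableEq W] {u v : QState W} {δ : ℝ}
    (hδ : 0 ≤ δ)
    (h : ∀ x, ‖u x‖ ≤ δ * ‖v x‖) : ‖u‖ ≤ δ * ‖v‖ := by
  refine (sq_le_sq₀ (norm_nonneg _) (by positivity)).1 ?_
  rw [mul_pow, norm_sq_eq_sum, norm_sq_eq_sum, Finset.mul_sum]
  refine Finset.sum_le_sum fun x _ => ?_
  rw [← mul_pow]
  exact pow_le_pow_left₀ (norm_nonneg _) (h x) 2

/-- If the truncated scores are accurate and `M` is their maximum, then `expVec` has the direction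
of the state to be prepared, up to the tolerance. -/
theorem hasPrepared_expVec [NeZero n] {a p₀ s : ℕ} {ε : ℝ} (hX : IsInput b X) (hε : 0 < ε)
    (hε1 : ε ≤ 1) (hp₀ : max n 27 * numRounds n ε ^ 2 ≤ 2 ^ p₀) {ks : List (Fin n)}
    (hks : ks.length < numRounds n ε) {M : ℤ} (hM : ∀ i : Fin n, truncScore X b (min p₀ b) ks i ≤ M)
    (hd : ∀ i, |M + -1 * truncScore X b (min p₀ b) ks i| < 2 ^ s) :
    HasPrepared (a := a) (targetState X ε ks) (tolerance n ε) (tensorState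
      (expVec X (idxLen n) b (min p₀ b) s M (-1) ks (ε / (4 * 2 ^ min p₀ b)))
        (zeroState (Fin a))) := by
  set p := min p₀ b with hp
  set θ := ε / (4 * 2 ^ p) with hθ
  set N := max n 27 with hN
  set T := numRounds n ε with hT
  have hTpos : (1 : ℝ) ≤ T := by exact_mod_cast numRounds_pos n hε
  have hNpos : (27 : ℝ) ≤ N := by exact_mod_cast le_max_right n 27
  have hNT : (0 : ℝ) < N * T := by positivity
  set η : ℝ := 1 / (4 * (N * T)) with hη
  have hη0 : 0 < η := by positivity
  have hη1 : η ≤ 1 := by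
    rw [hη, div_le_one (by positivity)]; nlinarith
  -- The error of the exponents.
  have herr : ∀ i : Fin n, |θ * truncScore X b p ks i - ε *
      (ks.map fun k => X i k).sum / 4| ≤ η := by
    intro i
    have h1 := abs_truncScore_div_sub_le hX p₀ ks i
    rw [← hp] at h1
    have h2 : θ * truncScore X b p ks i - ε * (ks.map fun k => X i k).sum / 4
        = ε / 4 * (truncScore X b p ks i / 2 ^ p - (ks.map fun k => X i k).sum) := by
      rw [hθ]; field_simp
    rw [h2, abs_mul, abs_of_pos (by positivity)]
    have h3 : (ks.length : ℝ) / 2 ^ p₀ ≤ 1 / (N * T) := by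
      rw [div_le_div_iff₀ (by positivity) hNT, one_mul]
      have h4 : (N : ℝ) * T ^ 2 ≤ 2 ^ p₀ := by exact_mod_cast hp₀
      have h5 : (ks.length : ℝ) ≤ T := by exact_mod_cast hks.le
      nlinarith
    calc ε / 4 * |(truncScore X b p ks i : ℝ) / 2 ^ p - (ks.map fun k => X i k).sum|
        ≤ 1 / 4 * (1 / (N * T)) := by
          refine mul_le_mul (by linarith) (h1.trans h3) (abs_nonneg _) (by norm_num)
      _ = η := by rw [hη]; field_simp
  set A : ℝ := (1 / √2) ^ (idxLen n + 1) * Real.exp (-(θ * M)) with hA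
  have hA0 : 0 < A := by positivity
  set Z : ℝ := √(∑ j, Real.exp (ε * (ks.map fun k => X j k).sum / 2)) with hZ
  have hZ0 : 0 < Z := Real.sqrt_pos.2
    (Finset.sum_pos (fun j _ => Real.exp_pos _) ⟨0, Finset.mem_univ _⟩)
  have htol : tolerance n ε = 2 * (2 * η) := by
    rw [tolerance, hη, ← hN, ← hT]; field_simp; norm_num
  rw [htol]
  refine hasPrepared_tensorState (norm_targetState ks) (c := A * Z) (by positivity)
    (norm_le_of_forall_norm_le (by positivity) fun x => ?_)
  simp only [PiLp.sub_apply, PiLp.smul_apply, smul_eq_mul]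
  rw [expVec_apply (le_two_pow_idxLen n) hd]
  simp only [targetState]
  by_cases hx : Nat.ofBits x < n
  · have hM' : 0 ≤ M + -1 * truncScore X b p ks (Nat.ofBits x) := by
      have := hM ⟨_, hx⟩
      simp only at this
      linarith
    rw [dif_pos hx, if_pos ⟨hx, hM'⟩]
    set E₁ := θ * truncScore X b p ks (Nat.ofBits x) with hE₁
    set E₂ := ε * (ks.map fun k => X ⟨_, hx⟩ k).sum / 4 with hE₂
    have h12 : |E₁ - E₂| ≤ η := herr ⟨_, hx⟩
    have e1 : (1 / √2 : ℝ) ^ (idxLen n + 1)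
        * Real.exp (-(θ * (M + -1 * truncScore X b p ks (Nat.ofBits x) : ℤ)))
        = A * Real.exp E₁ := by
      rw [hA, mul_assoc, ← Real.exp_add, hE₁]
      congr 2
      push_cast
      ring
    rw [e1, ← Complex.ofReal_mul, ← Complex.ofReal_sub, Complex.norm_real, Complex.norm_real,
      Real.norm_eq_abs, Real.norm_eq_abs, abs_of_pos (by positivity : 0 < A * Real.exp E₁)]
    have e2 : A * Real.exp E₁ - A * Z * (Real.exp E₂ / Z)
        = A * Real.exp E₁ * (1 - Real.exp (E₂ - E₁)) := by
      rw [Real.exp_sub]; field_simp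
    rw [e2, abs_mul, abs_of_pos (by positivity : 0 < A * Real.exp E₁), mul_comm]
    refine mul_le_mul_of_nonneg_right ?_ (by positivity)
    have h21 : |E₂ - E₁| ≤ η := by rwa [abs_sub_comm]
    have := Real.abs_exp_sub_one_le (h21.trans hη1)
    rw [abs_sub_comm]
    linarith
  · rw [dif_neg hx, if_neg fun h => hx h.1]; simp

/-! ### Correctness of the state preparation -/

/-- Bisection prepares the states for all rounds, if the parameters are large enough. -/
theorem isStatePrep_prepByBisection [NeZero n] {a p₀ k m t K : ℕ} {ε : ℝ} (hX : IsInput b X)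
    (hε : 0 < ε) (hε1 : ε ≤ 1) [Nontrivial (Fin (idxLen n) ⊕ Fin a)]
    (e : Anc (idxLen n) b (k + 1 + 1 + idxLen n + 1) m ↪ Fin a)
    (hp₀ : max n 27 * numRounds n ε ^ 2 ≤ 2 ^ p₀)
    (hk : 4 * (numRounds n ε * 2 ^ min p₀ b) ≤ 2 ^ k)
    (hm : idxLen n + 2 * (k + 1 + 1 + idxLen n + 1) + 1 ≤ m) (ht : idxLen n + 1 ≤ 2 * t)
    (hK : ((k : ℝ) + 1) * (3 / 4) ^ K ≤ tolerance n ε) :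
    IsStatePrep X ε fun ks => prepByBisection e (min p₀ b) ks (ε / (4 * 2 ^ min p₀ b)) t K k
      (-(numRounds n ε * 2 ^ min p₀ b : ℕ)) := by
  classical
  intro ks hks
  set p := min p₀ b with hp
  set T := numRounds n ε with hT
  have hk' : (4 : ℤ) * (T * 2 ^ p : ℕ) ≤ 2 ^ k := by exact_mod_cast hk
  have hB0 : (0 : ℤ) < (T * 2 ^ p : ℕ) := by
    have := numRounds_pos n hε
    rw [← hT] at this
    positivity
  have hB : ∀ i, |truncScore X b p ks i| ≤ (T * 2 ^ p : ℕ) := fun i => by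
    refine (abs_truncScore_le hX.bounded (min_le_right _ _) ks i).trans ?_
    exact_mod_cast Nat.mul_le_mul_right _ hks.le
  have h2k : (2 : ℤ) ^ (k + 1) = 2 * 2 ^ k := pow_succ' _ _
  generalize hBdef : ((T * 2 ^ p : ℕ) : ℤ) = B at *
  have h := le_expect_prepByBisection e (θ := ε / (4 * 2 ^ p)) (t := t) (K := K) hX.bounded
    (le_two_pow_idxLen n) (min_le_right p₀ b) hm (by positivity) ht hB (by linarith)
    (G := HasPrepared (targetState X ε ks) (tolerance n ε)) (fun M hM hM' c =>
      hasPrepared_smul c (hasPrepared_expVec hX hε hε1 hp₀ hks hM' fun j => by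
        obtain ⟨i, hi⟩ := hM
        have h1 := abs_le.1 (hB i)
        have h2 := abs_le.1 (hB j)
        rw [abs_lt]
        constructor <;> linarith))
    k (-B) le_rfl (by linarith) ⟨0, (abs_le.1 (hB _)).1⟩
    (fun i => by have := (abs_le.1 (hB i)).2; linarith) (zeroState _)
  rw [norm_zeroState] at h
  unfold Prepares Prog.prob
  rw [Prog.probFrom_eq_expect]
  refine le_trans (by linarith) (h.trans (le_of_eq ?_))
  congr!

end

section

/-! ### Gate complexity -/

open Circ

section

variable {n q b R m a : ℕ} (e : Anc q b R m ↪ Fin a) [Nontrivial (Fin q ⊕ Fin a)] [NeZero R]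

/-- The cost of one attempt, in terms of a common bound `Y` of all register lengths and a bound `T`
of the number of columns that enter the exponent. -/
theorem cost_attempt_le {p t Y T : ℕ} {ks : List (Fin n)} (hT : ks.length ≤ T) (hT1 : 1 ≤ T)
    (hY : 1 ≤ Y) (hq : q ≤ Y) (hp : p ≤ Y) (hm : m + 1 ≤ Y) (ht : t ≤ Y)
    (hR : q + 2 * R + 1 ≤ m) (c₀ c₁ c₂ : ℤ) (lam : ℕ → ℝ) :
    (attempt (b := b) e p c₀ c₁ c₂ ks lam t).cost ≤ 84 * (2 ^ t * T * Y ^ 2) := by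
  have hRY : R ≤ Y := by omega
  have hYT : Y ^ 2 ≤ T * Y ^ 2 := Nat.le_mul_of_pos_left _ hT1
  have hYY : Y ≤ T * Y ^ 2 := (Nat.le_self_pow two_ne_zero Y).trans hYT
  have h1Y : 1 ≤ T * Y ^ 2 := hY.trans hYY
  set F := (formCirc e p c₀ c₁ c₂ ks).length with hF
  have hF1 : F ≤ 12 * (T * Y ^ 2) := by
    refine (length_formCirc_le e p c₀ c₁ c₂ ks).trans ?_
    calc R * (1 + q + ks.length * (2 * q + p + 4) + R + 2)
        ≤ Y * (Y + Y + T * (2 * Y + Y + 4 * Y) + Y + 2 * Y) := by gcongr <;> omega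
      _ = 5 * Y ^ 2 + 7 * (T * Y ^ 2) := by ring
      _ ≤ _ := by omega
  set P := (prepCirc e p c₀ c₁ c₂ ks lam).length with hP
  have hP1 : P ≤ 15 * (T * Y ^ 2) := by
    have h1 : (uniformCirc q a b).length ≤ q :=
      (length_flatMap_le (K := 1) _ fun v => length_single_le v hadamard).trans (by simp)
    have h2 : (dampCirc e lam : Circ (Fin q ⊕ Fin a) q b).length ≤ 1 + R := by
      rw [dampCirc, List.length_append]
      exact Nat.add_le_add (length_single_le _ _)
        ((length_flatMap_le (K := 1) _ fun l => length_ctrl_le _ _ _).trans (by simp))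
    rw [hP, prepCirc, List.length_append, List.length_append, ← hF]
    omega
  have href : ∀ (ws : List (Fin q ⊕ Fin a)) (s : Bool), ws.length ≤ Y →
      (reflect ws (tstW e) m s : Circ (Fin q ⊕ Fin a) q b).length ≤ 9 * (T * Y ^ 2) := by
    intro ws s hws
    refine (length_reflect_le ws (tstW e) m s).trans ?_
    calc 2 * ((m + 1) * (ws.length + (m + 1) + 2)) + 1
        ≤ 2 * (Y * (Y + Y + 2 * Y)) + 1 := by gcongr; omega
      _ = 8 * Y ^ 2 + 1 := by ring
      _ ≤ _ := by omega
  have hdamp : (dampWires e).length = R + 1 := by simp [dampWires]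
  have hG : (grover e p c₀ c₁ c₂ ks lam).length ≤ 48 * (T * Y ^ 2) := by
    have h1 := href (dampWires e) false (by omega)
    have h2 := href (mainWires e) true (by rw [length_mainWires]; omega)
    rw [grover, List.length_append, List.length_append, List.length_append, length_inv, ← hP]
    omega
  have hC : (checkProg (b := b) e p c₀ c₁ c₂ ks).cost ≤ R + 1 + F := by
    refine (Prog.cost_bind_le _ _ (K := F) fun z => ?_).trans
      (Nat.add_le_add_right ((Prog.cost_measureAll _ _).trans hdamp.le) _)
    split_ifs
    · rw [cost_toProg, length_inv, Prog.cost, ← hF, add_zero]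
    · exact Nat.zero_le _
  have h2t : T * Y ^ 2 ≤ 2 ^ t * (T * Y ^ 2) := Nat.le_mul_of_pos_left _ (by positivity)
  refine (Prog.cost_randNat_le (K := 1 + (P + 2 ^ t * (48 * (T * Y ^ 2)) + (R + 1 + F))) _
    fun i hi => ?_).trans ?_
  · rw [Prog.cost, cost_toProg, List.length_append, length_iter, mul_zero, zero_add, ← hP]
    have : i * (grover e p c₀ c₁ c₂ ks lam).length ≤ 2 ^ t * (48 * (T * Y ^ 2)) :=
      Nat.mul_le_mul hi.le hG
    omega
  · have h3 : 2 ^ t * (48 * (T * Y ^ 2)) = 48 * (2 ^ t * (T * Y ^ 2)) := by ring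
    have h4 : 2 ^ t * T * Y ^ 2 = 2 ^ t * (T * Y ^ 2) := by ring
    rw [h3, h4]
    omega

end

theorem cost_prepByBisection_le {n q b s m a : ℕ} (e : Anc q b (s + 1 + q + 1) m ↪ Fin a)
    [Nontrivial (Fin q ⊕ Fin a)] {p t A : ℕ} {ks : List (Fin n)}
    (h : ∀ (D c₂ : ℤ) (θ : ℝ), (sampler (b := b) e p D c₂ ks θ t).cost ≤ A) (θ : ℝ) (K k : ℕ)
    (lo : ℤ) : (prepByBisection e p ks θ t K k lo).cost ≤ (k + 1) * (K * A) := by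
  have h1 : ∀ (D c₂ : ℤ) (θ : ℝ), (Prog.retry (sampler (b := b) e p D c₂ ks θ t) K).cost ≤ K * A :=
    fun D c₂ θ => (Prog.cost_retry_le _ _).trans (Nat.mul_le_mul_left _ (h D c₂ θ))
  induction k generalizing lo with
  | zero =>
    rw [prepByBisection]
    refine (Prog.cost_bind_le _ _ (K := 0) fun _ => by simp [Prog.cost]).trans ?_
    simpa using h1 lo (-1) θ
  | succ k ih =>
    rw [prepByBisection]
    refine (Prog.cost_bind_le _ _ (K := (k + 1) * (K * A)) fun ok => ?_).trans ?_
    · cases ok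
      · simpa using ih lo
      · simpa using ih (lo + 2 ^ k)
    · have := h1 (-(lo + 2 ^ k)) 1 0
      rw [add_mul (k + 1) 1, one_mul]
      omega

theorem cost_rounds_le {n b a T K : ℕ} [NeZero n]
    {prep : List (Fin n) → Prog (Wires n a) (idxLen n) b Unit}
    (h : ∀ ks : List (Fin n), ks.length < T → (prep ks).cost ≤ K) (t : ℕ) (ks : List (Fin n))
    (hks : ks.length + t ≤ T) : (rounds prep t ks).cost ≤ t * (1 + K + idxLen n) := by
  induction t generalizing ks with
  | zero => simp [rounds, Prog.cost]
  | succ t ih =>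
    rw [rounds, Prog.cost]
    have h1 : ∀ x : Fin (idxLen n) → Bool,
        (rounds prep t (ks ++ [Fin.ofNat n (Nat.ofBits x)])).cost ≤ t * (1 + K + idxLen n) :=
      fun x => ih _ (by simp; omega)
    have h2 := fun _ : Unit => Prog.cost_bind_le (Prog.measureAll (idxLen n) Sum.inl :
      Prog (Wires n a) (idxLen n) b _) _ h1
    have h3 := Prog.cost_bind_le (prep ks) _ h2
    have h4 := Prog.cost_measureAll (q := idxLen n) (b := b) (idxLen n)
      (Sum.inl : Fin (idxLen n) → Wires n a)
    have h5 := h ks (by omega)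
    rw [add_mul t 1, one_mul]
    omega

theorem cost_algorithm_le {n b a K : ℕ} {ε : ℝ} [NeZero n]
    {prep : List (Fin n) → Prog (Wires n a) (idxLen n) b Unit}
    (h : ∀ ks : List (Fin n), ks.length < numRounds n ε → (prep ks).cost ≤ K) :
    (algorithm ε prep).cost ≤ numRounds n ε * (1 + K + idxLen n) := by
  rw [algorithm]
  refine (Prog.cost_bind_le _ _ (K := 0) fun _ => by simp [Prog.cost]).trans ?_
  simpa using cost_rounds_le h (numRounds n ε) [] (by simp)

/-! ### Asymptotic bounds -/

/-- A number of bits that suffices for the entries in all rounds. As it also bounds the logarithms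
of `n`, of the number of rounds and of the inverse tolerance, all other register lengths are
proportional to it. -/
def precision (n : ℕ) (ε : ℝ) : ℕ := Nat.clog 2 (max n 27 * numRounds n ε ^ 2)

theorem le_two_pow_precision (n : ℕ) (ε : ℝ) :
    max n 27 * numRounds n ε ^ 2 ≤ 2 ^ precision n ε := Nat.le_pow_clog (by norm_num) _

theorem two_pow_clog_le {x : ℕ} (hx : 1 ≤ x) : 2 ^ Nat.clog 2 x ≤ 2 * x := by
  rcases hx.eq_or_lt with rfl | hx
  · simp
  · have h := Nat.pow_pred_clog_lt_self (b := 2) (by norm_num) hx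
    have h2 : 0 < Nat.clog 2 x := Nat.clog_pos (by norm_num) hx
    obtain ⟨k, hk⟩ := Nat.exists_eq_succ_of_ne_zero h2.ne'
    rw [hk] at h ⊢
    rw [Nat.pred_succ] at h
    rw [pow_succ]
    omega

/-- `√(2 ^ q)` for `q = ⌈log₂ n⌉` is of the order of `√n`. -/
theorem two_pow_half_idxLen_le (n : ℕ) [NeZero n] :
    (2 : ℝ) ^ (idxLen n / 2 + 1) ≤ 3 * √n := by
  have h1 : (2 : ℝ) ^ idxLen n ≤ 2 * n := by
    exact_mod_cast two_pow_clog_le (NeZero.one_le : 1 ≤ n)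
  refine (sq_le_sq₀ (by positivity) (by positivity)).1 ?_
  rw [mul_pow, Real.sq_sqrt (by positivity), ← pow_mul, add_mul, pow_add]
  have h2 : (2 : ℝ) ^ (idxLen n / 2 * 2) ≤ 2 ^ idxLen n :=
    pow_le_pow_right₀ (by norm_num) (Nat.div_mul_le_self _ _)
  have : (0 : ℝ) ≤ n := by positivity
  linarith

section

variable {n : ℕ} [NeZero n] {ε : ℝ}

theorem log_div_eq (n : ℕ) [NeZero n] (hε : 0 < ε) :
    Real.log (n / ε) = Real.log n + Real.log (1 / ε) := by
  have hn : (0 : ℝ) < n := by exact_mod_cast NeZero.pos n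
  rw [← Real.log_mul (by positivity) (by positivity), mul_one_div]

theorem log_one_div_nonneg (hε : 0 < ε) (hε1 : ε ≤ 1) : 0 ≤ Real.log (1 / ε) :=
  Real.log_nonneg (by rwa [le_div_iff₀ hε, one_mul])

theorem log_max_le (n : ℕ) [NeZero n] : Real.log (max n 27 : ℕ) ≤ 26 + Real.log n := by
  have hn : (1 : ℝ) ≤ n := by exact_mod_cast (NeZero.one_le : 1 ≤ n)
  have h1 : ((max n 27 : ℕ) : ℝ) ≤ 27 * n := by
    push_cast
    exact max_le (by linarith) (by linarith)
  have h2 : (0 : ℝ) < (max n 27 : ℕ) := by positivity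
  refine (Real.log_le_log h2 h1).trans ?_
  rw [Real.log_mul (by norm_num) (by positivity)]
  have := Real.log_le_sub_one_of_pos (show (0 : ℝ) < 27 by norm_num)
  linarith

theorem numRounds_le (hε : 0 < ε) (hε1 : ε ≤ 1) :
    (numRounds n ε : ℝ) ≤ 105 * (1 + Real.log (n / ε)) / ε ^ 2 := by
  have h1 := log_div_eq n hε
  have h2 := Real.log_natCast_nonneg n
  have h3 := log_one_div_nonneg hε hε1
  have h4 := log_max_le n
  have h5 : 0 ≤ Real.log (max n 27 : ℕ) := Real.log_natCast_nonneg _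
  have hε2 : ε ^ 2 ≤ 1 := pow_le_one₀ hε.le hε1
  refine (Nat.ceil_lt_add_one (by positivity)).le.trans ?_
  have h6 : (1 : ℝ) ≤ 1 / ε ^ 2 := by rw [le_div_iff₀ (by positivity), one_mul]; exact hε2
  calc 4 * Real.log (max n 27 : ℕ) / ε ^ 2 + 1
      ≤ 4 * Real.log (max n 27 : ℕ) / ε ^ 2 + 1 / ε ^ 2 := by linarith
    _ = (4 * Real.log (max n 27 : ℕ) + 1) / ε ^ 2 := by rw [add_div]
    _ ≤ _ := by
      refine div_le_div_of_nonneg_right ?_ (by positivity)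
      linarith

theorem precision_le (hε : 0 < ε) (hε1 : ε ≤ 1) :
    (precision n ε : ℝ) ≤ 482 * (1 + Real.log (n / ε)) := by
  have h1 := log_div_eq n hε
  have h2 := Real.log_natCast_nonneg n
  have h3 := log_one_div_nonneg hε hε1
  have h4 := log_max_le n
  have hT := numRounds_le (n := n) hε hε1
  have hT0 := numRounds_pos n hε
  set Λ := 1 + Real.log (n / ε) with hΛ
  have hΛ1 : 1 ≤ Λ := by linarith
  set T := numRounds n ε
  have hT0' : (0 : ℝ) < T := by exact_mod_cast hT0
  have hN0 : (0 : ℝ) < (max n 27 : ℕ) := by positivity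
  have h5 : (2 : ℝ) ^ precision n ε ≤ 2 * ((max n 27 : ℕ) * T ^ 2) := by
    exact_mod_cast two_pow_clog_le (x := max n 27 * T ^ 2)
        (Nat.one_le_iff_ne_zero.2 (by positivity))
  have h6 := Real.log_le_log (by positivity) h5
  rw [Real.log_pow, Real.log_mul (by norm_num) (by positivity), Real.log_mul (by positivity)
    (by positivity), Real.log_pow] at h6
  have h7 : Real.log T ≤ 104 + 3 * Λ := by
    refine (Real.log_le_log hT0' hT).trans ?_
    have h8 : 105 * Λ / ε ^ 2 = 105 * (Λ * (1 / ε) ^ 2) := by field_simp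
    rw [h8, Real.log_mul (by norm_num) (by positivity), Real.log_mul (by positivity)
      (by positivity), Real.log_pow]
    have h9 := Real.log_le_sub_one_of_pos (show (0 : ℝ) < 105 by norm_num)
    have h10 := Real.log_le_sub_one_of_pos (show (0 : ℝ) < Λ by linarith)
    push_cast
    linarith
  have h11 := Real.log_two_gt_d9
  have h12 := Real.log_two_lt_d9
  have h13 : (precision n ε : ℝ) * (1 / 2) ≤ precision n ε * Real.log 2 :=
    mul_le_mul_of_nonneg_left (by linarith) (by positivity)
  push_cast at h4 h6
  linarith

end

/-! ### The state preparation of the theorem -/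

theorem nontrivial_wires {q b R m a : ℕ} (e : Anc q b R m ↪ Fin a) : Nontrivial (Fin q ⊕ Fin a) :=
  ⟨⟨coinW e, tstW e 0, by simp [coinW, tstW]⟩⟩

theorem one_le_precision (n : ℕ) {ε : ℝ} (hε : 0 < ε) : 1 ≤ precision n ε := by
  refine Nat.clog_pos (by norm_num) ?_
  have := numRounds_pos n hε
  have h1 : 1 ≤ numRounds n ε ^ 2 := Nat.one_le_pow _ _ this
  have h2 : 27 ≤ max n 27 := le_max_right _ _
  nlinarith

theorem idxLen_le_precision (n : ℕ) {ε : ℝ} (hε : 0 < ε) : idxLen n ≤ precision n ε := by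
  have := numRounds_pos n hε
  refine Nat.clog_mono_right 2 (le_trans (le_max_left n 27) ?_)
  exact Nat.le_mul_of_pos_right _ (by positivity)

/-- With all register lengths proportional to `precision n ε`, bisection is a state preparation, and
its cost is of the order of `√n` times the number of rounds, up to logarithmic factors. -/
theorem exists_isStatePrep (n : ℕ) [NeZero n] {ε : ℝ} (hε : 0 < ε) (hε1 : ε ≤ 1) (b : ℕ) :
    ∃ (a : ℕ) (prep : List (Fin n) → Prog (Wires n a) (idxLen n) b Unit),
      (∀ X : Matrix (Fin n) (Fin n) ℝ, IsInput b X → IsStatePrep X ε prep) ∧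
      ∀ ks : List (Fin n), ks.length < numRounds n ε → (prep ks).cost ≤
        84 * (2 ^ (idxLen n / 2 + 1) * numRounds n ε * (12 * (precision n ε + 1)) ^ 4) := by
  set P := precision n ε with hP
  have hP1 : 1 ≤ P := one_le_precision n hε
  set T := numRounds n ε with hT
  have hT1 : 1 ≤ T := numRounds_pos n hε
  have hNT : max n 27 * T ^ 2 ≤ 2 ^ P := le_two_pow_precision n ε
  have hN1 : 1 ≤ max n 27 := le_max_of_le_right (by norm_num)
  have hTT : T ≤ T ^ 2 := Nat.le_self_pow two_ne_zero T
  have hT2 : T ≤ 2 ^ P := by nlinarith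
  set q := idxLen n with hq
  have hqP : q ≤ P := idxLen_le_precision n hε
  set p := min P b with hp
  have hpP : p ≤ P := min_le_left _ _
  -- The truncated scores lie between `-T 2 ^ p` and `T 2 ^ p`, an interval of length below `2 ^ k`.
  set k := p + P + 2 with hk
  set m := q + 2 * (k + 1 + 1 + q + 1) + 1 with hm
  let e := ancEmb q b (k + 1 + 1 + q + 1) m
  have := nontrivial_wires e
  refine ⟨_, fun ks => prepByBisection e p ks (ε / (4 * 2 ^ p)) (q / 2 + 1) (3 * (k + 1 + P)) k
    (-(T * 2 ^ p : ℕ)), fun X hX => ?_, fun ks hks => ?_⟩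
  · refine isStatePrep_prepByBisection hX hε hε1 e hNT ?_ hm.ge (by omega) ?_
    · calc 4 * (T * 2 ^ p) ≤ 4 * (2 ^ P * 2 ^ p) := by gcongr
        _ = 2 ^ k := by rw [hk, pow_add, pow_add]; ring
    · -- Each block of three attempts halves the probability of failure.
      have h1 : ((3 : ℝ) / 4) ^ (3 * (k + 1 + P)) ≤ (1 / 2) ^ (k + 1 + P) := by
        rw [pow_mul]
        exact pow_le_pow_left₀ (by norm_num) (by norm_num) _
      have h2 : ((k : ℝ) + 1) ≤ 2 ^ (k + 1) := by
        exact_mod_cast (Nat.lt_two_pow_self (n := k + 1)).le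
      have h3 : ((max n 27 : ℕ) : ℝ) * T ≤ 2 ^ P := by
        exact_mod_cast (Nat.mul_le_mul_left _ hTT).trans hNT
      have hTpos : (0 : ℝ) < T := by exact_mod_cast hT1
      calc ((k : ℝ) + 1) * (3 / 4) ^ (3 * (k + 1 + P)) ≤ 2 ^ (k + 1) * (1 / 2) ^ (k + 1 + P) := by
            gcongr
        _ = 1 / 2 ^ P := by rw [pow_add (1 / 2 : ℝ), one_div_pow, one_div_pow]; field_simp
        _ ≤ tolerance n ε := by
            rw [tolerance, ← hT]
            exact one_div_le_one_div_of_le (by positivity) h3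
  · set Y := 12 * (P + 1) with hY
    refine (cost_prepByBisection_le e (A := 84 * (2 ^ (q / 2 + 1) * T * Y ^ 2))
      (fun D c₂ θ => cost_attempt_le e hks.le hT1 (by omega) (by omega) (by omega) (by omega)
        (by omega) hm.ge _ _ _ _) _ _ _ _).trans ?_
    calc (k + 1) * (3 * (k + 1 + P) * (84 * (2 ^ (q / 2 + 1) * T * Y ^ 2)))
        ≤ Y * (Y * (84 * (2 ^ (q / 2 + 1) * T * Y ^ 2))) := by gcongr <;> omega
      _ = _ := by ring

end

end ZeroSum

end

theorem theorem4p2 :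
    (∀ (n : ℕ) [NeZero n] (ε : ℝ), 0 < ε → ∀ (b a : ℕ) (X : Matrix (Fin n) (Fin n) ℝ),
      ZeroSum.IsInput b X →
      ∀ prep : List (Fin n) → ZeroSum.Prog (ZeroSum.Wires n a) (ZeroSum.idxLen n) b Unit,
        ZeroSum.IsStatePrep X ε prep → 2 / 3 ≤ ZeroSum.successProb X ε prep) ∧
    ∃ (C : ℝ) (c : ℕ), ∀ (n : ℕ) [NeZero n] (ε : ℝ), 0 < ε → ε ≤ 1 → ∀ b : ℕ,
      ∃ (a : ℕ) (prep : List (Fin n) → ZeroSum.Prog (ZeroSum.Wires n a) (ZeroSum.idxLen n) b Unit),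
        (∀ X : Matrix (Fin n) (Fin n) ℝ, ZeroSum.IsInput b X →
          ZeroSum.IsStatePrep X ε prep ∧ 2 / 3 ≤ ZeroSum.successProb X ε prep) ∧
        ((ZeroSum.algorithm ε prep).cost : ℝ) ≤
          C * (√n / ε ^ 4) * (1 + Real.log (n / ε)) ^ c := by
  -- In `C`, the factor `3` bounds the number of iterations (`two_pow_half_idxLen_le`), `105` each
  -- of two factors `T` (`numRounds_le`), and `5796 = 12 * (482 + 1)` each of four register lengths
  -- (`precision_le`).
  refine ⟨fun n _ ε hε b a X hX prep hprep => ZeroSum.two_thirds_le_successProb hX hε hprep,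
    86 * 3 * 105 ^ 2 * 5796 ^ 4, 6, fun n _ ε hε hε1 b => ?_⟩
  obtain ⟨a, prep, hprep, hcost⟩ := ZeroSum.exists_isStatePrep n hε hε1 b
  refine ⟨a, prep, fun X hX => ⟨hprep X hX,
    ZeroSum.two_thirds_le_successProb hX hε (hprep X hX)⟩, ?_⟩
  have hlog := ZeroSum.log_div_eq n hε
  have hn0 := Real.log_natCast_nonneg n
  have hε0 := ZeroSum.log_one_div_nonneg hε hε1
  have hTb := ZeroSum.numRounds_le (n := n) hε hε1
  have hPb := ZeroSum.precision_le (n := n) hε hε1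
  have h2b := ZeroSum.two_pow_half_idxLen_le n
  have hT1 : 1 ≤ ZeroSum.numRounds n ε := ZeroSum.numRounds_pos n hε
  have hqP := ZeroSum.idxLen_le_precision n hε
  have hle := ZeroSum.cost_algorithm_le hcost
  set Λ := 1 + Real.log (n / ε) with hΛ
  set T := ZeroSum.numRounds n ε
  set Y := 12 * (ZeroSum.precision n ε + 1) with hY
  set G := 2 ^ (ZeroSum.idxLen n / 2 + 1) * T * Y ^ 4 with hG
  have hYG : Y ≤ G := by
    have h1 : Y ≤ Y ^ 4 := Nat.le_self_pow (by norm_num) Y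
    exact h1.trans (Nat.le_mul_of_pos_left _ (by positivity))
  have hle' : (ZeroSum.algorithm ε prep).cost ≤ T * (86 * G) :=
    hle.trans (Nat.mul_le_mul_left _ (by omega))
  have hYb : (Y : ℝ) ≤ 5796 * Λ := by
    rw [hY]; push_cast; linarith
  calc ((ZeroSum.algorithm ε prep).cost : ℝ)
      ≤ T * (86 * (2 ^ (ZeroSum.idxLen n / 2 + 1) * T * Y ^ 4)) := by exact_mod_cast hle'
    _ ≤ 105 * Λ / ε ^ 2 * (86 * (3 * √n * (105 * Λ / ε ^ 2) * (5796 * Λ) ^ 4)) := by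
      have hΛ0 : 0 ≤ Λ := by linarith
      gcongr
    _ = _ := by field_simp
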